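/- **Setting (SEA model).** Let $\mathcal X\subseteq\mathbb R^d$ be a closed convex set with $0\in\mathcal X$, possibly unbounded. In each round $t=1,2,\dots,T$ the learner plays $x_t\in\mathcal X$; nature chooses, possibly depending on the past, a distribution $\mathcal D_t$ over loss functions that are differentiable on $\mathcal X$; a loss $f_t\sim\mathcal D_t$ is drawn and the learner observes $g_t=\nabla f_t(x_t)$. Put $F_t(x)=\mathbb E_{f\sim\mathcal D_t}[f(x)]$, $\nabla F_t(x)=\mathbb E_{f\sim\mathcal D_t}[\nabla f(x)]$, $\nabla F_0=0$, and $$\sigma_{1:T}^2=\mathbb E\sum_{t=1}^T\sup_{x\in\mathcal X}\mathbb E_{f\sim\mathcal D_t}\|\nabla f(x)-\nabla F_t(x)\|_2^2,\qquad \sigma_{1:T}=\mathbb E\sum_{t=1}^T\sup_{x\in\mathcal X}\mathbb E_{f\sim\mathcal D_t}\|\nabla f(x)-\nabla F_t(x)\|_2,$$ $$\Sigma_{1:T}^2=\mathbb E\sum_{t=1}^T\sup_{x\in\mathcal X}\|\nabla F_t(x)-\nabla F_{t-1}(x)\|_2^2,\qquad \mathfrak G_{1:T}=\mathbb E\sum_{t=1}^T\sup_{x\in\mathcal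 X}\|\nabla F_t(x)\|_2 .$$ **Algorithm (CLA-OONS), with input $B_0>0$ only.** Start with $D_1=1$, $z_1=B_0$, $x_1'=0$, $m_1=0$, and let the first epoch start in round $t_1=1$. In round $t$, where $t_1$ is the first round of the current epoch, put $\mathcal X_t=\{x\in\mathcal X:\|x\|_2\le D_t\}$, $$\eta_t=\min\Big\{\frac1{64D_tz_t},\frac1{\sqrt{\sum_{s=t_1}^{t-1}\|\tilde g_s-m_s\|_2^2}}\Big\},\qquad A_t=4z_{t_1}^2I+\sum_{s=t_1}^{t-1}\eta_s(\nabla_s-m_s)(\nabla_s-m_s)^\top+4\eta_tz_t^2I$$ (with $1/0=\infty$), play $x_t=\arg\min_{x\in\mathcal X_t}\{\langle x,m_t\rangle+\frac12\|x-x_t'\|_{A_t}^2\}$, where $\|v\|_A^2=v^\top Av$, and observe $g_t=\nabla f_t(x_t)$. Put $B_t=\max\{B_{t-1},\|g_t-m_t\|_2\}$, $\tilde g_t=m_t+\frac{B_{t-1}}{B_t}(g_t-m_t)$, $\nabla_t=\tilde g_t+32\eta_t\langle x_t,\tilde g_t-m_t\rangle(\tilde g_t-m_t)$, $m_{t+1}=g_t$,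 $z_{t+1}=B_t$ and $S_t=\sum_{s=1}^t\frac{\|g_s\|_2}{\max\{1,\max_{k\le s}\|g_k\|_2\}}$. If $D_t<\sqrt{S_t}$, set $D_{t+1}=2\sqrt{S_t}$ and $x_{t+1}'=0$, and start a new epoch in round $t+1$. Otherwise set $D_{t+1}=D_t$ and $x_{t+1}'=\arg\min_{x\in\mathcal X_t}\{\langle x,\nabla_t\rangle+\frac12\|x-x_t'\|_{A_t}^2\}$. **Theorem.** Let $d\in\mathbb N$, $L\ge0$, $B_0>0$ and $G_0>0$. There are constants $C$ and $k$, depending only on $d,L,B_0,G_0$, such that the following holds. Let $G\ge G_0$ (unknown to the algorithm) be such that all loss functions satisfy $\|\nabla f(x)\|_2\le G$ for $x\in\mathcal X$, and let every $F_t$ ($1\le t\le T$) be convex on $\mathcal X$ with $\|\nabla F_t(x)-\nabla F_t(y)\|_2\le L\|x-y\|_2$ for all $x,y\in\mathcal X$. Then for every $T$ and every $u\in\mathcal X$ the regret $\mathfrak R_T(u)=\sum_{t=1}^Tf_t(x_t)-\sum_{t=1}^Tf_t(u)$ of CLA-OONS is integrable and $$\mathbb E[\mathfrak R_T(u)]\le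 C(1+\log T)^k\Big(\|u\|_2^2\big(\sqrt{\sigma_{1:T}^2}+\sqrt{\Sigma_{1:T}^2}\big)+G^2\|u\|_2^2+\|u\|_2^4+G\|u\|_2^3+G^2\sqrt{\sigma_{1:T}+\mathfrak G_{1:T}}\Big).$$ (For $T=0$ read $\log T$ as $0$.) -/

import Mathlib

open MeasureTheory ProbabilityTheory

noncomputable section

namespace CLAOONS

/-- The ambient space `ℝ^d` with its Euclidean norm. -/
abbrev E (d : ℕ) : Type := EuclideanSpace ℝ (Fin d)

/-! ### The algorithm

Rounds are numbered `0, 1, 2, …`. An epoch is a maximal block of consecutive rounds without a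
restart. -/

/-- `‖x‖_A ^ 2 = xᵀ A x`. -/
def sqNorm {d : ℕ} (A : Matrix (Fin d) (Fin d) ℝ) (x : E d) : ℝ :=
  x.ofLp ⬝ᵥ (A.mulVec x.ofLp)

/-- The Bregman divergence of `ψ(x) = ‖x‖_A ^ 2 / 2`, for a symmetric matrix `A`. -/
def breg {d : ℕ} (A : Matrix (Fin d) (Fin d) ℝ) (x y : E d) : ℝ :=
  (1 / 2) * sqNorm A (x - y)

open Classical in
/-- A minimizer of `φ` over `K` (the value `0` is used only if there is none). -/
def argminOn {d : ℕ} (φ : E d → ℝ) (K : Set (E d)) : E d :=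
  if h : ∃ x ∈ K, IsMinOn φ K x then h.choose else 0

/-- What the learner remembers at the beginning of a round `t`. -/
structure State (d : ℕ) where
  /-- the current domain radius `D_t` -/
  D : ℝ
  /-- the current range hint `z_t = B_{t-1} = max (B₀, max_{s<t} ‖g_s - m_s‖)` -/
  z : ℝ
  /-- the range hint at the first round of the current epoch -/
  zStart : ℝ
  /-- the secondary iterate `x'_t` -/
  x' : E d
  /-- `∑ η_s (∇_s - m_s)(∇_s - m_s)ᵀ` over the past rounds `s` of the current epoch -/
  H : Matrix (Fin d) (Fin d) ℝ
  /-- `∑ ‖g̃_s - m_s‖ ^ 2` over the past rounds `s` of the current epoch -/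
  V : ℝ
  /-- the optimistic prediction `m_t = g_{t-1}` (`0` in the very first round) -/
  m : E d
  /-- `max_{s<t} ‖g_s‖` over all past rounds (`0` in the very first round) -/
  N : ℝ
  /-- `∑_{s<t} ‖g_s‖ / max (1, max_{k≤s} ‖g_k‖)` over all past rounds -/
  S : ℝ

/-- The state before the first round. -/
def init (d : ℕ) (B₀ : ℝ) : State d where
  D := 1
  z := B₀
  zStart := B₀
  x' := 0
  H := 0
  V := 0
  m := 0
  N := 0
  S := 0

namespace State

variable {d : ℕ} (s : State d)

/-- The bounded domain of the current round, `{x ∈ 𝒳 : ‖x‖ ≤ D_t}`. -/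
def domain (𝒳 : Set (E d)) : Set (E d) := {x | x ∈ 𝒳 ∧ ‖x‖ ≤ s.D}

/-- The step size `η_t = min (1 / (64 D_t z_t), 1 / √V)`, where `1 / √V` is read as `+∞` for
`V = 0`. -/
def eta : ℝ := 1 / max (64 * s.D * s.z) (Real.sqrt s.V)

/-- The matrix `A_t = 4 z_start² I + ∑ η_s (∇_s - m_s)(∇_s - m_s)ᵀ + 4 η_t z_t² I`. -/
def A : Matrix (Fin d) (Fin d) ℝ :=
  (4 * s.zStart ^ 2) • (1 : Matrix (Fin d) (Fin d) ℝ) + s.H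
    + (4 * s.eta * s.z ^ 2) • (1 : Matrix (Fin d) (Fin d) ℝ)

/-- The decision `x_t`. -/
def play (𝒳 : Set (E d)) : E d :=
  argminOn (fun x => inner ℝ x s.m + breg s.A x s.x') (s.domain 𝒳)

/-- The new range `B_t` after the gradient `g_t` has been seen. -/
def newB (g : E d) : ℝ := max s.z ‖g - s.m‖

/-- The truncated gradient `g̃_t = m_t + (B_{t-1} / B_t) (g_t - m_t)`. -/
def clip (g : E d) : E d := s.m + (s.z / s.newB g) • (g - s.m)

/-- The corrected gradient `∇_t = g̃_t + 32 η_t ⟨x_t, g̃_t - m_t⟩ (g̃_t - m_t)`. -/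
def corrected (𝒳 : Set (E d)) (g : E d) : E d :=
  s.clip g + (32 * s.eta * inner ℝ (s.play 𝒳) (s.clip g - s.m)) • (s.clip g - s.m)

/-- The ordinary update `x'_{t+1}`. -/
def nextX' (𝒳 : Set (E d)) (g : E d) : E d :=
  argminOn (fun x => inner ℝ x (s.corrected 𝒳 g) + breg s.A x s.x') (s.domain 𝒳)

/-- `max_{k≤t} ‖g_k‖`. -/
def newN (g : E d) : ℝ := max s.N ‖g‖

/-- `∑_{s≤t} ‖g_s‖ / max (1, max_{k≤s} ‖g_k‖)`. -/
def newS (g : E d) : ℝ := s.S + ‖g‖ / max 1 (s.newN g)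

open Classical in
/-- One round: the learner has played `s.play 𝒳` and sees the gradient `g` of the loss there.
If `D_t` is too small, the radius is reset and a new epoch starts. -/
def step (𝒳 : Set (E d)) (g : E d) : State d :=
  if s.D < Real.sqrt (s.newS g) then
    { D := 2 * Real.sqrt (s.newS g)
      z := s.newB g
      zStart := s.newB g
      x' := 0
      H := 0
      V := 0
      m := g
      N := s.newN g
      S := s.newS g }
  else
    { D := s.D
      z := s.newB g
      zStart := s.zStart
      x' := s.nextX' 𝒳 g
      H := s.H + s.eta • Matrix.vecMulVec (s.corrected 𝒳 g - s.m).ofLp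
        (s.corrected 𝒳 g - s.m).ofLp
      V := s.V + ‖s.clip g - s.m‖ ^ 2
      m := g
      N := s.newN g
      S := s.newS g }

end State

/-- The state of the algorithm at the beginning of round `t`, when the losses are `f 0, f 1, …`.
The losses are only accessed through the gradients `∇ (f t) (x_t)` at the points played. -/
def run {d : ℕ} (𝒳 : Set (E d)) (B₀ : ℝ) (f : ℕ → E d → ℝ) : ℕ → State d
  | 0 => init d B₀
  | t + 1 => (run 𝒳 B₀ f t).step 𝒳 (gradient (f t) ((run 𝒳 B₀ f t).play 𝒳))

/-- The decision `x_t` of the algorithm against the losses `f 0, f 1, …`. -/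
def decision {d : ℕ} (𝒳 : Set (E d)) (B₀ : ℝ) (f : ℕ → E d → ℝ) (t : ℕ) : E d :=
  (run 𝒳 B₀ f t).play 𝒳

/-! ### The stochastically extended adversarial model -/

/-- A stochastically extended adversarial environment. Loss functions on `ℝ^d` are labelled by the
elements of `Ξ`. Before round `t` nature chooses, depending on the past `ℱ t`, a distribution
`𝒟 t ω` of labels; then the label `ξ t` of the loss of round `t` is drawn from it. -/
structure SEA (d : ℕ) (Ω Ξ : Type*) [mΩ : MeasurableSpace Ω] [mΞ : MeasurableSpace Ξ]
    (μ : Measure Ω) where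
  /-- the loss function with a given label -/
  loss : Ξ → E d → ℝ
  measurable_loss : Measurable (Function.uncurry loss)
  /-- the information available before round `t` -/
  ℱ : Filtration ℕ mΩ
  /-- the label of the loss function of round `t` -/
  ξ : ℕ → Ω → Ξ
  measurable_ξ : ∀ t, Measurable[ℱ (t + 1)] (ξ t)
  /-- the distribution that nature chooses in round `t` -/
  𝒟 : ∀ t, @Kernel Ω Ξ (ℱ t) mΞ
  isProb : ∀ t ω, IsProbabilityMeasure (𝒟 t ω)
  /-- given the past, the label of round `t` has distribution `𝒟 t` -/
  cond_law : ∀ t (s : Set Ξ), MeasurableSet s →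
    μ[(ξ t ⁻¹' s).indicator (fun _ => (1 : ℝ)) | ℱ t] =ᵐ[μ] fun ω => (𝒟 t ω).real s

namespace SEA

variable {d : ℕ} {Ω Ξ : Type*} [MeasurableSpace Ω] [MeasurableSpace Ξ] {μ : Measure Ω}
  (M : SEA d Ω Ξ μ)

/-- The random loss function `f_t`. -/
def f (ω : Ω) (t : ℕ) : E d → ℝ := M.loss (M.ξ t ω)

/-- The (conditional) expected function `F_t(x) = 𝔼_{f ∼ 𝒟_t} f(x)`. -/
def F (ω : Ω) (t : ℕ) (x : E d) : ℝ := ∫ ζ, M.loss ζ x ∂(M.𝒟 t ω)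

/-- The expected gradient `∇F_t(x) = 𝔼_{f ∼ 𝒟_t} ∇f(x)`. -/
def gradF (ω : Ω) (t : ℕ) (x : E d) : E d := ∫ ζ, gradient (M.loss ζ) x ∂(M.𝒟 t ω)

/-- The expected gradient of the round before `t`, which is `0` for the first round. -/
def prevGradF (ω : Ω) : ℕ → E d → E d
  | 0 => 0
  | t + 1 => M.gradF ω t

/-- The loss functions are differentiable on `𝒳`, and all their gradient norms there are at
most `G`. -/
def BoundedGradients (𝒳 : Set (E d)) (G : ℝ) : Prop :=
  ∀ ζ, ∀ x ∈ 𝒳, DifferentiableAt ℝ (M.loss ζ) x ∧ ‖gradient (M.loss ζ) x‖ ≤ G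

/-- The expected functions of the first `T` rounds are `L`-smooth over `𝒳`. -/
def Smooth (𝒳 : Set (E d)) (L : ℝ) (T : ℕ) : Prop :=
  ∀ t < T, ∀ᵐ ω ∂μ, ∀ x ∈ 𝒳, ∀ y ∈ 𝒳, ‖M.gradF ω t x - M.gradF ω t y‖ ≤ L * ‖x - y‖

/-- The expected functions of the first `T` rounds are well defined and convex on `𝒳`. -/
def Convex (𝒳 : Set (E d)) (T : ℕ) : Prop :=
  ∀ t < T, ∀ᵐ ω ∂μ, (∀ x ∈ 𝒳, Integrable (fun ζ => M.loss ζ x) (M.𝒟 t ω)) ∧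
    ConvexOn ℝ 𝒳 (M.F ω t)

/-- `σ²_{1:T} = 𝔼 ∑_t sup_{x ∈ 𝒳} 𝔼_{f ∼ 𝒟_t} ‖∇f(x) - ∇F_t(x)‖²`. -/
def cumVariance (𝒳 : Set (E d)) (T : ℕ) : ENNReal :=
  ∫⁻ ω, ∑ t ∈ Finset.range T, ⨆ x ∈ 𝒳,
    ∫⁻ ζ, ‖gradient (M.loss ζ) x - M.gradF ω t x‖ₑ ^ 2 ∂(M.𝒟 t ω) ∂μ

/-- `σ_{1:T} = 𝔼 ∑_t sup_{x ∈ 𝒳} 𝔼_{f ∼ 𝒟_t} ‖∇f(x) - ∇F_t(x)‖`. -/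
def cumDeviation (𝒳 : Set (E d)) (T : ℕ) : ENNReal :=
  ∫⁻ ω, ∑ t ∈ Finset.range T, ⨆ x ∈ 𝒳,
    ∫⁻ ζ, ‖gradient (M.loss ζ) x - M.gradF ω t x‖ₑ ∂(M.𝒟 t ω) ∂μ

/-- `Σ²_{1:T} = 𝔼 ∑_t sup_{x ∈ 𝒳} ‖∇F_t(x) - ∇F_{t-1}(x)‖²`. -/
def cumVariation (𝒳 : Set (E d)) (T : ℕ) : ENNReal :=
  ∫⁻ ω, ∑ t ∈ Finset.range T, ⨆ x ∈ 𝒳, ‖M.gradF ω t x - M.prevGradF ω t x‖ₑ ^ 2 ∂μ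

/-- `𝔊_{1:T} = 𝔼 ∑_t sup_{x ∈ 𝒳} ‖∇F_t(x)‖`. -/
def cumMaxGrad (𝒳 : Set (E d)) (T : ℕ) : ENNReal :=
  ∫⁻ ω, ∑ t ∈ Finset.range T, ⨆ x ∈ 𝒳, ‖M.gradF ω t x‖ₑ ∂μ

/-- The regret `∑_{t<T} f_t(x_t) - ∑_{t<T} f_t(u)` of the algorithm with initial scale `B₀`. -/
def regret (𝒳 : Set (E d)) (B₀ : ℝ) (T : ℕ) (u : E d) (ω : Ω) : ℝ :=
  ∑ t ∈ Finset.range T, M.f ω t (decision 𝒳 B₀ (M.f ω) t) - ∑ t ∈ Finset.range T, M.f ω t u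

end SEA

end CLAOONS

end

/-! The core is deterministic: `exists_pathwise_regret_bound` bounds ∑⟨g_t, x_t - u⟩ for every
gradient sequence of norm at most `G` and all vectors p_t, q_t with ‖q_{t+1} - p_t‖ ≤ L‖x_{t+1} -
x_t‖. It is applied with p_t = ∇F_t(x_t) and q_t = ∇F_{t-1}(x_t), for which smoothness supplies the
condition.

One round (`State.Valid.regret_step_le`). The three-point inequalities of the two minimizations
bound the round by the decrease of the divergence from x'_t to u, minus the movement of the
iterates, plus the stability term ⟨∇_t - m_t, x_t - x'_{t+1}⟩ and the growth of A_t. Stability is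
paid by the growth of a log determinant (`inv_form_le_log_det`). The correction inside ∇_t
contributes -32η⟨x_t, g̃_t - m_t⟩², which dominates all other quadratic terms in x_t; only η⟨u, g̃_t
- m_t⟩² survives, and its sum is of order ‖u‖²√V with V = ∑‖g̃_t - m_t‖². Clipping costs a multiple
of D(B_t - B_{t-1}), which telescopes. A term -B₀² · movement is kept.

Epochs. A round is active if D > 1 and ‖u‖ ≤ D. Over the active rounds the potential telescopes,
with a bounded loss at each of the at most 1 + log T restarts. In an inactive round D ≤ max(1, ‖u‖),
and the invariant S ≤ D² makes the total gradient norm of these rounds small.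

The quantity V is estimated twice. Next to ‖u‖² it is split into noise, variation and L² · movement,
and the movement is absorbed by the negative term, which produces ‖u‖⁴. Next to the log determinant
it is at most 4G∑‖g_t‖.

Expectation. The decision is determined by the past, so convexity of F_t bounds the expected regret
by the expected linearized regret although single losses may be nonconvex. Jensen's inequality moves
the expectation inside the square roots, and replacing x_t by a supremum over 𝒳 gives the cumulative
quantities. -/

noncomputable section

namespace CLAOONS

/-! ### Quadratic forms: the three-point inequality and log determinants. -/

section QuadraticForms

variable {d : ℕ}

lemma inner_eq_dotProduct (x y : E d) : inner ℝ x y = x.ofLp ⬝ᵥ y.ofLp := by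
  simp [EuclideanSpace.inner_eq_star_dotProduct, dotProduct_comm]

lemma sqNorm_add (A B : Matrix (Fin d) (Fin d) ℝ) (x : E d) :
    sqNorm (A + B) x = sqNorm A x + sqNorm B x := by
  simp [sqNorm, Matrix.add_mulVec, dotProduct_add]

lemma sqNorm_smul (c : ℝ) (A : Matrix (Fin d) (Fin d) ℝ) (x : E d) :
    sqNorm (c • A) x = c * sqNorm A x := by
  simp [sqNorm, Matrix.smul_mulVec, dotProduct_smul]

lemma sqNorm_one (x : E d) : sqNorm 1 x = ‖x‖ ^ 2 := by
  rw [sqNorm, Matrix.one_mulVec, ← inner_eq_dotProduct, real_inner_self_eq_norm_sq]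

lemma sqNorm_vecMulVec (v x : E d) :
    sqNorm (Matrix.vecMulVec v.ofLp v.ofLp) x = (inner ℝ v x) ^ 2 := by
  rw [sqNorm, Matrix.vecMulVec_mulVec, inner_eq_dotProduct]
  simp [dotProduct_smul, dotProduct_comm x.ofLp v.ofLp, sq]

lemma sqNorm_nonneg_of_posSemidef {A : Matrix (Fin d) (Fin d) ℝ} (hA : A.PosSemidef) (x : E d) :
    0 ≤ sqNorm A x := by
  simpa [sqNorm] using hA.dotProduct_mulVec_nonneg x.ofLp

lemma sqNorm_convex_comb (A : Matrix (Fin d) (Fin d) ℝ) (a b : E d) (s : ℝ) :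
    sqNorm A (a + s • (b - a))
      = (1 - s) * sqNorm A a + s * sqNorm A b - s * (1 - s) * sqNorm A (b - a) := by
  simp only [sqNorm, WithLp.ofLp_add, WithLp.ofLp_sub, WithLp.ofLp_smul, Matrix.mulVec_add,
    Matrix.mulVec_sub, Matrix.mulVec_smul, dotProduct_add, dotProduct_sub, dotProduct_smul,
    add_dotProduct, sub_dotProduct, smul_dotProduct, smul_eq_mul]
  ring

lemma continuous_sqNorm (A : Matrix (Fin d) (Fin d) ℝ) : Continuous (sqNorm A) := by
  unfold sqNorm
  have : Continuous fun x : E d => x.ofLp := PiLp.continuous_ofLp 2 _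
  exact this.dotProduct (continuous_const.matrix_mulVec this)

/-- A minimizer over a convex set of a linear function plus a quadratic form beats every competitor
by at least the divergence between them. -/
lemma three_point {K : Set (E d)} (hK : Convex ℝ K) {A : Matrix (Fin d) (Fin d) ℝ}
    {m c x y : E d} (hx : x ∈ K) (hy : y ∈ K)
    (hmin : IsMinOn (fun w => inner ℝ w m + breg A w c) K x) :
    inner ℝ x m + breg A x c + breg A y x ≤ inner ℝ y m + breg A y c := by
  -- Compare `x` with the point at parameter `s` of the segment to `y`. The form deviates from its
  -- linear interpolation by the factor s(1 - s); dividing by s and letting s → 0 gives the full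
  -- divergence.
  have key : ∀ s : ℝ, 0 < s → s < 1 →
      (1 - s) * breg A y x ≤ inner ℝ y m + breg A y c - (inner ℝ x m + breg A x c) := by
    intro s hs hs1
    have hmem : x + s • (y - x) ∈ K := by
      have := hK hx hy (by linarith : 0 ≤ 1 - s) hs.le (by ring)
      convert this using 1
      module
    have h1 := hmin hmem
    simp only [Set.mem_ofPred_eq, breg] at h1 ⊢
    have h2 : x + s • (y - x) - c = (x - c) + s • ((y - c) - (x - c)) := by module
    rw [h2, sqNorm_convex_comb, inner_add_left, inner_smul_left, inner_sub_left] at h1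
    have h3 : y - c - (x - c) = y - x := by abel
    rw [h3] at h1
    simp only [conj_trivial] at h1
    have : 0 ≤ s * ((inner ℝ y m + 1 / 2 * sqNorm A (y - c)
        - (inner ℝ x m + 1 / 2 * sqNorm A (x - c))) - (1 - s) * (1 / 2 * sqNorm A (y - x))) := by
      linarith
    have := nonneg_of_mul_nonneg_right this hs
    linarith
  have hlim : Filter.Tendsto (fun s : ℝ => (1 - s) * breg A y x) (nhdsWithin 0 (Set.Ioi 0))
      (nhds ((1 - 0) * breg A y x)) := by
    apply Filter.Tendsto.mono_left _ nhdsWithin_le_nhds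
    exact Continuous.tendsto (by fun_prop) 0
  have := le_of_tendsto hlim (by
    filter_upwards [Ioo_mem_nhdsGT (zero_lt_one (α := ℝ))] with s hs
    exact key s hs.1 hs.2)
  linarith

lemma argminOn_spec {φ : E d → ℝ} {K : Set (E d)} (h : ∃ x ∈ K, IsMinOn φ K x) :
    argminOn φ K ∈ K ∧ IsMinOn φ K (argminOn φ K) := by
  rw [argminOn, dif_pos h]
  exact h.choose_spec

lemma exists_isMinOn_linear_add_breg {K : Set (E d)} (hK : IsCompact K) (hne : K.Nonempty)
    (A : Matrix (Fin d) (Fin d) ℝ) (m c : E d) :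
    ∃ x ∈ K, IsMinOn (fun w => inner ℝ w m + breg A w c) K x := by
  apply hK.exists_isMinOn hne
  apply Continuous.continuousOn
  unfold breg
  have := (continuous_sqNorm A).comp (continuous_id.sub (continuous_const (y := c)))
  simp only [Function.comp_def] at this
  fun_prop

/-- For `Q = P + η δδᵀ`, the local norm of `δ` is controlled by the increase of the log
determinant. -/
lemma inv_form_le_log_det {P Q : Matrix (Fin d) (Fin d) ℝ} (hP : P.PosDef) (hQ : Q.PosDef)
    {η : ℝ} {δ : Fin d → ℝ} (h : Q = P + η • Matrix.vecMulVec δ δ) :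
    η * (δ ⬝ᵥ Q⁻¹.mulVec δ) ≤ Real.log Q.det - Real.log P.det := by
  have hu : IsUnit Q.det := (Matrix.isUnit_iff_isUnit_det _).1 hQ.isUnit
  have h1 : P = Q * (1 + Matrix.replicateCol Unit (-(η • Q⁻¹.mulVec δ))
      * Matrix.replicateRow Unit δ) := by
    rw [← Matrix.vecMulVec_eq, mul_add, mul_one, Matrix.mul_vecMulVec, Matrix.mulVec_neg,
      Matrix.mulVec_smul, Matrix.mulVec_mulVec, Matrix.mul_nonsing_inv Q hu, Matrix.one_mulVec,
      Matrix.neg_vecMulVec, Matrix.smul_vecMulVec, h]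
    abel
  -- The matrix determinant lemma for a rank-one change; afterwards log r ≤ r - 1 is used at r = det
  -- P / det Q.
  have h2 : P.det = Q.det * (1 - η * (δ ⬝ᵥ Q⁻¹.mulVec δ)) := by
    conv_lhs => rw [h1, Matrix.det_mul, Matrix.det_one_add_replicateCol_mul_replicateRow]
    simp [sub_eq_add_neg]
  have hr : 0 < P.det / Q.det := div_pos hP.det_pos hQ.det_pos
  have h3 : η * (δ ⬝ᵥ Q⁻¹.mulVec δ) = 1 - P.det / Q.det := by
    rw [h2]; field_simp [hQ.det_pos.ne']; ring
  have := Real.log_le_sub_one_of_pos hr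
  rw [Real.log_div hP.det_pos.ne' hQ.det_pos.ne'] at this
  linarith

/-- Young's inequality in the norm of `Q` and its dual: expand ‖y - 2κ Q⁻¹δ‖²_Q ≥ 0. -/
lemma mul_inner_le_quarter_add {Q : Matrix (Fin d) (Fin d) ℝ} (hQ : Q.PosDef) (κ : ℝ)
    (δ y : E d) :
    κ * inner ℝ δ y ≤ (1 / 4) * sqNorm Q y + κ ^ 2 * (δ.ofLp ⬝ᵥ Q⁻¹.mulVec δ.ofLp) := by
  have hu : IsUnit Q.det := (Matrix.isUnit_iff_isUnit_det _).1 hQ.isUnit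
  set w : E d := WithLp.toLp 2 (Q⁻¹.mulVec δ.ofLp) with hw
  have hQw : Q.mulVec w.ofLp = δ.ofLp := by
    simp [hw, Matrix.mulVec_mulVec, Matrix.mul_nonsing_inv Q hu]
  have hsym : ∀ a b : Fin d → ℝ, a ⬝ᵥ Q.mulVec b = b ⬝ᵥ Q.mulVec a := by
    intro a b
    have hT : Q.transpose = Q := by simpa [Matrix.IsHermitian] using hQ.isHermitian
    rw [Matrix.dotProduct_mulVec, ← Matrix.mulVec_transpose, hT, dotProduct_comm]
  have h0 := sqNorm_nonneg_of_posSemidef hQ.posSemidef (y - (2 * κ) • w)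
  have h1 : sqNorm Q (y - (2 * κ) • w) = sqNorm Q y - 4 * κ * inner ℝ δ y
      + 4 * κ ^ 2 * (δ.ofLp ⬝ᵥ Q⁻¹.mulVec δ.ofLp) := by
    simp only [sqNorm, WithLp.ofLp_sub, WithLp.ofLp_smul, Matrix.mulVec_sub, Matrix.mulVec_smul,
      dotProduct_sub, dotProduct_smul, sub_dotProduct, smul_dotProduct, smul_eq_mul, hQw,
      hsym w.ofLp y.ofLp, inner_eq_dotProduct]
    rw [dotProduct_comm y.ofLp δ.ofLp, dotProduct_comm w.ofLp δ.ofLp]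
    simp only [hw]
    ring
  linarith

/-- Every eigenvalue is at most the trace. The constant lost against the arithmetic-geometric mean
is harmless, since only the logarithm is used. -/
lemma det_le_trace_pow {Q : Matrix (Fin d) (Fin d) ℝ} (hQ : Q.PosDef) :
    Q.det ≤ Q.trace ^ d := by
  have h1 := hQ.isHermitian.det_eq_prod_eigenvalues
  have h2 := hQ.isHermitian.trace_eq_sum_eigenvalues
  simp only [RCLike.ofReal_real_eq_id, id] at h1 h2
  rw [h1, h2]
  have hpos : ∀ i, 0 ≤ hQ.isHermitian.eigenvalues i := fun i => (hQ.eigenvalues_pos i).le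
  calc ∏ i, hQ.isHermitian.eigenvalues i
      ≤ ∏ _i : Fin d, ∑ j, hQ.isHermitian.eigenvalues j :=
        Finset.prod_le_prod (fun i _ => hpos i)
          (fun i hi => Finset.single_le_sum (fun j _ => hpos j) hi)
    _ = _ := by simp

end QuadraticForms

end CLAOONS

end

/-! ### The regret of a single round. -/

noncomputable section

namespace CLAOONS

namespace State

variable {d : ℕ}

/-- The state after a round without restart. -/
def cont (s : State d) (𝒳 : Set (E d)) (g : E d) : State d where
  D := s.D
  z := s.newB g
  zStart := s.zStart
  x' := s.nextX' 𝒳 g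
  H := s.H + s.eta • Matrix.vecMulVec (s.corrected 𝒳 g - s.m).ofLp
    (s.corrected 𝒳 g - s.m).ofLp
  V := s.V + ‖s.clip g - s.m‖ ^ 2
  m := g
  N := s.newN g
  S := s.newS g

/-- The state after a round with restart. -/
def restart (s : State d) (g : E d) : State d where
  D := 2 * Real.sqrt (s.newS g)
  z := s.newB g
  zStart := s.newB g
  x' := 0
  H := 0
  V := 0
  m := g
  N := s.newN g
  S := s.newS g

lemma step_of_lt {s : State d} {g : E d} (𝒳 : Set (E d)) (h : s.D < Real.sqrt (s.newS g)) :
    s.step 𝒳 g = s.restart g := if_pos h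

lemma step_of_not_lt {s : State d} {g : E d} (𝒳 : Set (E d))
    (h : ¬ s.D < Real.sqrt (s.newS g)) : s.step 𝒳 g = s.cont 𝒳 g := if_neg h

/-- The properties of the state that hold in every round and that the analysis of a single round
depends on. -/
structure Valid (B₀ : ℝ) (s : State d) : Prop where
  one_le_D : 1 ≤ s.D
  le_zStart : B₀ ≤ s.zStart
  zStart_le : s.zStart ≤ s.z
  posSemidef_H : s.H.PosSemidef
  V_nonneg : 0 ≤ s.V

/-- The growth of the log determinant of the matrix since the start of the epoch. -/
def logDet (s : State d) : ℝ :=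
  Real.log ((4 * s.zStart ^ 2) • (1 : Matrix (Fin d) (Fin d) ℝ) + s.H).det
    - Real.log ((4 * s.zStart ^ 2) • (1 : Matrix (Fin d) (Fin d) ℝ)).det

/-- The potential function of the analysis within an epoch, for the comparator `u`. -/
def potential (R : ℝ) (u : E d) (s : State d) : ℝ :=
  breg s.A u s.x' - 60 * ‖u‖ ^ 2 * Real.sqrt s.V - 2 * R * s.logDet

/-- The squared movement of the iterates in one round. -/
def movement (s : State d) (𝒳 : Set (E d)) (g : E d) : ℝ :=
  ‖s.play 𝒳 - s.x'‖ ^ 2 + ‖s.play 𝒳 - s.nextX' 𝒳 g‖ ^ 2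

variable {B₀ : ℝ} {s : State d} {𝒳 : Set (E d)}

lemma sqNorm_A (s : State d) (x : E d) :
    sqNorm s.A x = 4 * s.zStart ^ 2 * ‖x‖ ^ 2 + sqNorm s.H x
      + 4 * s.eta * s.z ^ 2 * ‖x‖ ^ 2 := by
  simp only [A, sqNorm_add, sqNorm_smul, sqNorm_one]

lemma z_le_newB (s : State d) (g : E d) : s.z ≤ s.newB g := le_max_left _ _

lemma norm_le_newB (s : State d) (g : E d) : ‖g - s.m‖ ≤ s.newB g := le_max_right _ _

lemma convex_domain (s : State d) (h : Convex ℝ 𝒳) : Convex ℝ (s.domain 𝒳) := by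
  have : s.domain 𝒳 = 𝒳 ∩ Metric.closedBall 0 s.D := by
    ext; simp [domain]
  rw [this]
  exact h.inter (convex_closedBall _ _)

lemma isCompact_domain (s : State d) (h : IsClosed 𝒳) : IsCompact (s.domain 𝒳) := by
  have : s.domain 𝒳 = 𝒳 ∩ Metric.closedBall 0 s.D := by
    ext; simp [domain]
  rw [this]
  exact (isCompact_closedBall _ _).inter_left h

lemma zero_mem_domain {s : State d} (hD : 0 ≤ s.D) (h0 : 0 ∈ 𝒳) : 0 ∈ s.domain 𝒳 :=
  ⟨h0, by simpa using hD⟩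

lemma play_spec {s : State d} (hD : 0 ≤ s.D) (hcl : IsClosed 𝒳) (h0 : 0 ∈ 𝒳) :
    s.play 𝒳 ∈ s.domain 𝒳 ∧
      IsMinOn (fun x => inner ℝ x s.m + breg s.A x s.x') (s.domain 𝒳) (s.play 𝒳) :=
  argminOn_spec (exists_isMinOn_linear_add_breg (s.isCompact_domain hcl)
    ⟨0, zero_mem_domain hD h0⟩ _ _ _)

lemma nextX'_spec {s : State d} (hD : 0 ≤ s.D) (hcl : IsClosed 𝒳) (h0 : 0 ∈ 𝒳) (g : E d) :
    s.nextX' 𝒳 g ∈ s.domain 𝒳 ∧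
      IsMinOn (fun x => inner ℝ x (s.corrected 𝒳 g) + breg s.A x s.x') (s.domain 𝒳)
        (s.nextX' 𝒳 g) :=
  argminOn_spec (exists_isMinOn_linear_add_breg (s.isCompact_domain hcl)
    ⟨0, zero_mem_domain hD h0⟩ _ _ _)

lemma corrected_sub (s : State d) (𝒳 : Set (E d)) (g : E d) :
    s.corrected 𝒳 g - s.m
      = (1 + 32 * s.eta * inner ℝ (s.play 𝒳) (s.clip g - s.m)) • (s.clip g - s.m) := by
  rw [corrected, add_smul, one_smul]; abel

lemma clip_sub (s : State d) (g : E d) : s.clip g - s.m = (s.z / s.newB g) • (g - s.m) := by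
  rw [clip]; abel

namespace Valid

variable (hs : s.Valid B₀) (hB₀ : 0 < B₀)
include hs hB₀

lemma zStart_pos : 0 < s.zStart := hB₀.trans_le hs.le_zStart

lemma z_pos : 0 < s.z := (hs.zStart_pos hB₀).trans_le hs.zStart_le

lemma max_pos : 0 < max (64 * s.D * s.z) (Real.sqrt s.V) := by
  have := hs.z_pos hB₀
  have := hs.one_le_D
  exact lt_max_of_lt_left (by positivity)

lemma eta_pos : 0 < s.eta := one_div_pos.2 (hs.max_pos hB₀)

lemma eta_mul_le : s.eta * (64 * s.D * s.z) ≤ 1 := by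
  rw [eta, one_div, inv_mul_le_iff₀ (hs.max_pos hB₀), mul_one]
  exact le_max_left _ _

lemma eta_mul_z_le : s.eta * s.z ≤ 1 / 64 := by
  have h1 := hs.eta_mul_le hB₀
  have h2 : 0 ≤ s.eta * s.z := (mul_pos (hs.eta_pos hB₀) (hs.z_pos hB₀)).le
  have h3 := hs.one_le_D
  nlinarith

lemma newB_pos (g : E d) : 0 < s.newB g := (hs.z_pos hB₀).trans_le (s.z_le_newB g)

lemma norm_clip_sub_eq (g : E d) : ‖s.clip g - s.m‖ = s.z / s.newB g * ‖g - s.m‖ := by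
  rw [clip_sub, norm_smul, Real.norm_of_nonneg]
  exact (div_pos (hs.z_pos hB₀) (hs.newB_pos hB₀ g)).le

lemma norm_clip_sub_le_z (g : E d) : ‖s.clip g - s.m‖ ≤ s.z := by
  rw [hs.norm_clip_sub_eq hB₀, div_mul_eq_mul_div, div_le_iff₀ (hs.newB_pos hB₀ g)]
  exact mul_le_mul_of_nonneg_left (s.norm_le_newB g) (hs.z_pos hB₀).le

lemma norm_clip_sub_le (g : E d) : ‖s.clip g - s.m‖ ≤ ‖g - s.m‖ := by
  rw [hs.norm_clip_sub_eq hB₀]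
  exact mul_le_of_le_one_left (norm_nonneg _)
    ((div_le_one (hs.newB_pos hB₀ g)).2 (s.z_le_newB g))

/-- The price of clipping is the increase of the range, hence telescopes over the rounds. -/
lemma norm_sub_clip_le (g : E d) : ‖g - s.clip g‖ ≤ s.newB g - s.z := by
  have hB := hs.newB_pos hB₀ g
  have h1 : g - s.clip g = (1 - s.z / s.newB g) • (g - s.m) := by
    rw [clip, sub_smul, one_smul]; abel
  have h2 : 0 ≤ 1 - s.z / s.newB g := by
    rw [sub_nonneg, div_le_one hB]; exact s.z_le_newB g
  rw [h1, norm_smul, Real.norm_of_nonneg h2]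
  calc (1 - s.z / s.newB g) * ‖g - s.m‖ ≤ (1 - s.z / s.newB g) * s.newB g :=
        mul_le_mul_of_nonneg_left (s.norm_le_newB g) h2
    _ = _ := by field_simp

lemma abs_correction_le (hcl : IsClosed 𝒳) (h0 : 0 ∈ 𝒳) (g : E d) :
    |32 * s.eta * inner ℝ (s.play 𝒳) (s.clip g - s.m)| ≤ 1 / 2 := by
  have h1 := (play_spec (zero_le_one.trans hs.one_le_D) hcl h0).1.2
  have h2 := hs.norm_clip_sub_le_z hB₀ g
  have h3 := abs_real_inner_le_norm (s.play 𝒳) (s.clip g - s.m)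
  have h4 : ‖s.play 𝒳‖ * ‖s.clip g - s.m‖ ≤ s.D * s.z :=
    mul_le_mul h1 h2 (norm_nonneg _) (zero_le_one.trans hs.one_le_D)
  have h5 := hs.eta_mul_le hB₀
  have h6 := hs.eta_pos hB₀
  rw [abs_mul, abs_of_pos (by positivity : 0 < 32 * s.eta)]
  have : s.eta * |inner ℝ (s.play 𝒳) (s.clip g - s.m)| ≤ s.eta * (s.D * s.z) :=
    mul_le_mul_of_nonneg_left (h3.trans h4) h6.le
  nlinarith

/-- `∇_t - m_t` is a multiple of `g̃_t - m_t` with a factor close to one. -/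
lemma exists_corrected_sub_eq (hcl : IsClosed 𝒳) (h0 : 0 ∈ 𝒳) (g : E d) :
    ∃ c : ℝ, 1 / 2 ≤ c ∧ c ≤ 3 / 2 ∧ c = 1 + 32 * s.eta * inner ℝ (s.play 𝒳) (s.clip g - s.m) ∧
      s.corrected 𝒳 g - s.m = c • (s.clip g - s.m) := by
  have h := abs_le.1 (hs.abs_correction_le hB₀ hcl h0 g)
  exact ⟨_, by linarith, by linarith, rfl, corrected_sub s 𝒳 g⟩

lemma norm_corrected_sub_le (hcl : IsClosed 𝒳) (h0 : 0 ∈ 𝒳) (g : E d) :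
    ‖s.corrected 𝒳 g - s.m‖ ≤ 3 / 2 * s.z := by
  obtain ⟨c, hc1, hc2, -, hc⟩ := hs.exists_corrected_sub_eq hB₀ hcl h0 g
  rw [hc, norm_smul, Real.norm_of_nonneg (by linarith)]
  exact mul_le_mul hc2 (hs.norm_clip_sub_le_z hB₀ g) (norm_nonneg _) (by norm_num)

lemma posDef_base : ((4 * s.zStart ^ 2) • (1 : Matrix (Fin d) (Fin d) ℝ) + s.H).PosDef := by
  have := hs.zStart_pos hB₀
  exact (Matrix.PosDef.one.smul (by positivity : 0 < 4 * s.zStart ^ 2)).add_posSemidef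
    hs.posSemidef_H

lemma cont (𝒳 : Set (E d)) (g : E d) : (s.cont 𝒳 g).Valid B₀ where
  one_le_D := hs.one_le_D
  le_zStart := hs.le_zStart
  zStart_le := hs.zStart_le.trans (s.z_le_newB g)
  posSemidef_H := by
    have h := (Matrix.posSemidef_vecMulVec_self_star
      (s.corrected 𝒳 g - s.m).ofLp).smul (hs.eta_pos hB₀).le
    rw [star_trivial] at h
    exact hs.posSemidef_H.add h
  V_nonneg := add_nonneg hs.V_nonneg (by positivity)

omit hB₀ in
lemma restart {g : E d} (h : s.D < Real.sqrt (s.newS g)) : (s.restart g).Valid B₀ where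
  one_le_D := by
    have := hs.one_le_D
    simp only [State.restart]; linarith
  le_zStart := (hs.le_zStart.trans hs.zStart_le).trans (s.z_le_newB g)
  zStart_le := le_rfl
  posSemidef_H := Matrix.PosSemidef.zero
  V_nonneg := le_rfl

/-- With b² - a² = n² for b = √(V + n²) and a = √V, one has n² ≤ 2b(b - a). Both V and n² are at
most 1/η², so b ≤ √2/η ≤ 1.45/η, whence 29/10. This makes the sum of η‖g̃ - m‖² telescope. -/
lemma eta_mul_sq_le (g : E d) :
    s.eta * ‖s.clip g - s.m‖ ^ 2
      ≤ 29 / 10 * (Real.sqrt (s.V + ‖s.clip g - s.m‖ ^ 2) - Real.sqrt s.V) := by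
  have hM := hs.max_pos hB₀
  have hV := hs.V_nonneg
  have hh := hs.norm_clip_sub_le_z hB₀ g
  have hD := hs.one_le_D
  have hz := hs.z_pos hB₀
  set n := ‖s.clip g - s.m‖
  have hn : 0 ≤ n := norm_nonneg _
  set M := max (64 * s.D * s.z) (Real.sqrt s.V) with hMdef
  have h1 : n ≤ M := by
    refine hh.trans (le_trans ?_ (le_max_left _ _))
    nlinarith
  have h2 : s.V ≤ M ^ 2 := by
    rw [← Real.sq_sqrt hV]
    exact pow_le_pow_left₀ (Real.sqrt_nonneg _) (le_max_right _ _) 2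
  have h3 : Real.sqrt (s.V + n ^ 2) ≤ 145 / 100 * M :=
    Real.sqrt_le_iff.2 ⟨by positivity, by nlinarith⟩
  have h4 := Real.sq_sqrt hV
  have h5 := Real.sq_sqrt (by positivity : 0 ≤ s.V + n ^ 2)
  have h6 : Real.sqrt s.V ≤ Real.sqrt (s.V + n ^ 2) := Real.sqrt_le_sqrt (by nlinarith)
  have h7 := Real.sqrt_nonneg s.V
  set a := Real.sqrt s.V
  set b := Real.sqrt (s.V + n ^ 2)
  have h8 : n ^ 2 ≤ 2 * b * (b - a) := by nlinarith
  rw [eta, ← hMdef, one_div, inv_mul_le_iff₀ hM]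
  calc n ^ 2 ≤ 2 * b * (b - a) := h8
    _ ≤ 2 * (145 / 100 * M) * (b - a) :=
        mul_le_mul_of_nonneg_right (by linarith) (by linarith)
    _ = _ := by ring

lemma eta_cont_le (𝒳 : Set (E d)) (g : E d) : (s.cont 𝒳 g).eta ≤ s.eta := by
  have := hs.one_le_D
  apply one_div_le_one_div_of_le (hs.max_pos hB₀)
  apply max_le_max
  · exact mul_le_mul_of_nonneg_left (s.z_le_newB g) (by positivity)
  · exact Real.sqrt_le_sqrt (by simp [State.cont])

/-- Since η decreases, the difference is at most η'(B² - z²) ≤ 2η'B(B - z) with the new step size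
η', and η' · 64DB ≤ 1. This controls the last summand of A_t, which need not be monotone. -/
lemma scale_growth_le (𝒳 : Set (E d)) (g : E d) :
    s.D * ((s.cont 𝒳 g).eta * s.newB g ^ 2 - s.eta * s.z ^ 2) ≤ (s.newB g - s.z) / 32 := by
  have h1 := hs.eta_cont_le hB₀ 𝒳 g
  have h2 := (hs.cont hB₀ 𝒳 g).eta_mul_le hB₀
  have h3 := (hs.cont hB₀ 𝒳 g).eta_pos hB₀
  have h4 := s.z_le_newB g
  have h5 := hs.z_pos hB₀
  have h6 := hs.one_le_D
  set e := (s.cont 𝒳 g).eta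
  have h2' : e * (64 * s.D * s.newB g) ≤ 1 := h2
  have h7 : e * s.newB g ^ 2 - s.eta * s.z ^ 2 ≤ e * ((s.newB g + s.z) * (s.newB g - s.z)) := by
    nlinarith [mul_le_mul_of_nonneg_right h1 (sq_nonneg s.z)]
  have h8 : e * ((s.newB g + s.z) * (s.newB g - s.z))
      ≤ e * ((2 * s.newB g) * (s.newB g - s.z)) := by
    apply mul_le_mul_of_nonneg_left _ h3.le
    exact mul_le_mul_of_nonneg_right (by linarith) (by linarith)
  have h9 : s.D * (e * ((2 * s.newB g) * (s.newB g - s.z)))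
      = e * (64 * s.D * s.newB g) * ((s.newB g - s.z) / 32) := by ring
  calc _ ≤ s.D * (e * ((2 * s.newB g) * (s.newB g - s.z))) :=
        mul_le_mul_of_nonneg_left (h7.trans h8) (by linarith)
    _ ≤ _ := by rw [h9]; exact mul_le_of_le_one_left (by linarith) h2'

/-- The change of the divergence to the comparator when the matrix is updated. -/
lemma breg_cont_le (hcl : IsClosed 𝒳) (h0 : 0 ∈ 𝒳) {u : E d} (hu : ‖u‖ ≤ s.D) (g : E d) :
    breg (s.cont 𝒳 g).A u (s.nextX' 𝒳 g) ≤ breg s.A u (s.nextX' 𝒳 g)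
      + s.eta / 2 * (inner ℝ (s.corrected 𝒳 g - s.m) (u - s.nextX' 𝒳 g)) ^ 2
      + s.D * (s.newB g - s.z) / 4 := by
  have h1 := hs.scale_growth_le hB₀ 𝒳 g
  have hx := (nextX'_spec (zero_le_one.trans hs.one_le_D) hcl h0 g).1.2
  set y := u - s.nextX' 𝒳 g
  have hy : ‖y‖ ≤ 2 * s.D := (norm_sub_le _ _).trans (by linarith)
  have hy2 : ‖y‖ ^ 2 ≤ 4 * s.D ^ 2 := by nlinarith [norm_nonneg y]
  have hD := hs.one_le_D
  have hz := s.z_le_newB g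
  simp only [breg, sqNorm_A]
  simp only [State.cont, sqNorm_add, sqNorm_smul, sqNorm_vecMulVec]
  change 1 / 2 * (_ + _ + 4 * (s.cont 𝒳 g).eta * _ * ‖y‖ ^ 2) ≤ _
  -- Both points lie in the ball of radius D, so ‖y‖² ≤ 4D². The sign of the bracket is unknown; if
  -- it is negative, there is nothing to pay.
  have key : 2 * ((s.cont 𝒳 g).eta * s.newB g ^ 2 - s.eta * s.z ^ 2) * ‖y‖ ^ 2
      ≤ s.D * (s.newB g - s.z) / 4 := by
    set q := (s.cont 𝒳 g).eta * s.newB g ^ 2 - s.eta * s.z ^ 2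
    rcases le_or_gt q 0 with hq | hq
    · have : 2 * q * ‖y‖ ^ 2 ≤ 0 :=
        mul_nonpos_of_nonpos_of_nonneg (by linarith) (sq_nonneg _)
      have : 0 ≤ s.D * (s.newB g - s.z) := mul_nonneg (by linarith) (by linarith)
      linarith
    · calc 2 * q * ‖y‖ ^ 2 ≤ 2 * q * (4 * s.D ^ 2) :=
            mul_le_mul_of_nonneg_left hy2 (by linarith)
        _ = 8 * s.D * (s.D * q) := by ring
        _ ≤ 8 * s.D * ((s.newB g - s.z) / 32) :=
            mul_le_mul_of_nonneg_left h1 (by linarith)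
        _ = _ := by ring
  linarith

/-- The stability of the two iterates of a round, up to the progress of the log determinant. -/
lemma stability_le (hcl : IsClosed 𝒳) (h0 : 0 ∈ 𝒳) (g : E d) {R : ℝ}
    (hR : max (64 * s.D * s.z) (Real.sqrt s.V) ≤ R) :
    67 / 64 * |inner ℝ (s.corrected 𝒳 g - s.m) (s.play 𝒳 - s.nextX' 𝒳 g)|
      ≤ (1 / 4) * sqNorm s.A (s.play 𝒳 - s.nextX' 𝒳 g)
        + 2 * R * ((s.cont 𝒳 g).logDet - s.logDet) := by
  set δ := s.corrected 𝒳 g - s.m with hδ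
  set y := s.play 𝒳 - s.nextX' 𝒳 g
  set P := (4 * s.zStart ^ 2) • (1 : Matrix (Fin d) (Fin d) ℝ) + s.H with hP
  set Q := (4 * s.zStart ^ 2) • (1 : Matrix (Fin d) (Fin d) ℝ) + (s.cont 𝒳 g).H with hQ
  have hPpos : P.PosDef := hs.posDef_base hB₀
  have hQpos : Q.PosDef := (hs.cont hB₀ 𝒳 g).posDef_base hB₀
  have hPQ : Q = P + s.eta • Matrix.vecMulVec δ.ofLp δ.ofLp := by
    rw [hQ, hP, add_assoc]; rfl
  have h1 := inv_form_le_log_det hPpos hQpos hPQ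
  have hη := hs.eta_pos hB₀
  have h2 : (s.cont 𝒳 g).logDet - s.logDet = Real.log Q.det - Real.log P.det := by
    simp only [logDet, hQ, hP, State.cont]; ring
  have h3 : δ.ofLp ⬝ᵥ Q⁻¹.mulVec δ.ofLp ≤ R * ((s.cont 𝒳 g).logDet - s.logDet) := by
    rw [h2]
    have hq : 0 ≤ δ.ofLp ⬝ᵥ Q⁻¹.mulVec δ.ofLp := by
      simpa using hQpos.inv.posSemidef.dotProduct_mulVec_nonneg δ.ofLp
    -- `R` dominates 1/η; this trades the step size in the log-determinant estimate for a factor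
    -- common to all rounds.
    have h4 : 1 ≤ R * s.eta := by
      rw [eta, mul_one_div, one_le_div (hs.max_pos hB₀)]; exact hR
    have hRpos : 0 ≤ R := (hs.max_pos hB₀).le.trans hR
    calc _ ≤ (R * s.eta) * (δ.ofLp ⬝ᵥ Q⁻¹.mulVec δ.ofLp) := le_mul_of_one_le_left hq h4
      _ = R * (s.eta * (δ.ofLp ⬝ᵥ Q⁻¹.mulVec δ.ofLp)) := by ring
      _ ≤ _ := mul_le_mul_of_nonneg_left h1 hRpos
  -- This is the purpose of the summand 4ηz²I of A_t: since ‖δ‖ ≤ 2z, it dominates ηδδᵀ, so A_t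
  -- already contains the rank-one term that is only added after the round.
  have h5 : sqNorm Q y ≤ sqNorm s.A y := by
    rw [hPQ, hP, sqNorm_A, sqNorm_add, sqNorm_add, sqNorm_smul, sqNorm_smul, sqNorm_one,
      sqNorm_vecMulVec]
    have h6 := abs_real_inner_le_norm δ y
    have h7 := hs.norm_corrected_sub_le hB₀ hcl h0 g
    rw [← hδ] at h7
    have h8 : (inner ℝ δ y) ^ 2 ≤ (2 * s.z * ‖y‖) ^ 2 := by
      rw [← sq_abs]
      apply pow_le_pow_left₀ (abs_nonneg _)
      apply h6.trans (mul_le_mul_of_nonneg_right _ (norm_nonneg _))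
      have := hs.z_pos hB₀
      linarith
    have := mul_le_mul_of_nonneg_left h8 hη.le
    linarith
  have hn : 0 ≤ δ.ofLp ⬝ᵥ Q⁻¹.mulVec δ.ofLp := by
    simpa using hQpos.inv.posSemidef.dotProduct_mulVec_nonneg δ.ofLp
  -- The factor 67/64 = 1 + 3/64 collects the stability term itself and the share of
  -- `eta_mul_inner_sq_le_abs`; its square is rounded up to 2.
  have h9 := mul_inner_le_quarter_add hQpos (67 / 64) δ y
  have h10 := mul_inner_le_quarter_add hQpos (-(67 / 64)) δ y
  rcases abs_cases (inner ℝ δ y : ℝ) with ⟨h, -⟩ | ⟨h, -⟩ <;> rw [h] <;> nlinarith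

/-- ∇ - m is c(g̃ - m) with c ≤ 3/2, so c² ≤ 9/4, and (a - b)² ≤ 2(a² + b²). -/
lemma inner_corrected_sub_sq_le (hcl : IsClosed 𝒳) (h0 : 0 ∈ 𝒳) (u g : E d) :
    (inner ℝ (s.corrected 𝒳 g - s.m) (u - s.play 𝒳)) ^ 2
      ≤ 9 / 2 * ((inner ℝ u (s.clip g - s.m)) ^ 2
        + (inner ℝ (s.play 𝒳) (s.clip g - s.m)) ^ 2) := by
  obtain ⟨c, hc1, hc2, -, hcδ⟩ := hs.exists_corrected_sub_eq hB₀ hcl h0 g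
  have e : inner ℝ (s.corrected 𝒳 g - s.m) (u - s.play 𝒳)
      = c * (inner ℝ u (s.clip g - s.m) - inner ℝ (s.play 𝒳) (s.clip g - s.m)) := by
    rw [hcδ, real_inner_smul_left, inner_sub_right, real_inner_comm u,
      real_inner_comm (s.play 𝒳)]
  rw [e, mul_pow]
  generalize (inner ℝ u (s.clip g - s.m) : ℝ) = a
  generalize (inner ℝ (s.play 𝒳) (s.clip g - s.m) : ℝ) = b
  have c2 : c ^ 2 ≤ 9 / 4 := by nlinarith
  nlinarith [mul_le_mul_of_nonneg_right c2 (sq_nonneg (a - b)), sq_nonneg (a + b)]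

/-- One of the two factors is at most (3/2)z · 2D, and ηzD ≤ 1/64. So the quadratic term is a small
part of the linear stability term. -/
lemma eta_mul_inner_sq_le_abs (hcl : IsClosed 𝒳) (h0 : 0 ∈ 𝒳) (g : E d) :
    s.eta * (inner ℝ (s.corrected 𝒳 g - s.m) (s.play 𝒳 - s.nextX' 𝒳 g)) ^ 2
      ≤ 3 / 64 * |inner ℝ (s.corrected 𝒳 g - s.m) (s.play 𝒳 - s.nextX' 𝒳 g)| := by
  have hD := hs.one_le_D
  have hz := hs.z_pos hB₀
  have hx := (play_spec (zero_le_one.trans hs.one_le_D) hcl h0).1.2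
  have hy := (nextX'_spec (zero_le_one.trans hs.one_le_D) hcl h0 g).1.2
  have h1 := abs_real_inner_le_norm (s.corrected 𝒳 g - s.m) (s.play 𝒳 - s.nextX' 𝒳 g)
  have h2 : ‖s.play 𝒳 - s.nextX' 𝒳 g‖ ≤ 2 * s.D := (norm_sub_le _ _).trans (by linarith)
  have h3 := mul_le_mul (hs.norm_corrected_sub_le hB₀ hcl h0 g) h2 (norm_nonneg _)
    (by positivity)
  have h4 := mul_le_mul_of_nonneg_left (h1.trans h3) (hs.eta_pos hB₀).le
  have h5 := hs.eta_mul_le hB₀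
  rw [← sq_abs, sq, ← mul_assoc]
  exact mul_le_mul_of_nonneg_right (by linarith) (abs_nonneg _)

lemma eta_mul_inner_sq_le_sqrt (u g : E d) :
    s.eta * (inner ℝ u (s.clip g - s.m)) ^ 2
      ≤ 29 / 10 * (‖u‖ ^ 2
        * (Real.sqrt (s.V + ‖s.clip g - s.m‖ ^ 2) - Real.sqrt s.V)) := by
  have h1 : (inner ℝ u (s.clip g - s.m)) ^ 2 ≤ (‖u‖ * ‖s.clip g - s.m‖) ^ 2 := by
    rw [← sq_abs]
    exact pow_le_pow_left₀ (abs_nonneg _) (abs_real_inner_le_norm u _) 2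
  have h2 := mul_le_mul_of_nonneg_left h1 (hs.eta_pos hB₀).le
  have h3 := mul_le_mul_of_nonneg_left (hs.eta_mul_sq_le hB₀ g) (sq_nonneg ‖u‖)
  linarith

/-- Converts divergences into Euclidean movement with a constant that depends on B₀ only; it also
gives definiteness of A_t. -/
lemma norm_sq_le_sqNorm_A (w : E d) : 4 * B₀ ^ 2 * ‖w‖ ^ 2 ≤ sqNorm s.A w := by
  rw [sqNorm_A]
  have := sqNorm_nonneg_of_posSemidef hs.posSemidef_H w
  have := mul_le_mul_of_nonneg_right (pow_le_pow_left₀ hB₀.le hs.le_zStart 2) (sq_nonneg ‖w‖)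
  have := hs.eta_pos hB₀
  have : 0 ≤ 4 * s.eta * s.z ^ 2 * ‖w‖ ^ 2 := by positivity
  linarith

lemma inner_le_inner_clip (hcl : IsClosed 𝒳) (h0 : 0 ∈ 𝒳) {u : E d} (hu : ‖u‖ ≤ s.D) (g : E d) :
    inner ℝ g (s.play 𝒳 - u) ≤ inner ℝ (s.clip g) (s.play 𝒳 - u)
      + 2 * s.D * (s.newB g - s.z) := by
  have hx := (play_spec (zero_le_one.trans hs.one_le_D) hcl h0).1.2
  have h1 : inner ℝ g (s.play 𝒳 - u) = inner ℝ (s.clip g) (s.play 𝒳 - u)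
      + inner ℝ (g - s.clip g) (s.play 𝒳 - u) := by rw [inner_sub_left]; ring
  have h2 := real_inner_le_norm (g - s.clip g) (s.play 𝒳 - u)
  have h3 : ‖s.play 𝒳 - u‖ ≤ 2 * s.D := (norm_sub_le _ _).trans (by linarith)
  have h4 := mul_le_mul (hs.norm_sub_clip_le hB₀ g) h3 (norm_nonneg _)
    (by linarith [s.z_le_newB g])
  linarith

-- The budget of a round, with a = ⟨x, g̃ - m⟩ and b = ⟨u, g̃ - m⟩, where p is the stability term
-- and q = ⟨∇ - m, u - x⟩. The coefficient of ηa² is at most -32 + 16 + 9/2 < 0; that of ηb² is 16 +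
-- 9/2, and (41/2)(29/10) < 60. Half of the divergence `byx` pays for stability; the other half,
-- together with `bx`, pays for the movement. The range increase costs 2 + 1/4 ≤ 3.
omit hs hB₀ in
lemma regret_step_arith {η p q a b g₁ c₁ k₁ xm ym yc uc bx by' byx bux buy bc n₁ n₂ w β E ld : ℝ}
    (hη : 0 ≤ η) (t1 : xm + bx + byx ≤ ym + by') (t2 : yc + by' + buy ≤ uc + bux)
    (hst : 67 / 64 * |p| ≤ 1 / 4 * (2 * byx) + ld)
    (hbr : bc ≤ buy + η / 2 * (q + p) ^ 2 + w / 4) (hg : g₁ ≤ c₁ + 2 * w)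
    (e1 : c₁ = k₁ - 32 * η * a * (a - b)) (e2 : k₁ = p + (xm - ym) + (yc - uc))
    (e4 : η * q ^ 2 ≤ η * (9 / 2 * (b ^ 2 + a ^ 2))) (e5 : η * p ^ 2 ≤ 3 / 64 * |p|)
    (e6 : η * b ^ 2 ≤ 29 / 10 * E) (e8 : 4 * β * n₂ ≤ 2 * byx) (e9 : 4 * β * n₁ ≤ 2 * bx)
    (e11 : 0 ≤ E) (e17 : 0 ≤ β * n₁) (e19 : 0 ≤ w) :
    g₁ ≤ bux - bc + 60 * E + ld + 3 * w - β * (n₁ + n₂) := by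
  have e12 := le_abs_self p
  have e13 : η / 2 * (q + p) ^ 2 ≤ η * q ^ 2 + η * p ^ 2 := by
    nlinarith [mul_nonneg hη (sq_nonneg (q - p))]
  have e15 : 32 * η * a * b ≤ 16 * (η * a ^ 2) + 16 * (η * b ^ 2) := by
    nlinarith [mul_nonneg hη (sq_nonneg (a - b))]
  have e16 : 0 ≤ η * a ^ 2 := by positivity
  linarith

/-- The regret of a single round. -/
lemma regret_step_le (hcl : IsClosed 𝒳) (hcv : Convex ℝ 𝒳) (h0 : 0 ∈ 𝒳) {u : E d}
    (hu : u ∈ s.domain 𝒳) (g : E d) {R : ℝ} (hR : max (64 * s.D * s.z) (Real.sqrt s.V) ≤ R) :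
    inner ℝ g (s.play 𝒳 - u) ≤ s.potential R u - (s.cont 𝒳 g).potential R u
      + 3 * s.D * (s.newB g - s.z)
      - B₀ ^ 2 * s.movement 𝒳 g := by
  have hD := hs.one_le_D
  have hη := hs.eta_pos hB₀
  obtain ⟨hx, hxmin⟩ := play_spec (zero_le_one.trans hs.one_le_D) hcl h0
  obtain ⟨hy, hymin⟩ := nextX'_spec (zero_le_one.trans hs.one_le_D) hcl h0 g
  have t1 := three_point (s.convex_domain hcv) hx hy hxmin
  have t2 := three_point (s.convex_domain hcv) hy hu hymin
  have hst := hs.stability_le hB₀ hcl h0 g hR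
  have hbr := hs.breg_cont_le hB₀ hcl h0 hu.2 g
  have hclipg := hs.inner_le_inner_clip hB₀ hcl h0 hu.2 g
  have hcor : s.corrected 𝒳 g = s.clip g
      + (32 * s.eta * inner ℝ (s.play 𝒳) (s.clip g - s.m)) • (s.clip g - s.m) := rfl
  have e0 : s.potential R u - (s.cont 𝒳 g).potential R u
      = breg s.A u s.x' - breg (s.cont 𝒳 g).A u (s.nextX' 𝒳 g)
        + 60 * (‖u‖ ^ 2 * (Real.sqrt (s.V + ‖s.clip g - s.m‖ ^ 2) - Real.sqrt s.V))
        + 2 * R * ((s.cont 𝒳 g).logDet - s.logDet) := by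
    simp only [potential]
    have e1 : (s.cont 𝒳 g).x' = s.nextX' 𝒳 g := rfl
    have e2 : (s.cont 𝒳 g).V = s.V + ‖s.clip g - s.m‖ ^ 2 := rfl
    rw [e1, e2]; ring
  have e1 : inner ℝ (s.clip g) (s.play 𝒳 - u) = inner ℝ (s.corrected 𝒳 g) (s.play 𝒳 - u)
      - 32 * s.eta * inner ℝ (s.play 𝒳) (s.clip g - s.m)
        * (inner ℝ (s.play 𝒳) (s.clip g - s.m) - inner ℝ u (s.clip g - s.m)) := by
    rw [hcor, inner_add_left, real_inner_smul_left, real_inner_comm _ (s.clip g - s.m),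
      inner_sub_left (s.play 𝒳)]
    ring
  have e2 : inner ℝ (s.corrected 𝒳 g) (s.play 𝒳 - u)
      = inner ℝ (s.corrected 𝒳 g - s.m) (s.play 𝒳 - s.nextX' 𝒳 g)
      + (inner ℝ (s.play 𝒳) s.m - inner ℝ (s.nextX' 𝒳 g) s.m)
      + (inner ℝ (s.nextX' 𝒳 g) (s.corrected 𝒳 g) - inner ℝ u (s.corrected 𝒳 g)) := by
    simp only [inner_sub_left, inner_sub_right, real_inner_comm s.m,
      real_inner_comm (s.corrected 𝒳 g)]
    ring
  have e3 : inner ℝ (s.corrected 𝒳 g - s.m) (u - s.nextX' 𝒳 g)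
      = inner ℝ (s.corrected 𝒳 g - s.m) (u - s.play 𝒳)
        + inner ℝ (s.corrected 𝒳 g - s.m) (s.play 𝒳 - s.nextX' 𝒳 g) := by
    rw [← inner_add_right]; congr 1; abel
  have e4 := mul_le_mul_of_nonneg_left (hs.inner_corrected_sub_sq_le hB₀ hcl h0 u g) hη.le
  have e5 := hs.eta_mul_inner_sq_le_abs hB₀ hcl h0 g
  have e6 := hs.eta_mul_inner_sq_le_sqrt hB₀ u g
  have e8 := hs.norm_sq_le_sqNorm_A hB₀ (s.play 𝒳 - s.nextX' 𝒳 g)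
  have e9 := hs.norm_sq_le_sqNorm_A hB₀ (s.play 𝒳 - s.x')
  have e10 : sqNorm s.A (s.nextX' 𝒳 g - s.play 𝒳) = sqNorm s.A (s.play 𝒳 - s.nextX' 𝒳 g) := by
    simp only [sqNorm, WithLp.ofLp_sub, Matrix.mulVec_sub, dotProduct_sub, sub_dotProduct]
    ring
  have e11 : 0 ≤ ‖u‖ ^ 2 * (Real.sqrt (s.V + ‖s.clip g - s.m‖ ^ 2) - Real.sqrt s.V) :=
    mul_nonneg (sq_nonneg _) (sub_nonneg.2 (Real.sqrt_le_sqrt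
      (by linarith [sq_nonneg ‖s.clip g - s.m‖])))
  have e17 : 0 ≤ B₀ ^ 2 * ‖s.play 𝒳 - s.x'‖ ^ 2 := by positivity
  have e19 : 0 ≤ s.D * (s.newB g - s.z) :=
    mul_nonneg (by linarith) (by linarith [s.z_le_newB g])
  rw [e3] at hbr
  have e20 : sqNorm s.A (s.play 𝒳 - s.nextX' 𝒳 g) = 2 * breg s.A (s.nextX' 𝒳 g) (s.play 𝒳) := by
    rw [breg, e10]; ring
  have e21 : sqNorm s.A (s.play 𝒳 - s.x') = 2 * breg s.A (s.play 𝒳) s.x' := by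
    rw [breg]; ring
  rw [e20] at hst e8
  rw [e21] at e9
  rw [mul_assoc 2 s.D] at hclipg
  rw [e0, mul_assoc 3 s.D, movement]
  exact regret_step_arith hη.le t1 t2 hst hbr hclipg e1 e2 e4 e5 e6 e8 e9 e11 e17 e19

end Valid

end State

end CLAOONS

end

/-! ### Invariants, restarts, and sums over active and inactive rounds. -/

noncomputable section

namespace CLAOONS

namespace State

variable {d : ℕ} {B₀ : ℝ} {s : State d} {𝒳 : Set (E d)}

lemma logDet_restart (s : State d) (g : E d) : (s.restart g).logDet = 0 := by
  simp [logDet, restart]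

namespace Valid

/-- After division by c = 4 zStart² ≥ 4B₀², the determinant is at most the d-th power of T(d +
z/(4B₀²)). Only log T is kept as a logarithm; the other factor is estimated by log y ≤ y. -/
lemma logDet_le (hs : s.Valid B₀) (hB₀ : 0 < B₀) {T z : ℝ} (hT : 1 ≤ T)
    (hz : 0 ≤ z) (htr : s.H.trace ≤ T * z) :
    s.logDet ≤ d * (Real.log T + d + z / (4 * B₀ ^ 2)) := by
  rcases Nat.eq_zero_or_pos d with rfl | hd
  · simp [logDet]
  have hZ := hs.zStart_pos hB₀
  have hd' : (1 : ℝ) ≤ d := by exact_mod_cast hd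
  have h1 := det_le_trace_pow (hs.posDef_base hB₀)
  have h2 := (hs.posDef_base hB₀).det_pos
  have htr0 := hs.posSemidef_H.trace_nonneg
  set c := 4 * s.zStart ^ 2 with hc
  have hcpos : 0 < c := by positivity
  have hcB : 4 * B₀ ^ 2 ≤ c := by
    have := pow_le_pow_left₀ hB₀.le hs.le_zStart 2
    linarith
  have h3 : (c • (1 : Matrix (Fin d) (Fin d) ℝ) + s.H).trace = c * d + s.H.trace := by
    simp
  have h4 : (c • (1 : Matrix (Fin d) (Fin d) ℝ)).det = c ^ d := by simp
  rw [h3] at h1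
  have h5 : Real.log (c • (1 : Matrix (Fin d) (Fin d) ℝ) + s.H).det
      ≤ d * Real.log (c * d + s.H.trace) := by
    rw [← Real.log_pow]; exact Real.log_le_log h2 h1
  have h6 : c * d + s.H.trace ≤ c * (T * (d + z / (4 * B₀ ^ 2))) := by
    have e1 : s.H.trace ≤ c * (T * (z / (4 * B₀ ^ 2))) := by
      refine htr.trans ?_
      have : z ≤ c * (z / (4 * B₀ ^ 2)) := by
        rw [mul_div_assoc', le_div_iff₀ (by positivity), mul_comm]
        exact mul_le_mul_of_nonneg_right hcB hz
      nlinarith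
    have e2 : c * d ≤ c * (T * d) := by
      apply mul_le_mul_of_nonneg_left _ hcpos.le
      nlinarith
    linarith
  have hpos : 0 < d + z / (4 * B₀ ^ 2) := by positivity
  have h7 : Real.log (c * d + s.H.trace)
      ≤ Real.log c + (Real.log T + (d + z / (4 * B₀ ^ 2))) := by
    refine (Real.log_le_log (by positivity) h6).trans ?_
    rw [Real.log_mul hcpos.ne' (by positivity), Real.log_mul (by positivity) hpos.ne']
    have := Real.log_le_sub_one_of_pos hpos
    linarith
  rw [logDet, h4, Real.log_pow]
  have h8 := mul_le_mul_of_nonneg_left h7 (by linarith : (0 : ℝ) ≤ d)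
  linarith

/-- The added trace is η‖∇ - m‖² ≤ (9/4)ηz², and ηz ≤ 1/64, so growth is linear in z and not
quadratic. -/
lemma trace_cont_le (hs : s.Valid B₀) (hB₀ : 0 < B₀) (hcl : IsClosed 𝒳) (h0 : 0 ∈ 𝒳) (g : E d) :
    (s.cont 𝒳 g).H.trace ≤ s.H.trace + s.z := by
  have h1 := hs.norm_corrected_sub_le hB₀ hcl h0 g
  have h2 := hs.eta_mul_z_le hB₀
  have hη := hs.eta_pos hB₀
  have hz := hs.z_pos hB₀
  set δ := s.corrected 𝒳 g - s.m with hδ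
  have h3 : (s.cont 𝒳 g).H.trace = s.H.trace + s.eta * ‖δ‖ ^ 2 := by
    have : δ.ofLp ⬝ᵥ δ.ofLp = ‖δ‖ ^ 2 := by
      rw [← inner_eq_dotProduct, real_inner_self_eq_norm_sq]
    simp only [State.cont, Matrix.trace_add, Matrix.trace_smul, Matrix.trace_vecMulVec,
      smul_eq_mul]
    rw [← this]
  have h4 : ‖δ‖ ^ 2 ≤ (3 / 2 * s.z) ^ 2 := pow_le_pow_left₀ (norm_nonneg _) h1 2
  have h5 := mul_le_mul_of_nonneg_left h4 hη.le
  rw [h3]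
  nlinarith

end Valid

/-- The invariants of the state before round `t`, for gradients of norm at most `G`. -/
structure Regular (B₀ G : ℝ) (t : ℕ) (s : State d) : Prop extends Valid B₀ s where
  z_le : s.z ≤ max B₀ (2 * G)
  norm_m_le : ‖s.m‖ ≤ G
  N_nonneg : 0 ≤ s.N
  N_le : s.N ≤ G
  S_nonneg : 0 ≤ s.S
  S_le_sq : s.S ≤ s.D ^ 2
  S_le : s.S ≤ t
  D_le : s.D ≤ max 1 (2 * Real.sqrt s.S)
  trace_le : s.H.trace ≤ t * s.z

lemma regular_init {G : ℝ} (hG : 0 ≤ G) :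
    (init d B₀).Regular B₀ G 0 := by
  refine ⟨⟨?_, ?_, ?_, Matrix.PosSemidef.zero, ?_⟩, ?_, ?_, ?_, ?_, ?_, ?_, ?_, ?_, ?_⟩ <;>
    simp [init, hG]

lemma norm_div_max_le_one (s : State d) (g : E d) : ‖g‖ / max 1 (s.newN g) ≤ 1 :=
  (div_le_one (lt_max_of_lt_left one_pos)).2 ((le_max_right _ _).trans (le_max_right _ _))

lemma norm_div_max_nonneg (s : State d) (g : E d) : 0 ≤ ‖g‖ / max 1 (s.newN g) :=
  div_nonneg (norm_nonneg _) (zero_le_one.trans (le_max_left _ _))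

lemma norm_div_max_le_norm (s : State d) (g : E d) : ‖g‖ / max 1 (s.newN g) ≤ ‖g‖ :=
  div_le_self (norm_nonneg _) (le_max_left _ _)

namespace Regular

variable {G : ℝ} {t : ℕ} {g : E d}

lemma newB_le (hs : s.Regular B₀ G t) (hg : ‖g‖ ≤ G) : s.newB g ≤ max B₀ (2 * G) := by
  refine max_le hs.z_le (le_trans ?_ (le_max_right _ _))
  exact (norm_sub_le _ _).trans (by linarith [hs.norm_m_le])

lemma newN_le (hs : s.Regular B₀ G t) (hg : ‖g‖ ≤ G) : s.newN g ≤ G := max_le hs.N_le hg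

lemma trace_cont_le' (hs : s.Regular B₀ G t) (hB₀ : 0 < B₀) (hcl : IsClosed 𝒳) (h0 : 0 ∈ 𝒳) :
    (s.cont 𝒳 g).H.trace ≤ (t + 1 : ℕ) * s.newB g := by
  have h1 := hs.trace_cont_le hB₀ hcl h0 g
  have h2 := hs.trace_le
  have h3 := s.z_le_newB g
  push_cast
  have : (t : ℝ) * s.z ≤ t * s.newB g := mul_le_mul_of_nonneg_left h3 (Nat.cast_nonneg _)
  linarith

lemma step (hs : s.Regular B₀ G t) (hB₀ : 0 < B₀) (hcl : IsClosed 𝒳) (h0 : 0 ∈ 𝒳)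
    (hg : ‖g‖ ≤ G) : (s.step 𝒳 g).Regular B₀ G (t + 1) := by
  have hN : 0 ≤ s.newN g := hs.N_nonneg.trans (le_max_left _ _)
  have hS : 0 ≤ s.newS g := add_nonneg hs.S_nonneg (s.norm_div_max_nonneg g)
  have hSle : s.newS g ≤ (t + 1 : ℕ) := by
    push_cast; exact add_le_add hs.S_le (s.norm_div_max_le_one g)
  have hB := hs.newB_pos hB₀ g
  by_cases h : s.D < Real.sqrt (s.newS g)
  · rw [step_of_lt 𝒳 h]
    refine ⟨hs.toValid.restart h, hs.newB_le hg, hg, hN, hs.newN_le hg, hS, ?_, hSle,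
      le_max_right _ _, ?_⟩
    · change s.newS g ≤ (2 * Real.sqrt (s.newS g)) ^ 2
      rw [mul_pow, Real.sq_sqrt hS]; linarith
    · change (0 : Matrix (Fin d) (Fin d) ℝ).trace ≤ _ * s.newB g
      rw [Matrix.trace_zero]; positivity
  · rw [step_of_not_lt 𝒳 h]
    refine ⟨hs.toValid.cont hB₀ 𝒳 g, hs.newB_le hg, hg, hN, hs.newN_le hg, hS, ?_, hSle, ?_,
      hs.trace_cont_le' hB₀ hcl h0⟩
    · change s.newS g ≤ s.D ^ 2
      exact (Real.sqrt_le_left (zero_le_one.trans hs.one_le_D)).1 (not_lt.1 h)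
    · change s.D ≤ max 1 (2 * Real.sqrt (s.newS g))
      refine hs.D_le.trans (max_le_max le_rfl ?_)
      have : s.S ≤ s.newS g := le_add_of_nonneg_right (s.norm_div_max_nonneg g)
      linarith [Real.sqrt_le_sqrt this]

end Regular

/-- The rounds after the first epoch in which the domain is large enough for the comparator. -/
def Active (u : E d) (s : State d) : Prop := 1 < s.D ∧ ‖u‖ ≤ s.D

end State

/-- The states of the algorithm on a sequence of observed gradients. -/
def trajectory {d : ℕ} (𝒳 : Set (E d)) (B₀ : ℝ) (g : ℕ → E d) : ℕ → State d
  | 0 => init d B₀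
  | t + 1 => (trajectory 𝒳 B₀ g t).step 𝒳 (g t)

open Classical in
/-- The number of restarts during the first `n` rounds. -/
def restarts {d : ℕ} (𝒳 : Set (E d)) (B₀ : ℝ) (g : ℕ → E d) (n : ℕ) : ℕ :=
  ∑ t ∈ Finset.range n,
    if (trajectory 𝒳 B₀ g t).D < Real.sqrt ((trajectory 𝒳 B₀ g t).newS (g t)) then 1 else 0

lemma sum_range_succ_le_sum {f : ℕ → ℝ} (hf : ∀ t, 0 ≤ f t) (n : ℕ) :
    ∑ t ∈ Finset.range n, f (t + 1) ≤ ∑ t ∈ Finset.range (n + 1), f t := by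
  rw [Finset.sum_range_succ']; linarith [hf 0]

lemma sum_range_le_sum_succ {f : ℕ → ℝ} (hf : ∀ t, 0 ≤ f t) (n : ℕ) :
    ∑ t ∈ Finset.range n, f t ≤ ∑ t ∈ Finset.range (n + 1), f t := by
  rw [Finset.sum_range_succ]; linarith [hf n]

lemma norm_sq_add_four_le {d : ℕ} (a b c e : E d) :
    ‖a + b + c + e‖ ^ 2 ≤ 4 * (‖a‖ ^ 2 + ‖b‖ ^ 2 + ‖c‖ ^ 2 + ‖e‖ ^ 2) := by
  have h1 : ‖a + b + c + e‖ ≤ ‖a‖ + ‖b‖ + ‖c‖ + ‖e‖ := by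
    refine (norm_add_le _ _).trans ?_
    gcongr
    exact norm_add₃_le
  have h2 := pow_le_pow_left₀ (norm_nonneg _) h1 2
  nlinarith [sq_nonneg (‖a‖ - ‖b‖), sq_nonneg (‖a‖ - ‖c‖), sq_nonneg (‖a‖ - ‖e‖),
    sq_nonneg (‖b‖ - ‖c‖), sq_nonneg (‖b‖ - ‖e‖), sq_nonneg (‖c‖ - ‖e‖)]

section Trajectory

variable {d : ℕ} {𝒳 : Set (E d)} {B₀ G : ℝ} {g : ℕ → E d}

local notation "st" => trajectory 𝒳 B₀ g

lemma trajectory_m_succ (t : ℕ) : (st (t + 1)).m = g t := by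
  change ((st t).step 𝒳 (g t)).m = g t
  rw [State.step]; split_ifs <;> rfl

lemma trajectory_z_succ (t : ℕ) : (st (t + 1)).z = (st t).newB (g t) := by
  change ((st t).step 𝒳 (g t)).z = _
  rw [State.step]; split_ifs <;> rfl

lemma trajectory_S_succ (t : ℕ) : (st (t + 1)).S = (st t).newS (g t) := by
  change ((st t).step 𝒳 (g t)).S = _
  rw [State.step]; split_ifs <;> rfl

lemma trajectory_S_le_sum (n : ℕ) : (st n).S ≤ ∑ t ∈ Finset.range n, ‖g t‖ := by
  induction n with
  | zero => simp [trajectory, init]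
  | succ n ih =>
    rw [trajectory_S_succ, Finset.sum_range_succ]
    exact add_le_add ih (State.norm_div_max_le_norm _ _)

lemma trajectory_S_mono : Monotone fun t => (st t).S := by
  apply monotone_nat_of_le_succ
  intro t
  rw [trajectory_S_succ]
  exact le_add_of_nonneg_right (State.norm_div_max_nonneg _ _)

variable (hB₀ : 0 < B₀) (hcl : IsClosed 𝒳) (h0 : 0 ∈ 𝒳) (hg : ∀ t, ‖g t‖ ≤ G)
include hB₀ hcl h0 hg

lemma trajectory_regular (t : ℕ) : (st t).Regular B₀ G t := by
  induction t with
  | zero => exact State.regular_init ((norm_nonneg _).trans (hg 0))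
  | succ t ih => exact ih.step hB₀ hcl h0 (hg t)

/-- A restart happens only if √S exceeds D, and then sets the radius to 2√S, so it more than doubles
D. -/
lemma two_pow_restarts_le (n : ℕ) : (2 : ℝ) ^ restarts 𝒳 B₀ g n ≤ (st n).D := by
  induction n with
  | zero => simp [restarts, trajectory, init]
  | succ n ih =>
    have h1 := (trajectory_regular hB₀ hcl h0 hg n).one_le_D
    rw [restarts, Finset.sum_range_succ, ← restarts]
    by_cases h : (st n).D < Real.sqrt ((st n).newS (g n))
    · rw [if_pos h, pow_succ]
      change _ ≤ ((st n).step 𝒳 (g n)).D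
      rw [State.step_of_lt 𝒳 h]
      change _ ≤ 2 * Real.sqrt ((st n).newS (g n))
      linarith
    · rw [if_neg h, add_zero]
      change _ ≤ ((st n).step 𝒳 (g n)).D
      rw [State.step_of_not_lt 𝒳 h]
      exact ih

/-- Combine the doubling of D with D ≤ max(1, 2√S) and S ≤ T: two to the number of restarts is at
most 2√T. -/
lemma restarts_le {T : ℕ} (hT : 1 ≤ T) : (restarts 𝒳 B₀ g T : ℝ) ≤ 1 + Real.log T := by
  have h1 := two_pow_restarts_le hB₀ hcl h0 hg T
  have h2 := trajectory_regular hB₀ hcl h0 hg T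
  have hT' : (1 : ℝ) ≤ T := by exact_mod_cast hT
  have h3 : (2 : ℝ) ^ restarts 𝒳 B₀ g T ≤ 2 * Real.sqrt T := by
    refine h1.trans (h2.D_le.trans (max_le ?_ ?_))
    · have := Real.one_le_sqrt.2 hT'
      linarith
    · have := Real.sqrt_le_sqrt h2.S_le
      linarith
  have h4 := Real.log_le_log (by positivity) h3
  rw [Real.log_pow, Real.log_mul (by norm_num) (by positivity),
    Real.log_sqrt (by positivity)] at h4
  have h5 := Real.log_two_gt_d9
  have h6 := Real.log_nonneg hT'
  have h7 : (0 : ℝ) ≤ restarts 𝒳 B₀ g T := Nat.cast_nonneg _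
  by_contra! h8
  nlinarith

open Classical in
/-- The regret of the active rounds. -/
lemma sum_active_regret_le (hcv : Convex ℝ 𝒳) {u : E d} (hu : u ∈ 𝒳) {T : ℕ} {R K₁ K₂ : ℝ}
    (hK₁ : 0 ≤ K₁) (hK₂ : 0 ≤ K₂)
    (hR : ∀ t < T, (st t).Active u → max (64 * (st t).D * (st t).z) (Real.sqrt (st t).V) ≤ R)
    (hcont : ∀ t < T, (st t).Active u → 60 * ‖u‖ ^ 2 * Real.sqrt ((st t).cont 𝒳 (g t)).V
      + 2 * R * ((st t).cont 𝒳 (g t)).logDet ≤ K₁)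
    (hlast : (st T).Active u → 60 * ‖u‖ ^ 2 * Real.sqrt (st T).V + 2 * R * (st T).logDet ≤ K₁)
    (hrestart : ∀ t < T, (st t).D < Real.sqrt ((st t).newS (g t)) →
      breg ((st t).restart (g t)).A u 0 ≤ K₂) :
    (∑ t ∈ Finset.range T, if (st t).Active u then
      inner ℝ (g t) ((st t).play 𝒳 - u) - 3 * (st t).D * ((st t).newB (g t) - (st t).z)
        + B₀ ^ 2 * (st t).movement 𝒳 (g t) else 0)
      ≤ (restarts 𝒳 B₀ g T + 1) * (K₁ + K₂) := by
  have hbreg : ∀ (t : ℕ) (w : E d), 0 ≤ breg (st t).A u w := by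
    intro t w
    have h := (trajectory_regular hB₀ hcl h0 hg t).toValid.norm_sq_le_sqNorm_A hB₀ (u - w)
    have : 0 ≤ 4 * B₀ ^ 2 * ‖u - w‖ ^ 2 := by positivity
    rw [breg]; linarith
  -- The potential is counted in active states only. The first epoch has D = 1 and is never active,
  -- so the induction starts at zero. A restart costs at most K₁ for closing an epoch and K₂ for
  -- opening the next.
  have key : ∀ n ≤ T, (∑ t ∈ Finset.range n, if (st t).Active u then
      inner ℝ (g t) ((st t).play 𝒳 - u) - 3 * (st t).D * ((st t).newB (g t) - (st t).z)
        + B₀ ^ 2 * (st t).movement 𝒳 (g t) else 0)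
      ≤ restarts 𝒳 B₀ g n * (K₁ + K₂)
        - if (st n).Active u then (st n).potential R u else 0 := by
    intro n
    induction n with
    | zero =>
      intro _
      have : ¬ (init d B₀).Active u := fun h => lt_irrefl _ h.1
      simp [restarts, trajectory, this]
    | succ n ih =>
      intro hn
      have hv := (trajectory_regular hB₀ hcl h0 hg n).toValid
      have ih := ih (Nat.le_of_succ_le hn)
      rw [restarts, Finset.sum_range_succ, Finset.sum_range_succ, ← restarts]
      change _ ≤ _ - if ((st n).step 𝒳 (g n)).Active u
        then ((st n).step 𝒳 (g n)).potential R u else 0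
      by_cases h : (st n).D < Real.sqrt ((st n).newS (g n))
      · have hfresh : (if ((st n).restart (g n)).Active u
            then ((st n).restart (g n)).potential R u else 0) ≤ K₂ := by
          split_ifs with h1
          · rw [State.potential, State.logDet_restart]
            change breg _ u 0 - 60 * ‖u‖ ^ 2 * Real.sqrt 0 - _ ≤ K₂
            have := hrestart n hn h
            simp only [Real.sqrt_zero]
            linarith
          · exact hK₂
        rw [if_pos h, State.step_of_lt 𝒳 h]
        push_cast
        by_cases hA : (st n).Active u
        · rw [if_pos hA] at ih ⊢
          have h1 := hv.regret_step_le hB₀ hcl hcv h0 ⟨hu, hA.2⟩ (g n) (hR n hn hA)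
          have h2 := hcont n hn hA
          -- The round that triggers a restart is charged as if the epoch continued; the divergence
          -- in the resulting potential is nonnegative and is dropped.
          have h3 : -((st n).cont 𝒳 (g n)).potential R u ≤ K₁ := by
            have h4 := (hv.cont hB₀ 𝒳 (g n)).norm_sq_le_sqNorm_A hB₀
              (u - ((st n).cont 𝒳 (g n)).x')
            have h5 : 0 ≤ 4 * B₀ ^ 2 * ‖u - ((st n).cont 𝒳 (g n)).x'‖ ^ 2 := by positivity
            rw [State.potential, breg]
            linarith
          linarith
        · rw [if_neg hA] at ih ⊢
          linarith
      · rw [if_neg h, State.step_of_not_lt 𝒳 h, add_zero]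
        have hiff : ((st n).cont 𝒳 (g n)).Active u ↔ (st n).Active u := Iff.rfl
        simp only [hiff]
        by_cases hA : (st n).Active u
        · rw [if_pos hA] at ih
          rw [if_pos hA, if_pos hA]
          have h1 := hv.regret_step_le hB₀ hcl hcv h0 ⟨hu, hA.2⟩ (g n) (hR n hn hA)
          linarith
        · rw [if_neg hA] at ih
          rw [if_neg hA, if_neg hA]
          linarith
  refine (key T le_rfl).trans ?_
  split_ifs with hA
  · have h1 := hlast hA
    have h2 := hbreg T (st T).x'
    rw [State.potential]
    linarith
  · linarith

omit hB₀ hcl h0 hg in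
open Classical in
/-- The sum of the squared clipped prediction errors over the active rounds. -/
lemma V_le_sum_active {u : E d} (n : ℕ) (hA : (st n).Active u) :
    (st n).V ≤ ∑ t ∈ Finset.range n,
      if (st t).Active u then ‖(st t).clip (g t) - (st t).m‖ ^ 2 else 0 := by
  induction n with
  | zero => exact absurd hA.1 (lt_irrefl _)
  | succ n ih =>
    have hnn : ∀ t, 0 ≤ if (st t).Active u then ‖(st t).clip (g t) - (st t).m‖ ^ 2 else 0 := by
      intro t; split_ifs <;> positivity
    rw [Finset.sum_range_succ]
    change ((st n).step 𝒳 (g n)).Active u at hA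
    change ((st n).step 𝒳 (g n)).V ≤ _
    by_cases h : (st n).D < Real.sqrt ((st n).newS (g n))
    · rw [State.step_of_lt 𝒳 h]
      exact add_nonneg (Finset.sum_nonneg fun t _ => hnn t) (hnn n)
    · rw [State.step_of_not_lt 𝒳 h] at hA ⊢
      -- Without a restart D is unchanged, so activity is inherited from the preceding round of the
      -- epoch.
      have hA' : (st n).Active u := hA
      rw [if_pos hA']
      exact add_le_add (ih hA') le_rfl

-- Without a restart, g_{t+1} - g_t is split into two noise terms, the variation p - q at the new
-- point, and q_{t+1} - p_t, which is controlled by the movement. Across a restart no movement bound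
-- is available and the crude bound 4G² is used, once per restart.
open Classical in
lemma sum_active_clip_sq_le_stochastic {u : E d} {L : ℝ} {p q : ℕ → E d} {T : ℕ}
    (hpq : ∀ t, t + 1 < T → ‖q (t + 1) - p t‖ ≤ L * ‖(st (t + 1)).play 𝒳 - (st t).play 𝒳‖) :
    (∑ t ∈ Finset.range T,
      if (st t).Active u then ‖(st t).clip (g t) - (st t).m‖ ^ 2 else 0)
    ≤ 4 * G ^ 2 * restarts 𝒳 B₀ g T + 8 * (∑ t ∈ Finset.range T, ‖g t - p t‖ ^ 2)
      + 4 * (∑ t ∈ Finset.range T, ‖p t - q t‖ ^ 2)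
      + 16 * L ^ 2 * (∑ t ∈ Finset.range T,
        if (st t).Active u then (st t).movement 𝒳 (g t) else 0) := by
  rcases T with _ | n
  · simp [restarts]
  set r : ℕ → ℝ := fun t =>
    if (st t).D < Real.sqrt ((st t).newS (g t)) then 1 else 0 with hr
  set mv : ℕ → ℝ := fun t => if (st t).Active u then (st t).movement 𝒳 (g t) else 0 with hmv
  have hrest : (restarts 𝒳 B₀ g (n + 1) : ℝ) = ∑ t ∈ Finset.range (n + 1), r t := by
    rw [restarts]; push_cast; rfl
  have hr0 : ∀ t, 0 ≤ r t := fun t => by simp only [hr]; split_ifs <;> norm_num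
  have hmv0 : ∀ t, 0 ≤ mv t := fun t => by
    simp only [hmv, State.movement]; split_ifs <;> positivity
  have hG : 0 ≤ G := (norm_nonneg _).trans (hg 0)
  have hterm : ∀ t ∈ Finset.range n,
      (if (st (t + 1)).Active u then ‖(st (t + 1)).clip (g (t + 1)) - (st (t + 1)).m‖ ^ 2 else 0)
      ≤ 4 * G ^ 2 * r t + 4 * ‖g (t + 1) - p (t + 1)‖ ^ 2 + 4 * ‖g t - p t‖ ^ 2
        + 4 * ‖p (t + 1) - q (t + 1)‖ ^ 2 + 8 * L ^ 2 * mv (t + 1) + 8 * L ^ 2 * mv t := by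
    intro t ht
    have e1 : 0 ≤ 4 * G ^ 2 * r t := mul_nonneg (by positivity) (hr0 t)
    have e2 : 0 ≤ 8 * L ^ 2 * mv (t + 1) := mul_nonneg (by positivity) (hmv0 _)
    have e3 : 0 ≤ 8 * L ^ 2 * mv t := mul_nonneg (by positivity) (hmv0 _)
    have e4 : 0 ≤ 4 * ‖g (t + 1) - p (t + 1)‖ ^ 2 := by positivity
    have e5 : 0 ≤ 4 * ‖g t - p t‖ ^ 2 := by positivity
    have e6 : 0 ≤ 4 * ‖p (t + 1) - q (t + 1)‖ ^ 2 := by positivity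
    split_ifs with hA
    · have hle := (trajectory_regular hB₀ hcl h0 hg (t + 1)).toValid.norm_clip_sub_le hB₀
        (g (t + 1))
      rw [trajectory_m_succ] at hle ⊢
      have hsq := pow_le_pow_left₀ (norm_nonneg _) hle 2
      by_cases h : (st t).D < Real.sqrt ((st t).newS (g t))
      · have hrt : r t = 1 := if_pos h
        have h2 : ‖g (t + 1) - g t‖ ≤ 2 * G :=
          (norm_sub_le _ _).trans (by linarith [hg t, hg (t + 1)])
        have h3 := pow_le_pow_left₀ (norm_nonneg _) h2 2
        rw [hrt] at e1 ⊢
        linarith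
      · have hst : st (t + 1) = (st t).cont 𝒳 (g t) := State.step_of_not_lt 𝒳 h
        have hA' : (st t).Active u := by rw [hst] at hA; exact hA
        have hx' : (st (t + 1)).x' = (st t).nextX' 𝒳 (g t) := by rw [hst]; rfl
        have h1 : g (t + 1) - g t = (g (t + 1) - p (t + 1)) + (p (t + 1) - q (t + 1))
            + (q (t + 1) - p t) + (p t - g t) := by abel
        have h2 := norm_sq_add_four_le (g (t + 1) - p (t + 1)) (p (t + 1) - q (t + 1))
          (q (t + 1) - p t) (p t - g t)
        rw [← h1, norm_sub_rev (p t)] at h2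
        have h3 := pow_le_pow_left₀ (norm_nonneg _)
          (hpq t (by have := Finset.mem_range.1 ht; omega)) 2
        -- Consecutive decisions are compared through x'_{t+1}, which enters the movement of round t
        -- as the updated iterate and that of round t + 1 as the starting one.
        have h4 : ‖(st (t + 1)).play 𝒳 - (st t).play 𝒳‖ ^ 2 ≤ 2 * (mv (t + 1) + mv t) := by
          have h5 : ‖(st (t + 1)).play 𝒳 - (st t).play 𝒳‖
              ≤ ‖(st (t + 1)).play 𝒳 - (st (t + 1)).x'‖
                + ‖(st t).play 𝒳 - (st t).nextX' 𝒳 (g t)‖ := by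
            rw [hx', norm_sub_rev ((st t).play 𝒳)]
            exact norm_sub_le_norm_sub_add_norm_sub _ _ _
          have h6 := pow_le_pow_left₀ (norm_nonneg _) h5 2
          simp only [hmv, if_pos hA, if_pos hA', State.movement]
          nlinarith [sq_nonneg (‖(st (t + 1)).play 𝒳 - (st (t + 1)).x'‖
                - ‖(st t).play 𝒳 - (st t).nextX' 𝒳 (g t)‖),
            sq_nonneg ‖(st (t + 1)).play 𝒳 - (st (t + 1)).nextX' 𝒳 (g (t + 1))‖,
            sq_nonneg ‖(st t).play 𝒳 - (st t).x'‖]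
        rw [mul_pow] at h3
        have h7 := mul_le_mul_of_nonneg_left h4 (sq_nonneg L)
        linarith
    · linarith
  -- Round 0 is never active, so every remaining round has a predecessor.
  rw [Finset.sum_range_succ', if_neg (show ¬ (st 0).Active u from fun h => lt_irrefl _ h.1),
    add_zero]
  refine (Finset.sum_le_sum hterm).trans ?_
  simp only [Finset.sum_add_distrib, ← Finset.mul_sum]
  have a1 := sum_range_le_sum_succ hr0 n
  have a2 := sum_range_le_sum_succ hmv0 n
  have a3 := sum_range_succ_le_sum hmv0 n
  have a4 := sum_range_le_sum_succ (f := fun t => ‖g t - p t‖ ^ 2) (fun t => sq_nonneg _) n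
  have a5 := sum_range_succ_le_sum (f := fun t => ‖g t - p t‖ ^ 2) (fun t => sq_nonneg _) n
  have a6 := sum_range_succ_le_sum (f := fun t => ‖p t - q t‖ ^ 2) (fun t => sq_nonneg _) n
  have b1 := mul_le_mul_of_nonneg_left a1 (by positivity : 0 ≤ 4 * G ^ 2)
  have b2 := mul_le_mul_of_nonneg_left a2 (by positivity : 0 ≤ 8 * L ^ 2)
  have b3 := mul_le_mul_of_nonneg_left a3 (by positivity : 0 ≤ 8 * L ^ 2)
  rw [hrest]
  linarith

-- Since m_t is the previous gradient, (‖g‖ + ‖m‖)² ≤ 2G(‖g‖ + ‖m‖) suffices. This second estimate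
-- has no factor ‖u‖ and serves the part of the bound that does not vanish at u = 0.
open Classical in
lemma sum_active_clip_sq_le_norm {u : E d} (T : ℕ) :
    (∑ t ∈ Finset.range T,
      if (st t).Active u then ‖(st t).clip (g t) - (st t).m‖ ^ 2 else 0)
    ≤ 4 * G * ∑ t ∈ Finset.range T, ‖g t‖ := by
  have hG : 0 ≤ G := (norm_nonneg _).trans (hg 0)
  have hm : ∑ t ∈ Finset.range T, ‖(st t).m‖ ≤ ∑ t ∈ Finset.range T, ‖g t‖ := by
    rcases T with _ | n
    · simp
    · rw [Finset.sum_range_succ']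
      simp only [trajectory_m_succ]
      have : ‖(st 0).m‖ = 0 := by simp [trajectory, init]
      rw [this, add_zero]
      exact sum_range_le_sum_succ (fun t => norm_nonneg _) n
  have hterm : ∀ t ∈ Finset.range T,
      (if (st t).Active u then ‖(st t).clip (g t) - (st t).m‖ ^ 2 else 0)
      ≤ 2 * G * ‖g t‖ + 2 * G * ‖(st t).m‖ := by
    intro t _
    have hr := trajectory_regular hB₀ hcl h0 hg t
    split_ifs
    · have h1 := (hr.toValid.norm_clip_sub_le hB₀ (g t)).trans (norm_sub_le _ _)
      have h2 := pow_le_pow_left₀ (norm_nonneg _) h1 2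
      have h3 := hr.norm_m_le
      have h4 := hg t
      nlinarith [norm_nonneg (g t), norm_nonneg (st t).m]
    · positivity
  refine (Finset.sum_le_sum hterm).trans ?_
  rw [Finset.sum_add_distrib, ← Finset.mul_sum, ← Finset.mul_sum]
  nlinarith

open Classical in
/-- The total gradient norm of the inactive rounds. -/
lemma sum_inactive_norm_le {u : E d} (n : ℕ) :
    (∑ t ∈ Finset.range n, if (st t).Active u then 0 else ‖g t‖)
    ≤ max 1 G * min (st n).S ((max 1 ‖u‖) ^ 2 + 1) := by
  have hG : 0 < max 1 G := lt_max_of_lt_left one_pos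
  induction n with
  | zero => simp [trajectory, init]; positivity
  | succ n ih =>
    have hr := trajectory_regular hB₀ hcl h0 hg n
    have hmono := trajectory_S_mono (𝒳 := 𝒳) (B₀ := B₀) (g := g) (Nat.le_succ n)
    rw [Finset.sum_range_succ]
    split_ifs with hA
    · rw [add_zero]
      exact ih.trans (mul_le_mul_of_nonneg_left (min_le_min hmono le_rfl) hG.le)
    · have hS : (st (n + 1)).S = (st n).S + ‖g n‖ / max 1 ((st n).newN (g n)) :=
        trajectory_S_succ n
      have hD : (st n).D ≤ max 1 ‖u‖ := by
        rcases le_or_gt (st n).D 1 with h | h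
        · exact h.trans (le_max_left _ _)
        · have : ¬ ‖u‖ ≤ (st n).D := fun h' => hA ⟨h, h'⟩
          exact (not_le.1 this).le.trans (le_max_right _ _)
      -- The invariant S ≤ D² bounds S before the round and the increment is at most 1. Hence in an
      -- inactive round the minimum is S itself and grows by the full increment.
      have hS1 : (st (n + 1)).S ≤ (max 1 ‖u‖) ^ 2 + 1 := by
        rw [hS]
        have := pow_le_pow_left₀ (zero_le_one.trans hr.one_le_D) hD 2
        linarith [hr.S_le_sq, (st n).norm_div_max_le_one (g n)]
      have hg' : ‖g n‖ ≤ max 1 G * (‖g n‖ / max 1 ((st n).newN (g n))) := by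
        rw [mul_div_assoc', le_div_iff₀ (lt_max_of_lt_left one_pos), mul_comm]
        exact mul_le_mul_of_nonneg_right (max_le_max le_rfl (hr.newN_le (hg n))) (norm_nonneg _)
      rw [min_eq_left hS1, hS, mul_add]
      exact add_le_add (ih.trans (mul_le_mul_of_nonneg_left (min_le_left _ _) hG.le)) hg'

end Trajectory

end CLAOONS

end

/-! ### The pathwise regret bound. -/

noncomputable section

namespace CLAOONS

lemma add_sq_four_le_sq_add {a b c e : ℝ} (ha : 0 ≤ a) (hb : 0 ≤ b) (hc : 0 ≤ c) (he : 0 ≤ e) :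
    a ^ 2 + b ^ 2 + c ^ 2 + e ^ 2 ≤ (a + b + c + e) ^ 2 := by
  have : 0 ≤ 2 * (a * b + a * c + a * e + b * c + b * e + c * e) := by positivity
  linarith

section Pathwise

variable {d : ℕ} {𝒳 : Set (E d)} {B₀ G : ℝ} {g : ℕ → E d}

local notation "st" => trajectory 𝒳 B₀ g

variable (hB₀ : 0 < B₀) (hcl : IsClosed 𝒳) (h0 : 0 ∈ 𝒳) (hg : ∀ t, ‖g t‖ ≤ G)
include hB₀ hcl h0 hg

open Classical in
lemma sum_active_regret_le_of_bounds (hcv : Convex ℝ 𝒳) {u : E d} (hu : u ∈ 𝒳) {T : ℕ}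
    (hT : 1 ≤ T) {z V : ℝ} (hz : max B₀ (2 * G) ≤ z)
    (hV : (∑ t ∈ Finset.range T,
      if (st t).Active u then ‖(st t).clip (g t) - (st t).m‖ ^ 2 else 0) ≤ V) :
    (∑ t ∈ Finset.range T, if (st t).Active u then inner ℝ (g t) ((st t).play 𝒳 - u) else 0)
      + B₀ ^ 2 * (∑ t ∈ Finset.range T, if (st t).Active u then (st t).movement 𝒳 (g t) else 0)
      ≤ (restarts 𝒳 B₀ g T + 1) * (60 * ‖u‖ ^ 2 * Real.sqrt V
          + 2 * (128 * z * Real.sqrt (st T).S + Real.sqrt V)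
            * (d * (Real.log T + d + z / (4 * B₀ ^ 2)))
          + (2 * z ^ 2 + z) * ‖u‖ ^ 2) + 6 * z * Real.sqrt (st T).S := by
  set Q := Real.sqrt (st T).S with hQ
  set Λ := d * (Real.log T + d + z / (4 * B₀ ^ 2)) with hΛ
  -- An upper bound for 1/η in all active rounds, because there D ≤ 2Q.
  set R := 128 * z * Q + Real.sqrt V with hR
  have hz0 : 0 < z := hB₀.trans_le ((le_max_left _ _).trans hz)
  have hT' : (1 : ℝ) ≤ T := by exact_mod_cast hT
  have hΛ0 : 0 ≤ Λ := by have := Real.log_nonneg hT'; positivity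
  have hQ0 : 0 ≤ Q := Real.sqrt_nonneg _
  have hR0 : 0 ≤ R := by positivity
  have hreg := trajectory_regular hB₀ hcl h0 hg
  -- The reason for excluding the first epoch: its radius 1 is not bounded by a multiple of √S, and
  -- the final bound has no additive constant.
  have hD : ∀ t ≤ T, (st t).Active u → (st t).D ≤ 2 * Q := by
    intro t ht hA
    have h1 := (hreg t).D_le
    have h2 := Real.sqrt_le_sqrt (trajectory_S_mono (𝒳 := 𝒳) (B₀ := B₀) (g := g) ht)
    rcases le_max_iff.1 h1 with h | h
    · exact absurd hA.1 (not_lt.2 h)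
    · linarith
  have hnn : ∀ t, 0 ≤ if (st t).Active u then ‖(st t).clip (g t) - (st t).m‖ ^ 2 else 0 := by
    intro t; split_ifs <;> positivity
  have hVt : ∀ t ≤ T, (st t).Active u → (st t).V ≤ V := by
    intro t ht hA
    refine (V_le_sum_active t hA).trans (le_trans ?_ hV)
    exact Finset.sum_le_sum_of_subset_of_nonneg (Finset.range_mono ht) fun i _ _ => hnn i
  have hVc : ∀ t < T, (st t).Active u → ((st t).cont 𝒳 (g t)).V ≤ V := by
    intro t ht hA
    have h1 := V_le_sum_active t hA
    refine le_trans ?_ ((Finset.sum_le_sum_of_subset_of_nonneg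
      (Finset.range_mono (Nat.succ_le_of_lt ht)) fun i _ _ => hnn i).trans hV)
    rw [Finset.sum_range_succ, if_pos hA]
    exact add_le_add h1 le_rfl
  have htr : ∀ t ≤ T, (st t).H.trace ≤ T * z := by
    intro t ht
    refine (hreg t).trace_le.trans ?_
    exact mul_le_mul (by exact_mod_cast ht) ((hreg t).z_le.trans hz)
      ((hreg t).toValid.z_pos hB₀).le (by linarith)
  have htc : ∀ t < T, ((st t).cont 𝒳 (g t)).H.trace ≤ T * z := by
    intro t ht
    refine ((hreg t).trace_cont_le' hB₀ hcl h0).trans ?_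
    exact mul_le_mul (by exact_mod_cast ht) (((hreg t).newB_le (hg t)).trans hz)
      ((hreg t).toValid.newB_pos hB₀ _).le (by linarith)
  have hK : ∀ (v : ℝ) (l : ℝ), v ≤ V → l ≤ Λ →
      60 * ‖u‖ ^ 2 * Real.sqrt v + 2 * R * l ≤ 60 * ‖u‖ ^ 2 * Real.sqrt V + 2 * R * Λ := by
    intro v l hv hl
    have := Real.sqrt_le_sqrt hv
    gcongr
  have main := sum_active_regret_le hB₀ hcl h0 hg hcv hu (T := T) (R := R)
    (K₁ := 60 * ‖u‖ ^ 2 * Real.sqrt V + 2 * R * Λ) (K₂ := (2 * z ^ 2 + z) * ‖u‖ ^ 2)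
    (by positivity) (by positivity)
    (by
      intro t ht hA
      refine max_le ?_ ?_
      · have h1 := mul_le_mul (hD t ht.le hA) ((hreg t).z_le.trans hz)
          ((hreg t).toValid.z_pos hB₀).le (by linarith)
        have := Real.sqrt_nonneg V
        rw [hR]
        linarith
      · have := Real.sqrt_le_sqrt (hVt t ht.le hA)
        have : 0 ≤ 128 * z * Q := by positivity
        linarith)
    (fun t ht hA => hK _ _ (hVc t ht hA)
      (((hreg t).toValid.cont hB₀ 𝒳 (g t)).logDet_le hB₀ hT' hz0.le (htc t ht)))
    (fun hA => hK _ _ (hVt T le_rfl hA)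
      ((hreg T).toValid.logDet_le hB₀ hT' hz0.le (htr T le_rfl)))
    (by
      intro t ht hrs
      have hzB := ((hreg t).newB_le (hg t)).trans hz
      have hv := (hreg t).toValid.restart hrs
      set r := (st t).restart (g t) with hr
      have hrz : r.z ≤ z := hzB
      have hrz0 := hv.z_pos hB₀
      have h1 := hv.eta_mul_z_le hB₀
      have h2 : breg r.A u 0 = 2 * (r.z ^ 2 + r.eta * r.z ^ 2) * ‖u‖ ^ 2 := by
        rw [breg, State.sqNorm_A, sub_zero]
        have e1 : r.zStart = r.z := rfl
        have e2 : r.H = 0 := rfl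
        rw [e1, e2]
        simp [sqNorm]
        ring
      rw [h2]
      refine mul_le_mul_of_nonneg_right ?_ (sq_nonneg _)
      nlinarith)
  have hsum : (∑ t ∈ Finset.range T, if (st t).Active u then
      inner ℝ (g t) ((st t).play 𝒳 - u) - 3 * (st t).D * ((st t).newB (g t) - (st t).z)
        + B₀ ^ 2 * (st t).movement 𝒳 (g t) else 0)
      ≥ (∑ t ∈ Finset.range T, if (st t).Active u then inner ℝ (g t) ((st t).play 𝒳 - u) else 0)
      + B₀ ^ 2 * (∑ t ∈ Finset.range T, if (st t).Active u then (st t).movement 𝒳 (g t) else 0)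
      - 6 * Q * ∑ t ∈ Finset.range T, ((st (t + 1)).z - (st t).z) := by
    rw [ge_iff_le, Finset.mul_sum, Finset.mul_sum, ← Finset.sum_add_distrib,
      ← Finset.sum_sub_distrib]
    apply Finset.sum_le_sum
    intro t ht
    rw [trajectory_z_succ]
    have h1 := (st t).z_le_newB (g t)
    split_ifs with hA
    · have h2 := hD t (Finset.mem_range.1 ht).le hA
      have := mul_le_mul_of_nonneg_right h2 (sub_nonneg.2 h1)
      linarith
    · have := mul_nonneg hQ0 (sub_nonneg.2 h1)
      linarith
  rw [Finset.sum_range_sub (fun t => (st t).z)] at hsum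
  have h3 : (st T).z - (st 0).z ≤ z := by
    have := (hreg T).z_le.trans hz
    have := (hreg 0).toValid.z_pos hB₀
    linarith
  have h4 := mul_le_mul_of_nonneg_left h3 hQ0
  linarith

-- In inactive rounds ‖x_t‖ ≤ max(1, ‖u‖), so `sum_inactive_norm_le` applies. For ‖u‖ ≤ 1 use min(S,
-- 2) ≤ (3/2)√S, for ‖u‖ > 1 use 2‖u‖(‖u‖² + 1) ≤ 4‖u‖³.
open Classical in
lemma sum_inactive_regret_le {u : E d} (T : ℕ) :
    (∑ t ∈ Finset.range T, if (st t).Active u then 0 else inner ℝ (g t) ((st t).play 𝒳 - u))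
    ≤ max 1 G * (3 * Real.sqrt (st T).S + 4 * ‖u‖ ^ 3) := by
  have hreg := trajectory_regular hB₀ hcl h0 hg
  have hG : 0 < max 1 G := lt_max_of_lt_left one_pos
  have h1 := sum_inactive_norm_le hB₀ hcl h0 hg (u := u) T
  set U := max 1 ‖u‖ with hU
  have hS0 := (hreg T).S_nonneg
  have h2 : (∑ t ∈ Finset.range T,
      if (st t).Active u then 0 else inner ℝ (g t) ((st t).play 𝒳 - u))
      ≤ (U + ‖u‖) * ∑ t ∈ Finset.range T, if (st t).Active u then 0 else ‖g t‖ := by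
    rw [Finset.mul_sum]
    apply Finset.sum_le_sum
    intro t _
    split_ifs with hA
    · simp
    · have hD : (st t).D ≤ U := by
        rcases le_or_gt (st t).D 1 with h | h
        · exact h.trans (le_max_left _ _)
        · have : ¬ ‖u‖ ≤ (st t).D := fun h' => hA ⟨h, h'⟩
          exact (not_le.1 this).le.trans (le_max_right _ _)
      have hx := (State.play_spec (zero_le_one.trans (hreg t).one_le_D) hcl h0).1.2
      have h3 : ‖(st t).play 𝒳 - u‖ ≤ U + ‖u‖ := (norm_sub_le _ _).trans (by linarith)
      rw [mul_comm]
      exact (real_inner_le_norm _ _).trans (mul_le_mul_of_nonneg_left h3 (norm_nonneg _))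
  have hU0 : 0 ≤ U + ‖u‖ := by positivity
  refine h2.trans ((mul_le_mul_of_nonneg_left h1 hU0).trans ?_)
  rw [mul_left_comm]
  refine mul_le_mul_of_nonneg_left ?_ hG.le
  have hQ0 := Real.sqrt_nonneg (st T).S
  have hn := norm_nonneg u
  rcases le_or_gt ‖u‖ 1 with hu1 | hu1
  · have hU1 : U = 1 := max_eq_left hu1
    have h5 : min (st T).S (1 ^ 2 + 1) ≤ 3 / 2 * Real.sqrt (st T).S := by
      have hsq := Real.sq_sqrt hS0
      rcases le_or_gt (st T).S 2 with h | h
      · refine (min_le_left _ _).trans ?_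
        have : Real.sqrt (st T).S ≤ 3 / 2 := by nlinarith
        nlinarith
      · refine (min_le_right _ _).trans ?_
        have : 4 / 3 ≤ Real.sqrt (st T).S := by nlinarith
        linarith
    rw [hU1]
    have h6 : 0 ≤ min (st T).S (1 ^ 2 + 1) := le_min hS0 (by norm_num)
    have h7 : 0 ≤ ‖u‖ ^ 3 := by positivity
    have h8 := mul_le_mul_of_nonneg_right (by linarith : 1 + ‖u‖ ≤ 2) h6
    refine h8.trans ?_
    refine (mul_le_mul_of_nonneg_left h5 zero_le_two).trans ?_
    linarith
  · have hU1 : U = ‖u‖ := max_eq_right hu1.le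
    rw [hU1]
    have h6 : (‖u‖ + ‖u‖) * min (st T).S (‖u‖ ^ 2 + 1) ≤ (‖u‖ + ‖u‖) * (‖u‖ ^ 2 + 1) :=
      mul_le_mul_of_nonneg_left (min_le_right _ _) (by linarith)
    nlinarith

/-- Active and inactive rounds are added, with `c1` estimating √V next to ‖u‖² and `c2` next to the
log determinant. One factor 1 + log T counts the epochs; a second one comes from the log
determinant, the restarts inside √V, or the square that absorbs the movement. -/
lemma sum_inner_regret_le (hcv : Convex ℝ 𝒳) {u : E d} (hu : u ∈ 𝒳) {T : ℕ}
    (hT : 1 ≤ T) {L z : ℝ} {p q : ℕ → E d} (hL : 0 ≤ L) (hz : max B₀ (2 * G) ≤ z)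
    (hpq : ∀ t, t + 1 < T → ‖q (t + 1) - p t‖ ≤ L * ‖(st (t + 1)).play 𝒳 - (st t).play 𝒳‖) :
    ∑ t ∈ Finset.range T, inner ℝ (g t) ((st t).play 𝒳 - u)
      ≤ 2 * (1 + Real.log T) * (60 * ‖u‖ ^ 2 *
          (2 * G * (1 + Real.log T)
            + 3 * Real.sqrt (∑ t ∈ Finset.range T, ‖g t - p t‖ ^ 2)
            + 2 * Real.sqrt (∑ t ∈ Finset.range T, ‖p t - q t‖ ^ 2))
          + 2 * ((128 * z + 2 * Real.sqrt G) * Real.sqrt (∑ t ∈ Finset.range T, ‖g t‖))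
            * (d * (Real.log T + d + z / (4 * B₀ ^ 2)))
          + (2 * z ^ 2 + z) * ‖u‖ ^ 2)
        + (240 * L * (1 + Real.log T) * ‖u‖ ^ 2) ^ 2 / B₀ ^ 2
        + 6 * z * Real.sqrt (∑ t ∈ Finset.range T, ‖g t‖)
        + max 1 G * (3 * Real.sqrt (∑ t ∈ Finset.range T, ‖g t‖) + 4 * ‖u‖ ^ 3) := by
  classical
  have hreg := trajectory_regular hB₀ hcl h0 hg
  have hG : 0 ≤ G := (norm_nonneg _).trans (hg 0)
  have hT' : (1 : ℝ) ≤ T := by exact_mod_cast hT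
  have hlog := Real.log_nonneg hT'
  have hz0 : 0 < z := hB₀.trans_le ((le_max_left _ _).trans hz)
  have hr := restarts_le hB₀ hcl h0 hg hT
  have hr0 : (0 : ℝ) ≤ restarts 𝒳 B₀ g T := Nat.cast_nonneg _
  have b1 := sum_active_regret_le_of_bounds hB₀ hcl h0 hg hcv hu hT hz le_rfl
  have b2 := sum_inactive_regret_le hB₀ hcl h0 hg (u := u) T
  have b3 := sum_active_clip_sq_le_stochastic hB₀ hcl h0 hg (u := u) hpq
  have b4 := sum_active_clip_sq_le_norm hB₀ hcl h0 hg (u := u) T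
  have b5 := Real.sqrt_le_sqrt (trajectory_S_le_sum (𝒳 := 𝒳) (B₀ := B₀) (g := g) T)
  have hsplit : ∑ t ∈ Finset.range T, inner ℝ (g t) ((st t).play 𝒳 - u)
      = (∑ t ∈ Finset.range T, if (st t).Active u then inner ℝ (g t) ((st t).play 𝒳 - u) else 0)
      + ∑ t ∈ Finset.range T,
        if (st t).Active u then 0 else inner ℝ (g t) ((st t).play 𝒳 - u) := by
    rw [← Finset.sum_add_distrib]
    refine Finset.sum_congr rfl fun t _ => ?_
    split_ifs <;> simp
  have hP0 : 0 ≤ ∑ t ∈ Finset.range T,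
      if (st t).Active u then (st t).movement 𝒳 (g t) else 0 := by
    refine Finset.sum_nonneg fun t _ => ?_
    simp only [State.movement]; split_ifs <;> positivity
  have hN0 : 0 ≤ ∑ t ∈ Finset.range T, ‖g t - p t‖ ^ 2 :=
    Finset.sum_nonneg fun t _ => sq_nonneg _
  have hW0 : 0 ≤ ∑ t ∈ Finset.range T, ‖p t - q t‖ ^ 2 :=
    Finset.sum_nonneg fun t _ => sq_nonneg _
  have hS0 : 0 ≤ ∑ t ∈ Finset.range T, ‖g t‖ := Finset.sum_nonneg fun t _ => norm_nonneg _
  rw [hsplit]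
  generalize (∑ t ∈ Finset.range T,
    if (st t).Active u then inner ℝ (g t) ((st t).play 𝒳 - u) else 0) = I₁ at *
  generalize (∑ t ∈ Finset.range T,
    if (st t).Active u then 0 else inner ℝ (g t) ((st t).play 𝒳 - u)) = I₂ at *
  generalize (∑ t ∈ Finset.range T,
    if (st t).Active u then (st t).movement 𝒳 (g t) else 0) = P at *
  generalize (∑ t ∈ Finset.range T,
    if (st t).Active u then ‖(st t).clip (g t) - (st t).m‖ ^ 2 else 0) = V at *
  generalize (∑ t ∈ Finset.range T, ‖g t - p t‖ ^ 2) = N at *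
  generalize (∑ t ∈ Finset.range T, ‖p t - q t‖ ^ 2) = W at *
  generalize (∑ t ∈ Finset.range T, ‖g t‖) = S at *
  generalize (restarts 𝒳 B₀ g T : ℝ) = r at *
  generalize Real.sqrt (st T).S = Q₀ at *
  clear hsplit hreg hpq
  set ℓ := 1 + Real.log T with hℓ
  have hℓ1 : 1 ≤ ℓ := by linarith
  have c1 : Real.sqrt V ≤ 2 * G * ℓ + 3 * Real.sqrt N + 2 * Real.sqrt W
      + 4 * L * Real.sqrt P := by
    refine Real.sqrt_le_iff.2 ⟨by positivity, b3.trans ?_⟩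
    have hN := Real.sq_sqrt hN0
    have hW := Real.sq_sqrt hW0
    have hP := Real.sq_sqrt hP0
    have hrℓ : r ≤ ℓ ^ 2 := by nlinarith
    have h1 := mul_le_mul_of_nonneg_left hrℓ (by positivity : 0 ≤ 4 * G ^ 2)
    have h1' : 4 * G ^ 2 * ℓ ^ 2 = (2 * G * ℓ) ^ 2 := by ring
    rw [h1'] at h1
    have h2 : 0 ≤ 2 * G * ℓ := by positivity
    have h3 : 0 ≤ 3 * Real.sqrt N := by positivity
    have h4 : 0 ≤ 2 * Real.sqrt W := by positivity
    have h5 : 0 ≤ 4 * L * Real.sqrt P := by positivity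
    have h6 : 8 * N ≤ (3 * Real.sqrt N) ^ 2 := by rw [mul_pow, hN]; linarith
    have h7 : 4 * W = (2 * Real.sqrt W) ^ 2 := by rw [mul_pow, hW]; ring
    have h8 : 16 * L ^ 2 * P = (4 * L * Real.sqrt P) ^ 2 := by rw [mul_pow, hP]; ring
    rw [h7, h8]
    have := add_sq_four_le_sq_add h2 h3 h4 h5
    linarith
  have c2 : Real.sqrt V ≤ 2 * Real.sqrt G * Real.sqrt S := by
    refine Real.sqrt_le_iff.2 ⟨by positivity, b4.trans_eq ?_⟩
    rw [mul_pow, mul_pow, Real.sq_sqrt hG, Real.sq_sqrt hS0]; ring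
  set Λ := d * (Real.log T + d + z / (4 * B₀ ^ 2)) with hΛ
  have hΛ0 : 0 ≤ Λ := by positivity
  have c3 : 60 * ‖u‖ ^ 2 * Real.sqrt V + 2 * (128 * z * Q₀ + Real.sqrt V) * Λ
      + (2 * z ^ 2 + z) * ‖u‖ ^ 2
      ≤ 60 * ‖u‖ ^ 2 * (2 * G * ℓ + 3 * Real.sqrt N + 2 * Real.sqrt W + 4 * L * Real.sqrt P)
        + 2 * ((128 * z + 2 * Real.sqrt G) * Real.sqrt S) * Λ + (2 * z ^ 2 + z) * ‖u‖ ^ 2 := by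
    have h1 : 128 * z * Q₀ + Real.sqrt V ≤ (128 * z + 2 * Real.sqrt G) * Real.sqrt S := by
      have := mul_le_mul_of_nonneg_left b5 (by positivity : 0 ≤ 128 * z)
      linarith
    gcongr
  have c4 : (r + 1) * (60 * ‖u‖ ^ 2 * Real.sqrt V + 2 * (128 * z * Q₀ + Real.sqrt V) * Λ
      + (2 * z ^ 2 + z) * ‖u‖ ^ 2)
      ≤ 2 * ℓ * (60 * ‖u‖ ^ 2 * (2 * G * ℓ + 3 * Real.sqrt N + 2 * Real.sqrt W
          + 4 * L * Real.sqrt P)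
        + 2 * ((128 * z + 2 * Real.sqrt G) * Real.sqrt S) * Λ
        + (2 * z ^ 2 + z) * ‖u‖ ^ 2) := by
    refine (mul_le_mul_of_nonneg_left c3 (by linarith)).trans ?_
    exact mul_le_mul_of_nonneg_right (by linarith) (by positivity)
  -- The movement P inside √V is absorbed by the negative movement term of the one-round bounds; 480
  -- = 2 · 60 · 4.
  have c5 : 480 * L * ℓ * ‖u‖ ^ 2 * Real.sqrt P
      ≤ (240 * L * ℓ * ‖u‖ ^ 2) ^ 2 / B₀ ^ 2 + B₀ ^ 2 * P := by
    have h1 := sq_nonneg (240 * L * ℓ * ‖u‖ ^ 2 / B₀ - B₀ * Real.sqrt P)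
    have h2 : (240 * L * ℓ * ‖u‖ ^ 2 / B₀ - B₀ * Real.sqrt P) ^ 2
        = (240 * L * ℓ * ‖u‖ ^ 2) ^ 2 / B₀ ^ 2 - 480 * L * ℓ * ‖u‖ ^ 2 * Real.sqrt P
          + B₀ ^ 2 * Real.sqrt P ^ 2 := by
      field_simp
      ring
    rw [Real.sq_sqrt hP0] at h2
    linarith
  have c6 := mul_le_mul_of_nonneg_left b5 (by positivity : 0 ≤ 6 * z)
  have c7 : max 1 G * (3 * Q₀ + 4 * ‖u‖ ^ 3) ≤ max 1 G * (3 * Real.sqrt S + 4 * ‖u‖ ^ 3) :=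
    mul_le_mul_of_nonneg_left (by linarith) (zero_le_one.trans (le_max_left _ _))
  linarith

end Pathwise

/-- The pathwise regret bound of the algorithm, for an arbitrary sequence of observed gradients. -/
theorem exists_pathwise_regret_bound (d : ℕ) {L B₀ G₀ : ℝ} (hL : 0 ≤ L) (hB₀ : 0 < B₀)
    (hG₀ : 0 < G₀) :
    ∃ C : ℝ, 0 ≤ C ∧ ∀ (𝒳 : Set (E d)) (G : ℝ) (g p q : ℕ → E d) (u : E d) (T : ℕ),
      IsClosed 𝒳 → Convex ℝ 𝒳 → 0 ∈ 𝒳 → u ∈ 𝒳 → G₀ ≤ G → 1 ≤ T → (∀ t, ‖g t‖ ≤ G) →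
      (∀ t, t + 1 < T → ‖q (t + 1) - p t‖
        ≤ L * ‖(trajectory 𝒳 B₀ g (t + 1)).play 𝒳 - (trajectory 𝒳 B₀ g t).play 𝒳‖) →
      ∑ t ∈ Finset.range T, inner ℝ (g t) ((trajectory 𝒳 B₀ g t).play 𝒳 - u)
        ≤ C * (1 + Real.log T) ^ 2 *
          (‖u‖ ^ 2 * (Real.sqrt (∑ t ∈ Finset.range T, ‖g t - p t‖ ^ 2)
              + Real.sqrt (∑ t ∈ Finset.range T, ‖p t - q t‖ ^ 2))
            + G ^ 2 * ‖u‖ ^ 2 + ‖u‖ ^ 4 + G * ‖u‖ ^ 3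
            + G ^ 2 * Real.sqrt (∑ t ∈ Finset.range T, ‖g t‖)) := by
  -- κG ≥ 1, so missing powers of G can be supplied; this is the only role of the lower bound G₀.
  set κ := G₀⁻¹ with hκ
  set cz := B₀ * κ + 2 with hcz
  set c₁ := κ + 1 with hc₁
  set cΛ := d * (κ + d * κ + cz / (4 * B₀ ^ 2)) with hcΛ
  have hκ0 : 0 < κ := inv_pos.2 hG₀
  have hcz0 : 0 < cz := by positivity
  have hc₁0 : 0 < c₁ := by positivity
  have hcΛ0 : 0 ≤ cΛ := by positivity
  -- The five groups are the coefficients of ‖u‖²(√N + √W), G²‖u‖², ‖u‖⁴, G‖u‖³ and G²√S, in this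
  -- order, where N, W and S are the three sums under the roots.
  refine ⟨360 + (240 * κ + 4 * cz ^ 2 + 2 * cz * κ) + (240 * L) ^ 2 / B₀ ^ 2 + 4 * c₁
    + (4 * (128 * cz + 2 * c₁) * cΛ + 6 * cz * κ + 3 * c₁ * κ), by positivity, ?_⟩
  intro 𝒳 G g p q u T hcl hcv h0 hu hG hT hg hpq
  have hG0 : 0 < G := hG₀.trans_le hG
  have hκG : 1 ≤ κ * G := by
    rw [hκ, inv_mul_eq_div, one_le_div hG₀]; exact hG
  have hz : max B₀ (2 * G) ≤ cz * G := by
    refine max_le ?_ ?_ <;> nlinarith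
  have h1G : max 1 G ≤ c₁ * G := max_le (by nlinarith) (by nlinarith)
  have hsG : Real.sqrt G ≤ c₁ * G := by
    refine Real.sqrt_le_iff.2 ⟨by positivity, ?_⟩
    have : 1 ≤ c₁ * G := by nlinarith
    have h2 : G ≤ c₁ * G := by nlinarith
    nlinarith
  have main := sum_inner_regret_le hB₀ hcl h0 hg hcv hu hT hL hz hpq
  have hT' : (1 : ℝ) ≤ T := by exact_mod_cast hT
  have hlog := Real.log_nonneg hT'
  refine main.trans ?_
  have hn := norm_nonneg u
  have hN0 := Real.sqrt_nonneg (∑ t ∈ Finset.range T, ‖g t - p t‖ ^ 2)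
  have hW0 := Real.sqrt_nonneg (∑ t ∈ Finset.range T, ‖p t - q t‖ ^ 2)
  have hS0 := Real.sqrt_nonneg (∑ t ∈ Finset.range T, ‖g t‖)
  generalize Real.sqrt (∑ t ∈ Finset.range T, ‖g t - p t‖ ^ 2) = N at *
  generalize Real.sqrt (∑ t ∈ Finset.range T, ‖p t - q t‖ ^ 2) = W at *
  generalize Real.sqrt (∑ t ∈ Finset.range T, ‖g t‖) = Q at *
  generalize ‖u‖ = v at *
  clear main hpq hg
  have hΛ : d * (Real.log T + d + cz * G / (4 * B₀ ^ 2)) ≤ cΛ * ((1 + Real.log T) * G) := by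
    rw [hcΛ, mul_assoc]
    refine mul_le_mul_of_nonneg_left ?_ (Nat.cast_nonneg _)
    have h1 : (1 : ℝ) ≤ κ * G * (1 + Real.log T) := by nlinarith
    have e1 : Real.log T ≤ κ * G * (1 + Real.log T) := by nlinarith
    have e2 : (d : ℝ) ≤ d * (κ * G * (1 + Real.log T)) :=
      le_mul_of_one_le_right (Nat.cast_nonneg _) h1
    have e3 : cz * G / (4 * B₀ ^ 2) ≤ cz * G / (4 * B₀ ^ 2) * (1 + Real.log T) :=
      le_mul_of_one_le_right (by positivity) (by linarith)
    calc _ ≤ κ * G * (1 + Real.log T) + d * (κ * G * (1 + Real.log T))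
          + cz * G / (4 * B₀ ^ 2) * (1 + Real.log T) := by linarith
      _ = _ := by ring
  have hΛ0 : 0 ≤ d * (Real.log T + d + cz * G / (4 * B₀ ^ 2)) := by positivity
  set ℓ := 1 + Real.log T with hℓ
  have hℓ1 : 1 ≤ ℓ := by linarith
  have hℓ2 : ℓ ≤ ℓ ^ 2 := by nlinarith
  have hℓ3 : 1 ≤ ℓ ^ 2 := hℓ1.trans hℓ2
  generalize d * (Real.log T + d + cz * G / (4 * B₀ ^ 2)) = Λ at *
  have t1 : 2 * ℓ * (60 * v ^ 2 * (2 * G * ℓ + 3 * N + 2 * W))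
      ≤ 360 * ℓ ^ 2 * (v ^ 2 * (N + W)) + 240 * κ * ℓ ^ 2 * (G ^ 2 * v ^ 2) := by
    have e1 : ℓ * (v ^ 2 * N) ≤ ℓ ^ 2 * (v ^ 2 * N) :=
      mul_le_mul_of_nonneg_right hℓ2 (by positivity)
    have e2 : ℓ * (v ^ 2 * W) ≤ ℓ ^ 2 * (v ^ 2 * W) :=
      mul_le_mul_of_nonneg_right hℓ2 (by positivity)
    have e3 : 1 * (ℓ ^ 2 * v ^ 2 * G) ≤ κ * G * (ℓ ^ 2 * v ^ 2 * G) :=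
      mul_le_mul_of_nonneg_right hκG (by positivity)
    have e4 : 0 ≤ ℓ ^ 2 * (v ^ 2 * W) := by positivity
    linarith
  have t2 : 2 * ℓ * ((2 * (cz * G) ^ 2 + cz * G) * v ^ 2)
      ≤ (4 * cz ^ 2 + 2 * cz * κ) * ℓ ^ 2 * (G ^ 2 * v ^ 2) := by
    have e1 : 1 * (cz * G) ≤ κ * G * (cz * G) := mul_le_mul_of_nonneg_right hκG (by positivity)
    calc 2 * ℓ * ((2 * (cz * G) ^ 2 + cz * G) * v ^ 2)
        ≤ 2 * ℓ ^ 2 * ((2 * (cz * G) ^ 2 + κ * G * (cz * G)) * v ^ 2) := by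
          refine mul_le_mul (by linarith) ?_ (by positivity) (by positivity)
          exact mul_le_mul_of_nonneg_right (by linarith) (by positivity)
      _ = _ := by ring
  have t3 : 2 * ℓ * (2 * ((128 * (cz * G) + 2 * Real.sqrt G) * Q) * Λ)
      ≤ 4 * (128 * cz + 2 * c₁) * cΛ * ℓ ^ 2 * (G ^ 2 * Q) := by
    calc 2 * ℓ * (2 * ((128 * (cz * G) + 2 * Real.sqrt G) * Q) * Λ)
        ≤ 2 * ℓ * (2 * ((128 * (cz * G) + 2 * (c₁ * G)) * Q) * (cΛ * (ℓ * G))) := by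
          gcongr
      _ = _ := by ring
  have t4 : (240 * L * ℓ * v ^ 2) ^ 2 / B₀ ^ 2 = (240 * L) ^ 2 / B₀ ^ 2 * ℓ ^ 2 * v ^ 4 := by
    ring
  have hGQ : G * Q ≤ κ * ℓ ^ 2 * (G ^ 2 * Q) := by
    calc G * Q = 1 * 1 * (G * Q) := by ring
      _ ≤ κ * G * ℓ ^ 2 * (G * Q) := by gcongr
      _ = _ := by ring
  have t5 : 6 * (cz * G) * Q ≤ 6 * cz * κ * ℓ ^ 2 * (G ^ 2 * Q) := by
    have := mul_le_mul_of_nonneg_left hGQ (by positivity : 0 ≤ 6 * cz)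
    linarith
  have t6 : max 1 G * (3 * Q + 4 * v ^ 3)
      ≤ 3 * c₁ * κ * ℓ ^ 2 * (G ^ 2 * Q) + 4 * c₁ * ℓ ^ 2 * (G * v ^ 3) := by
    have e1 := mul_le_mul_of_nonneg_left hGQ (by positivity : 0 ≤ 3 * c₁)
    have e2 : 1 * (4 * c₁ * (G * v ^ 3)) ≤ ℓ ^ 2 * (4 * c₁ * (G * v ^ 3)) :=
      mul_le_mul_of_nonneg_right hℓ3 (by positivity)
    have e3 := mul_le_mul_of_nonneg_right h1G (by positivity : 0 ≤ 3 * Q + 4 * v ^ 3)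
    linarith
  set K₁ := 240 * κ + 4 * cz ^ 2 + 2 * cz * κ with hK₁
  set K₂ := (240 * L) ^ 2 / B₀ ^ 2 with hK₂
  set K₃ := 4 * (128 * cz + 2 * c₁) * cΛ + 6 * cz * κ + 3 * c₁ * κ with hK₃
  have hK₁0 : 0 ≤ K₁ := by positivity
  have hK₂0 : 0 ≤ K₂ := by positivity
  have hK₃0 : 0 ≤ K₃ := by positivity
  set C := 360 + K₁ + K₂ + 4 * c₁ + K₃ with hC
  have m1 : 360 * (ℓ ^ 2 * (v ^ 2 * (N + W))) ≤ C * (ℓ ^ 2 * (v ^ 2 * (N + W))) :=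
    mul_le_mul_of_nonneg_right (by linarith) (by positivity)
  have m2 : K₁ * (ℓ ^ 2 * (G ^ 2 * v ^ 2)) ≤ C * (ℓ ^ 2 * (G ^ 2 * v ^ 2)) :=
    mul_le_mul_of_nonneg_right (by linarith) (by positivity)
  have m3 : K₂ * (ℓ ^ 2 * v ^ 4) ≤ C * (ℓ ^ 2 * v ^ 4) :=
    mul_le_mul_of_nonneg_right (by linarith) (by positivity)
  have m4 : 4 * c₁ * (ℓ ^ 2 * (G * v ^ 3)) ≤ C * (ℓ ^ 2 * (G * v ^ 3)) :=
    mul_le_mul_of_nonneg_right (by linarith) (by positivity)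
  have m5 : K₃ * (ℓ ^ 2 * (G ^ 2 * Q)) ≤ C * (ℓ ^ 2 * (G ^ 2 * Q)) :=
    mul_le_mul_of_nonneg_right (by linarith) (by positivity)
  have m2' : K₁ * (ℓ ^ 2 * (G ^ 2 * v ^ 2)) = 240 * κ * ℓ ^ 2 * (G ^ 2 * v ^ 2)
      + (4 * cz ^ 2 + 2 * cz * κ) * ℓ ^ 2 * (G ^ 2 * v ^ 2) := by rw [hK₁]; ring
  have m5' : K₃ * (ℓ ^ 2 * (G ^ 2 * Q)) = 4 * (128 * cz + 2 * c₁) * cΛ * ℓ ^ 2 * (G ^ 2 * Q)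
      + 6 * cz * κ * ℓ ^ 2 * (G ^ 2 * Q) + 3 * c₁ * κ * ℓ ^ 2 * (G ^ 2 * Q) := by
    rw [hK₃]; ring
  calc _ = 2 * ℓ * (60 * v ^ 2 * (2 * G * ℓ + 3 * N + 2 * W))
        + 2 * ℓ * ((2 * (cz * G) ^ 2 + cz * G) * v ^ 2)
        + 2 * ℓ * (2 * ((128 * (cz * G) + 2 * Real.sqrt G) * Q) * Λ)
        + (240 * L * ℓ * v ^ 2) ^ 2 / B₀ ^ 2 + 6 * (cz * G) * Q
        + max 1 G * (3 * Q + 4 * v ^ 3) := by ring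
    _ ≤ C * (ℓ ^ 2 * (v ^ 2 * (N + W))) + C * (ℓ ^ 2 * (G ^ 2 * v ^ 2)) + C * (ℓ ^ 2 * v ^ 4)
        + C * (ℓ ^ 2 * (G * v ^ 3)) + C * (ℓ ^ 2 * (G ^ 2 * Q)) := by
      rw [t4]
      linarith
    _ = _ := by ring

end CLAOONS

end

/-! ### Measurability of the minimizers, gradients and states. -/

noncomputable section

namespace CLAOONS

open Filter Topology

section Argmin

variable {d : ℕ}

lemma sqNorm_eq_sum (A : Matrix (Fin d) (Fin d) ℝ) (x : E d) :
    sqNorm A x = ∑ i, x i * ∑ j, A i j * x j := rfl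

/-- The objective `⟨x, m⟩ + ‖x - c‖_A² / 2` is jointly continuous in `m`, `c`, `A` and `x`. -/
lemma continuous_objective :
    Continuous fun p : (E d × E d × ℝ × (Fin d → Fin d → ℝ)) × E d =>
      inner ℝ p.2 p.1.1 + breg (Matrix.of p.1.2.2.2) p.2 p.1.2.1 := by
  unfold breg
  simp only [sqNorm_eq_sum, Matrix.of_apply]
  have : Continuous fun v : E d => v.ofLp := PiLp.continuous_ofLp 2 _
  fun_prop

/-- Unique minimizers of a jointly continuous function over a ball section of a closed convex set
depend continuously on the parameters, including the radius of the ball. -/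
lemma continuousOn_minimizer {P : Type*} [TopologicalSpace P] {𝒳 : Set (E d)} (hcl : IsClosed 𝒳)
    (hcv : Convex ℝ 𝒳) (h0 : 0 ∈ 𝒳) {φ : P × E d → ℝ} (hφ : Continuous φ) {D : P → ℝ}
    (hD : Continuous D) {F : P → E d} {U : Set P} (hU : ∀ p ∈ U, 0 < D p)
    (hF : ∀ p ∈ U, F p ∈ {x | x ∈ 𝒳 ∧ ‖x‖ ≤ D p} ∧
      IsMinOn (fun x => φ (p, x)) {x | x ∈ 𝒳 ∧ ‖x‖ ≤ D p} (F p))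
    (huniq : ∀ p ∈ U, ∀ x ∈ {x | x ∈ 𝒳 ∧ ‖x‖ ≤ D p},
      IsMinOn (fun x => φ (p, x)) {x | x ∈ 𝒳 ∧ ‖x‖ ≤ D p} x → x = F p) :
    ContinuousOn F U := by
  intro p₀ hp₀
  -- Along an ultrafilter the minimizers converge by compactness; it remains to see that the limit
  -- minimizes at `p₀`, where the minimizer is unique.
  rw [ContinuousWithinAt, tendsto_iff_ultrafilter]
  intro g hg
  have hgp : Tendsto (fun p : P => p) g (𝓝 p₀) :=
    (tendsto_id'.2 hg).mono_right nhdsWithin_le_nhds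
  have hgU : ∀ᶠ p in (g : Filter P), p ∈ U := hg self_mem_nhdsWithin
  have hgD : Tendsto D g (𝓝 (D p₀)) := (hD.tendsto p₀).comp hgp
  have hK : ∀ᶠ p in (g : Filter P), F p ∈ 𝒳 ∩ Metric.closedBall 0 (D p₀ + 1) := by
    filter_upwards [hgU, hgD.eventually (gt_mem_nhds (lt_add_one _))] with p hp hp'
    have := (hF p hp).1
    exact ⟨this.1, by simpa using this.2.trans hp'.le⟩
  obtain ⟨x, hx, hxlim⟩ := ((isCompact_closedBall (0 : E d) (D p₀ + 1)).inter_left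
    hcl).ultrafilter_le_nhds (g.map F) (by rw [le_principal_iff]; exact hK)
  have hxlim' : Tendsto F g (𝓝 x) := hxlim
  suffices x = F p₀ by rw [← this]; exact hxlim'
  have hxD : ‖x‖ ≤ D p₀ := by
    refine le_of_tendsto_of_tendsto hxlim'.norm hgD ?_
    filter_upwards [hgU] with p hp
    exact (hF p hp).1.2
  have hobj : Tendsto (fun p => φ (p, F p)) g (𝓝 (φ (p₀, x))) :=
    (hφ.tendsto (p₀, x)).comp (hgp.prodMk_nhds hxlim')
  refine huniq p₀ hp₀ x ⟨hx.1, hxD⟩ fun y hy => ?_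
  have hD₀ := hU p₀ hp₀
  -- A competitor for the radius D p₀ need not be admissible for D p. Shrinking it towards 0 ∈ 𝒳
  -- makes it admissible, and the shrinking factor tends to 1.
  have hyl : Tendsto (fun p => (min 1 (D p / D p₀)) • y) g (𝓝 y) := by
    have h1 : Tendsto (fun p => min 1 (D p / D p₀)) g (𝓝 (min 1 (D p₀ / D p₀))) :=
      tendsto_const_nhds.min (hgD.div_const _)
    rw [div_self hD₀.ne', min_self] at h1
    simpa using h1.smul_const y
  have hobjy : Tendsto (fun p => φ (p, (min 1 (D p / D p₀)) • y)) g (𝓝 (φ (p₀, y))) :=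
    (hφ.tendsto (p₀, y)).comp (hgp.prodMk_nhds hyl)
  refine le_of_tendsto_of_tendsto hobj hobjy ?_
  filter_upwards [hgU] with p hp
  have h2 : 0 ≤ D p / D p₀ := (div_pos (hU p hp) hD₀).le
  have h3 : 0 ≤ min 1 (D p / D p₀) := le_min zero_le_one h2
  refine (hF p hp).2 ⟨hcv.smul_mem_of_zero_mem h0 hy.1 ⟨h3, min_le_left _ _⟩, ?_⟩
  rw [norm_smul, Real.norm_of_nonneg h3]
  calc _ ≤ D p / D p₀ * D p₀ := mul_le_mul (min_le_right _ _) hy.2 (norm_nonneg _) h2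
    _ = D p := div_mul_cancel₀ _ hD₀.ne'

/-- `argminOn` is an arbitrary choice, so regularity rests on uniqueness: by the three-point
inequality two minimizers have divergence at most 0, and positive definiteness makes them equal. -/
lemma continuousOn_argmin {𝒳 : Set (E d)} (hcl : IsClosed 𝒳) (hcv : Convex ℝ 𝒳) (h0 : 0 ∈ 𝒳) :
    ContinuousOn (fun p : E d × E d × ℝ × (Fin d → Fin d → ℝ) =>
      argminOn (fun x => inner ℝ x p.1 + breg (Matrix.of p.2.2.2) x p.2.1)
        {x | x ∈ 𝒳 ∧ ‖x‖ ≤ p.2.2.1})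
      {p | 0 < p.2.2.1 ∧ ∀ x : E d, x ≠ 0 → 0 < sqNorm (Matrix.of p.2.2.2) x} := by
  have hball : ∀ D : ℝ, {x | x ∈ 𝒳 ∧ ‖x‖ ≤ D} = 𝒳 ∩ Metric.closedBall 0 D := by
    intro D; ext; simp
  have hspec : ∀ (D : ℝ) (m c : E d) (A : Matrix (Fin d) (Fin d) ℝ), 0 < D →
      argminOn (fun x => inner ℝ x m + breg A x c) {x | x ∈ 𝒳 ∧ ‖x‖ ≤ D}
        ∈ {x | x ∈ 𝒳 ∧ ‖x‖ ≤ D} ∧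
      IsMinOn (fun x => inner ℝ x m + breg A x c) {x | x ∈ 𝒳 ∧ ‖x‖ ≤ D}
        (argminOn (fun x => inner ℝ x m + breg A x c) {x | x ∈ 𝒳 ∧ ‖x‖ ≤ D}) := by
    intro D m c A hD
    apply argminOn_spec
    apply exists_isMinOn_linear_add_breg
    · rw [hball]; exact (isCompact_closedBall _ _).inter_left hcl
    · exact ⟨0, h0, by simpa using hD.le⟩
  refine continuousOn_minimizer hcl hcv h0 continuous_objective
    (continuous_fst.comp (continuous_snd.comp continuous_snd)) (fun p hp => hp.1)
    (fun p hp => hspec _ _ _ _ hp.1) ?_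
  rintro ⟨m, c, D, A⟩ hp x hx hmin
  obtain ⟨hD, hA⟩ := hp
  change 0 < D at hD
  have hcvK : Convex ℝ {w | w ∈ 𝒳 ∧ ‖w‖ ≤ D} := by
    rw [hball]; exact hcv.inter (convex_closedBall _ _)
  obtain ⟨hF1, hF2⟩ := hspec D m c (Matrix.of A) hD
  change x = argminOn (fun x => inner ℝ x m + breg (Matrix.of A) x c) {x | x ∈ 𝒳 ∧ ‖x‖ ≤ D}
  generalize argminOn (fun x => inner ℝ x m + breg (Matrix.of A) x c)
    {x | x ∈ 𝒳 ∧ ‖x‖ ≤ D} = y at *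
  have h3 := three_point (m := m) (c := c) (A := Matrix.of A) hcvK hx hF1 hmin
  have h4 : inner ℝ y m + breg (Matrix.of A) y c ≤ inner ℝ x m + breg (Matrix.of A) x c :=
    hF2 hx
  by_contra hne
  have h6 := hA (y - x) (sub_ne_zero.2 (Ne.symm hne))
  have h5 : breg (Matrix.of A) y x ≤ 0 := by linarith
  rw [breg] at h5
  change 0 < sqNorm (Matrix.of A) (y - x) at h6
  linarith

lemma measurable_argmin {Ω : Type*} {mΩ : MeasurableSpace Ω} {𝒳 : Set (E d)} (hcl : IsClosed 𝒳)
    (hcv : Convex ℝ 𝒳) (h0 : 0 ∈ 𝒳) {m c : Ω → E d} {D : Ω → ℝ}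
    {A : Ω → Matrix (Fin d) (Fin d) ℝ} (hm : Measurable m) (hc : Measurable c)
    (hD : Measurable D) (hA : ∀ i j, Measurable fun ω => A ω i j) (hDpos : ∀ ω, 0 < D ω)
    (hApos : ∀ ω, ∀ x : E d, x ≠ 0 → 0 < sqNorm (A ω) x) :
    Measurable fun ω => argminOn (fun x => inner ℝ x (m ω) + breg (A ω) x (c ω))
      {x | x ∈ 𝒳 ∧ ‖x‖ ≤ D ω} := by
  have h1 := (continuousOn_argmin hcl hcv h0).domRestrict.measurable
  have h2 : Measurable fun ω => ((m ω, c ω, D ω, fun i j => A ω i j) :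
      E d × E d × ℝ × (Fin d → Fin d → ℝ)) :=
    hm.prodMk (hc.prodMk (hD.prodMk
      (measurable_pi_lambda _ fun i => measurable_pi_lambda _ fun j => hA i j)))
  exact h1.comp (h2.subtype_mk (h := fun ω => ⟨hDpos ω, hApos ω⟩))

end Argmin

/-- Directional derivatives are limits of difference quotients with step 1/n, each measurable by
joint measurability of the loss. Differentiability is needed only at the points `X ω`. -/
lemma measurable_gradient {d : ℕ} {Ω Ξ : Type*} {mΩ : MeasurableSpace Ω} {mΞ : MeasurableSpace Ξ}
    {loss : Ξ → E d → ℝ} (hloss : Measurable (Function.uncurry loss)) {Z : Ω → Ξ} {X : Ω → E d}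
    (hZ : Measurable Z) (hX : Measurable X)
    (hd : ∀ ω, DifferentiableAt ℝ (loss (Z ω)) (X ω)) :
    Measurable fun ω => gradient (loss (Z ω)) (X ω) := by
  have key : ∀ v : E d, Measurable fun ω => fderiv ℝ (loss (Z ω)) (X ω) v := by
    intro v
    refine measurable_of_tendsto_metrizable (f := fun (n : ℕ) ω =>
      (n : ℝ) • (loss (Z ω) (X ω + (n : ℝ)⁻¹ • v) - loss (Z ω) (X ω))) ?_ ?_
    · intro n
      have h1 : Measurable fun ω => loss (Z ω) (X ω + (n : ℝ)⁻¹ • v) :=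
        hloss.comp (hZ.prodMk (hX.add_const _))
      have h2 : Measurable fun ω => loss (Z ω) (X ω) := hloss.comp (hZ.prodMk hX)
      exact (h1.sub h2).const_mul (n : ℝ)
    · rw [tendsto_pi_nhds]
      intro ω
      exact ((hd ω).hasFDerivAt.lim_real v).comp tendsto_natCast_atTop_atTop
  have h : (fun ω => gradient (loss (Z ω)) (X ω)) = fun ω =>
      WithLp.toLp 2 fun i => fderiv ℝ (loss (Z ω)) (X ω) (EuclideanSpace.single i 1) := by
    funext ω
    ext i
    change _ = fderiv ℝ (loss (Z ω)) (X ω) (EuclideanSpace.single i 1)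
    rw [← inner_gradient_left, EuclideanSpace.inner_single_right]
    simp
  rw [h]
  exact (WithLp.measurable_toLp 2 _).comp (measurable_pi_lambda _ fun i => key _)

/-- All components of a random state are measurable. -/
structure MeasurableState {d : ℕ} {Ω : Type*} [MeasurableSpace Ω] (s : Ω → State d) :
    Prop where
  D : Measurable fun ω => (s ω).D
  z : Measurable fun ω => (s ω).z
  zStart : Measurable fun ω => (s ω).zStart
  x' : Measurable fun ω => (s ω).x'
  H : ∀ i j, Measurable fun ω => (s ω).H i j
  V : Measurable fun ω => (s ω).V
  m : Measurable fun ω => (s ω).m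
  N : Measurable fun ω => (s ω).N
  S : Measurable fun ω => (s ω).S

namespace MeasurableState

variable {d : ℕ} {Ω : Type*} {mΩ : MeasurableSpace Ω} {s : Ω → State d} {𝒳 : Set (E d)} {B₀ : ℝ}

lemma eta (hs : MeasurableState s) : Measurable fun ω => (s ω).eta :=
  (((hs.D.const_mul 64).mul hs.z).max hs.V.sqrt).const_div 1

lemma A (hs : MeasurableState s) (i j : Fin d) : Measurable fun ω => (s ω).A i j := by
  simp only [State.A, Matrix.add_apply, Matrix.smul_apply, smul_eq_mul]
  exact ((((hs.zStart.pow_const 2).const_mul 4).mul_const _).add (hs.H i j)).add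
    (((hs.eta.const_mul 4).mul (hs.z.pow_const 2)).mul_const _)

lemma sqNorm_A_pos {s : State d} (hB₀ : 0 < B₀) (hv : s.Valid B₀) {x : E d}
    (hx : x ≠ 0) : 0 < sqNorm s.A x := by
  have h1 := hv.norm_sq_le_sqNorm_A hB₀ x
  have h2 := norm_pos_iff.2 hx
  have : 0 < 4 * B₀ ^ 2 * ‖x‖ ^ 2 := by positivity
  linarith

variable (hB₀ : 0 < B₀) (hcl : IsClosed 𝒳) (hcv : Convex ℝ 𝒳) (h0 : 0 ∈ 𝒳)
  (hs : MeasurableState s) (hv : ∀ ω, (s ω).Valid B₀)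
include hB₀ hcl hcv h0 hs hv

lemma play : Measurable fun ω => (s ω).play 𝒳 :=
  measurable_argmin hcl hcv h0 hs.m hs.x' hs.D hs.A
    (fun ω => zero_lt_one.trans_le (hv ω).one_le_D) fun ω _ hx => sqNorm_A_pos hB₀ (hv ω) hx

variable {g : Ω → E d} (hg : Measurable g)
include hg

omit hB₀ hcl hcv h0 hv in
lemma newB : Measurable fun ω => (s ω).newB (g ω) := hs.z.max (hg.sub hs.m).norm

omit hB₀ hcl hcv h0 hv in
lemma newN : Measurable fun ω => (s ω).newN (g ω) := hs.N.max hg.norm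

omit hB₀ hcl hcv h0 hv in
lemma newS : Measurable fun ω => (s ω).newS (g ω) :=
  hs.S.add (hg.norm.div (measurable_const.max (hs.newN hg)))

omit hB₀ hcl hcv h0 hv in
lemma clip : Measurable fun ω => (s ω).clip (g ω) :=
  hs.m.add ((hs.z.div (hs.newB hg)).smul (hg.sub hs.m))

lemma corrected : Measurable fun ω => (s ω).corrected 𝒳 (g ω) :=
  (hs.clip hg).add ((((hs.eta.const_mul 32)).mul
    ((play hB₀ hcl hcv h0 hs hv).inner ((hs.clip hg).sub hs.m))).smul ((hs.clip hg).sub hs.m))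

lemma nextX' : Measurable fun ω => (s ω).nextX' 𝒳 (g ω) :=
  measurable_argmin hcl hcv h0 (corrected hB₀ hcl hcv h0 hs hv hg) hs.x' hs.D hs.A
    (fun ω => zero_lt_one.trans_le (hv ω).one_le_D) fun ω _ hx => sqNorm_A_pos hB₀ (hv ω) hx

lemma step : MeasurableState fun ω => (s ω).step 𝒳 (g ω) := by
  have hset : MeasurableSet {ω | (s ω).D < Real.sqrt ((s ω).newS (g ω))} :=
    measurableSet_lt hs.D (hs.newS hg).sqrt
  have hδ := (corrected hB₀ hcl hcv h0 hs hv hg).sub hs.m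
  have hcoord : ∀ i, Measurable fun x : E d => x i := fun i => by fun_prop
  constructor
  · simp only [State.step, apply_ite State.D]
    exact Measurable.ite hset ((hs.newS hg).sqrt.const_mul 2) hs.D
  · simp only [State.step, apply_ite State.z]
    exact Measurable.ite hset (hs.newB hg) (hs.newB hg)
  · simp only [State.step, apply_ite State.zStart]
    exact Measurable.ite hset (hs.newB hg) hs.zStart
  · simp only [State.step, apply_ite State.x']
    exact Measurable.ite hset measurable_const (nextX' hB₀ hcl hcv h0 hs hv hg)
  · intro i j
    have : ∀ ω, ((s ω).step 𝒳 (g ω)).H i j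
        = if (s ω).D < Real.sqrt ((s ω).newS (g ω)) then 0 else (s ω).H i j + (s ω).eta *
          (((s ω).corrected 𝒳 (g ω) - (s ω).m) i * ((s ω).corrected 𝒳 (g ω) - (s ω).m) j) := by
      intro ω
      rw [State.step]
      split_ifs
      · rfl
      · rfl
    simp only [this]
    exact Measurable.ite hset measurable_const ((hs.H i j).add (hs.eta.mul
      (((hcoord i).comp hδ).mul ((hcoord j).comp hδ))))
  · simp only [State.step, apply_ite State.V]
    exact Measurable.ite hset measurable_const
      (hs.V.add (((hs.clip hg).sub hs.m).norm.pow_const 2))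
  · simp only [State.step, apply_ite State.m]
    exact Measurable.ite hset hg hg
  · simp only [State.step, apply_ite State.N]
    exact Measurable.ite hset (hs.newN hg) (hs.newN hg)
  · simp only [State.step, apply_ite State.S]
    exact Measurable.ite hset (hs.newS hg) (hs.newS hg)

end MeasurableState

end CLAOONS

end

/-! ### Convexity of the expected loss, conditional laws, and Jensen's inequality. -/

noncomputable section

namespace CLAOONS

open Filter Topology

section Loss

variable {d : ℕ} {Ξ : Type*} {mΞ : MeasurableSpace Ξ} {loss : Ξ → E d → ℝ} {𝒳 : Set (E d)} {G : ℝ}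

lemma norm_gradient (f : E d → ℝ) (x : E d) : ‖gradient f x‖ = ‖fderiv ℝ f x‖ := by
  rw [gradient, LinearIsometryEquiv.norm_map]

lemma abs_sub_le_of_gradient_le {f : E d → ℝ} (hcv : Convex ℝ 𝒳)
    (hb : ∀ x ∈ 𝒳, DifferentiableAt ℝ f x ∧ ‖gradient f x‖ ≤ G) {x y : E d} (hx : x ∈ 𝒳)
    (hy : y ∈ 𝒳) : |f y - f x| ≤ G * ‖y - x‖ :=
  hcv.norm_image_sub_le_of_norm_fderiv_le (𝕜 := ℝ) (fun z hz => (hb z hz).1)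
    (fun z hz => (norm_gradient f z).symm.trans_le (hb z hz).2) hx hy

variable (hloss : Measurable (Function.uncurry loss))
  (hb : ∀ ζ, ∀ x ∈ 𝒳, DifferentiableAt ℝ (loss ζ) x ∧ ‖gradient (loss ζ) x‖ ≤ G)
include hloss hb

omit hloss in
lemma norm_integral_gradient_le (ν : Measure Ξ) [IsProbabilityMeasure ν] {x : E d} (hx : x ∈ 𝒳) :
    ‖∫ ζ, gradient (loss ζ) x ∂ν‖ ≤ G := by
  have := norm_integral_le_of_norm_le_const (μ := ν) (f := fun ζ => gradient (loss ζ) x) (C := G)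
    (Eventually.of_forall fun ζ => (hb ζ x hx).2)
  simpa using this

omit hloss in
/-- The gradient inequality for a convex expectation of (possibly nonconvex) losses. -/
lemma integral_sub_le_inner_gradient (ν : Measure Ξ) [IsProbabilityMeasure ν] (hcv : Convex ℝ 𝒳)
    (hint : ∀ x ∈ 𝒳, Integrable (fun ζ => loss ζ x) ν)
    (hconv : ConvexOn ℝ 𝒳 fun x => ∫ ζ, loss ζ x ∂ν) {x u : E d} (hx : x ∈ 𝒳) (hu : u ∈ 𝒳) :
    ∫ ζ, (loss ζ x - loss ζ u) ∂ν ≤ ∫ ζ, inner ℝ (gradient (loss ζ) x) (x - u) ∂ν := by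
  -- The inverse step size n + 1 keeps every `y n` on the segment from `x` to `u`, hence in 𝒳.
  set c : ℕ → ℝ := fun n => (n : ℝ) + 1 with hc
  have hc0 : ∀ n, 0 < c n := fun n => by positivity
  have hc1 : ∀ n, (c n)⁻¹ ≤ 1 := fun n => inv_le_one_of_one_le₀ (by simp [hc])
  set y : ℕ → E d := fun n => x + (c n)⁻¹ • (u - x) with hy
  have hymem : ∀ n, y n ∈ 𝒳 := fun n =>
    hcv.add_smul_sub_mem hx hu ⟨(inv_pos.2 (hc0 n)).le, hc1 n⟩
  have hlim : ∀ ζ, Tendsto (fun n => c n * (loss ζ (y n) - loss ζ x)) atTop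
      (𝓝 (inner ℝ (gradient (loss ζ) x) (u - x))) := by
    intro ζ
    rw [inner_gradient_left]
    have h1 := (hb ζ x hx).1.hasFDerivAt.lim_real (u - x)
    have h2 : Tendsto c atTop atTop :=
      tendsto_atTop_add_const_right _ _ tendsto_natCast_atTop_atTop
    exact h1.comp h2
  have hmeas : ∀ z ∈ 𝒳, AEStronglyMeasurable (fun ζ => loss ζ z) ν := fun z hz =>
    (hint z hz).aestronglyMeasurable
  -- The difference quotients are dominated by G‖u - x‖, since the losses are G-Lipschitz on 𝒳. So
  -- the directional derivative of the expectation is the expected one, and convexity is needed only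
  -- for the expectation.
  have hdom := tendsto_integral_of_dominated_convergence (μ := ν)
    (F := fun n ζ => c n * (loss ζ (y n) - loss ζ x))
    (f := fun ζ => inner ℝ (gradient (loss ζ) x) (u - x)) (fun _ => G * ‖u - x‖)
    (fun n => ((hmeas _ (hymem n)).sub (hmeas _ hx)).const_mul _) (integrable_const _)
    (fun n => Eventually.of_forall fun ζ => by
      have h1 := abs_sub_le_of_gradient_le hcv (hb ζ) hx (hymem n)
      have h2 : y n - x = (c n)⁻¹ • (u - x) := by simp [hy]
      rw [h2, norm_smul, Real.norm_of_nonneg (inv_pos.2 (hc0 n)).le] at h1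
      rw [Real.norm_eq_abs, abs_mul, abs_of_pos (hc0 n)]
      calc c n * |loss ζ (y n) - loss ζ x| ≤ c n * (G * ((c n)⁻¹ * ‖u - x‖)) :=
            mul_le_mul_of_nonneg_left h1 (hc0 n).le
        _ = G * ‖u - x‖ := by have := (hc0 n).ne'; field_simp)
    (Eventually.of_forall hlim)
  have hle : ∫ ζ, inner ℝ (gradient (loss ζ) x) (u - x) ∂ν
      ≤ (∫ ζ, loss ζ u ∂ν) - ∫ ζ, loss ζ x ∂ν := by
    refine le_of_tendsto hdom (Eventually.of_forall fun n => ?_)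
    rw [integral_const_mul, integral_sub (hint _ (hymem n)) (hint _ hx)]
    have h1 := hconv.2 hx hu (sub_nonneg.2 (hc1 n)) (inv_pos.2 (hc0 n)).le (by ring)
    have h2 : (1 - (c n)⁻¹) • x + (c n)⁻¹ • u = y n := by simp only [hy]; module
    rw [h2] at h1
    simp only [smul_eq_mul] at h1
    have h3 : ∫ ζ, loss ζ (y n) ∂ν - ∫ ζ, loss ζ x ∂ν
        ≤ (c n)⁻¹ * ((∫ ζ, loss ζ u ∂ν) - ∫ ζ, loss ζ x ∂ν) := by linarith
    have h4 := mul_le_mul_of_nonneg_left h3 (hc0 n).le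
    rwa [← mul_assoc, mul_inv_cancel₀ (hc0 n).ne', one_mul] at h4
  rw [integral_sub (hint _ hx) (hint _ hu)]
  have h5 : ∀ ζ, inner ℝ (gradient (loss ζ) x) (x - u)
      = -(inner ℝ (gradient (loss ζ) x) (u - x) : ℝ) := by
    intro ζ; rw [← inner_neg_right, neg_sub]
  simp only [h5]
  rw [integral_neg]
  linarith

end Loss

section Law

variable {Ω Ω' Ξ : Type*} {mΩ : MeasurableSpace Ω} {mΩ' : MeasurableSpace Ω'}
  {mΞ : MeasurableSpace Ξ} {μ : Measure Ω} [IsProbabilityMeasure μ] {p : Ω → Ω'} {ξ : Ω → Ξ}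
  {κ : Kernel Ω' Ξ} [IsMarkovKernel κ]

/-- Two finite measures on a product agree once they agree on rectangles. The conditional law thus
becomes a joint law of past and label, to which Fubini applies. -/
lemma map_prodMk_eq_compProd (hp : Measurable p) (hξ : Measurable ξ)
    (h : ∀ (A : Set Ω') (s : Set Ξ), MeasurableSet A → MeasurableSet s →
      μ (p ⁻¹' A ∩ ξ ⁻¹' s) = ∫⁻ ω in p ⁻¹' A, κ (p ω) s ∂μ) :
    μ.map (fun ω => (p ω, ξ ω)) = (μ.map p) ⊗ₘ κ := by
  have : IsProbabilityMeasure (μ.map fun ω => (p ω, ξ ω)) :=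
    Measure.isProbabilityMeasure_map (hp.prodMk hξ).aemeasurable
  have : IsProbabilityMeasure (μ.map p) := Measure.isProbabilityMeasure_map hp.aemeasurable
  refine Measure.ext_prod fun {A s} hA hs => ?_
  rw [Measure.map_apply (hp.prodMk hξ) (hA.prod hs), Measure.compProd_apply_prod hA hs,
    setLIntegral_map hA (κ.measurable_coe hs) hp, ← h A s hA hs]
  rfl

variable (hp : Measurable p) (hξ : Measurable ξ)
  (hlaw : μ.map (fun ω => (p ω, ξ ω)) = (μ.map p) ⊗ₘ κ)
include hp hξ hlaw

lemma lintegral_of_law {φ : Ω' × Ξ → ENNReal} (hφ : Measurable φ) :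
    ∫⁻ ω, φ (p ω, ξ ω) ∂μ = ∫⁻ ω, ∫⁻ ζ, φ (p ω, ζ) ∂(κ (p ω)) ∂μ := by
  have : IsProbabilityMeasure (μ.map p) := Measure.isProbabilityMeasure_map hp.aemeasurable
  rw [← lintegral_map (μ := μ) hφ (hp.prodMk hξ), hlaw, Measure.lintegral_compProd hφ,
    lintegral_map hφ.lintegral_kernel_prod_right' hp]

lemma integral_of_law {φ : Ω' × Ξ → ℝ} (hφ : Measurable φ) {c : ℝ} (hc : ∀ z, ‖φ z‖ ≤ c) :
    ∫ ω, φ (p ω, ξ ω) ∂μ = ∫ ω, ∫ ζ, φ (p ω, ζ) ∂(κ (p ω)) ∂μ := by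
  have : IsProbabilityMeasure (μ.map p) := Measure.isProbabilityMeasure_map hp.aemeasurable
  have hint : Integrable φ ((μ.map p) ⊗ₘ κ) :=
    Integrable.of_bound hφ.aestronglyMeasurable c (Eventually.of_forall hc)
  rw [← integral_map (μ := μ) (hp.prodMk hξ).aemeasurable hφ.aestronglyMeasurable, hlaw,
    Measure.integral_compProd hint,
    integral_map hp.aemeasurable
      (hφ.stronglyMeasurable.integral_kernel_prod_right').aestronglyMeasurable]

variable {d : ℕ} {loss : Ξ → E d → ℝ} {𝒳 : Set (E d)} {G D : ℝ} {X : Ω' → E d} {u : E d}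
  (hloss : Measurable (Function.uncurry loss))
  (hb : ∀ ζ, ∀ x ∈ 𝒳, DifferentiableAt ℝ (loss ζ) x ∧ ‖gradient (loss ζ) x‖ ≤ G)
  (hX : Measurable X) (hX𝒳 : ∀ a, X a ∈ 𝒳)
include hloss hb hX hX𝒳

omit hp hξ hlaw in
lemma measurable_gradient_play :
    Measurable fun z : Ω' × Ξ => gradient (loss z.2) (X z.1) :=
  measurable_gradient hloss measurable_snd (hX.comp measurable_fst)
    fun z => (hb z.2 _ (hX𝒳 z.1)).1

omit hp hξ hlaw in
lemma measurable_integral_gradient_play :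
    Measurable fun a => ∫ ζ, gradient (loss ζ) (X a) ∂(κ a) :=
  ((measurable_gradient_play hloss hb hX
    hX𝒳).stronglyMeasurable.integral_kernel_prod_right').measurable

/-- In expectation, the regret of a round is at most its linearization. -/
lemma integral_regret_round_le (hcv : Convex ℝ 𝒳) (hu : u ∈ 𝒳) (hD : ∀ a, ‖X a‖ ≤ D)
    (hF : ∀ᵐ ω ∂μ, (∀ x ∈ 𝒳, Integrable (fun ζ => loss ζ x) (κ (p ω))) ∧
      ConvexOn ℝ 𝒳 fun x => ∫ ζ, loss ζ x ∂(κ (p ω))) :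
    ∫ ω, (loss (ξ ω) (X (p ω)) - loss (ξ ω) u) ∂μ
      ≤ ∫ ω, inner ℝ (gradient (loss (ξ ω)) (X (p ω))) (X (p ω) - u) ∂μ := by
  have : Nonempty Ω := by
    by_contra h
    rw [not_nonempty_iff] at h
    exact IsProbabilityMeasure.ne_zero μ (Measure.eq_zero_of_isEmpty μ)
  have hG : 0 ≤ G := by
    obtain ⟨ω⟩ := this
    exact (norm_nonneg _).trans (hb (ξ ω) _ (hX𝒳 (p ω))).2
  have hXu : ∀ a, ‖X a - u‖ ≤ D + ‖u‖ := fun a => (norm_sub_le _ _).trans (by linarith [hD a])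
  have hm := measurable_gradient_play hloss hb hX hX𝒳
  have hφ₁ : Measurable fun z : Ω' × Ξ => loss z.2 (X z.1) - loss z.2 u :=
    (hloss.comp (measurable_snd.prodMk (hX.comp measurable_fst))).sub
      (hloss.comp (measurable_snd.prodMk measurable_const))
  have hφ₂ : Measurable fun z : Ω' × Ξ => (inner ℝ (gradient (loss z.2) (X z.1)) (X z.1 - u) : ℝ) :=
    hm.inner ((hX.comp measurable_fst).sub_const u)
  have hb₁ : ∀ z : Ω' × Ξ, ‖loss z.2 (X z.1) - loss z.2 u‖ ≤ G * (D + ‖u‖) := fun z =>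
    (abs_sub_le_of_gradient_le hcv (hb z.2) hu (hX𝒳 z.1)).trans
      (mul_le_mul_of_nonneg_left (hXu _) hG)
  have hb₂ : ∀ z : Ω' × Ξ, ‖(inner ℝ (gradient (loss z.2) (X z.1)) (X z.1 - u) : ℝ)‖
      ≤ G * (D + ‖u‖) := fun z =>
    (abs_real_inner_le_norm _ _).trans
      (mul_le_mul (hb z.2 _ (hX𝒳 z.1)).2 (hXu _) (norm_nonneg _) hG)
  rw [integral_of_law hp hξ hlaw hφ₁ hb₁, integral_of_law hp hξ hlaw hφ₂ hb₂]
  refine integral_mono_ae ?_ ?_ ?_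
  · refine Integrable.of_bound
      (hφ₁.stronglyMeasurable.integral_kernel_prod_right'.comp_measurable hp).aestronglyMeasurable
      (G * (D + ‖u‖)) (Eventually.of_forall fun ω => ?_)
    have := norm_integral_le_of_norm_le_const (μ := κ (p ω))
      (Eventually.of_forall fun ζ => hb₁ (p ω, ζ))
    simpa using this
  · refine Integrable.of_bound
      (hφ₂.stronglyMeasurable.integral_kernel_prod_right'.comp_measurable hp).aestronglyMeasurable
      (G * (D + ‖u‖)) (Eventually.of_forall fun ω => ?_)
    have := norm_integral_le_of_norm_le_const (μ := κ (p ω))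
      (Eventually.of_forall fun ζ => hb₂ (p ω, ζ))
    simpa using this
  · filter_upwards [hF] with ω hω
    exact integral_sub_le_inner_gradient hb (κ (p ω)) hcv hω.1 hω.2 (hX𝒳 _) hu

/-- Given the past, the point X is frozen, so the drawn label may be averaged over the kernel. The
exponents 1 and 2 are the ones needed. -/
lemma lintegral_deviation_round_eq (r : ℕ) :
    ∫⁻ ω, ‖gradient (loss (ξ ω)) (X (p ω)) - ∫ ζ, gradient (loss ζ) (X (p ω)) ∂(κ (p ω))‖ₑ ^ r ∂μ
      = ∫⁻ ω, ∫⁻ ζ, ‖gradient (loss ζ) (X (p ω))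
        - ∫ ζ, gradient (loss ζ) (X (p ω)) ∂(κ (p ω))‖ₑ ^ r ∂(κ (p ω)) ∂μ :=
  lintegral_of_law hp hξ hlaw (φ := fun z => ‖gradient (loss z.2) (X z.1)
    - ∫ ζ, gradient (loss ζ) (X z.1) ∂(κ z.1)‖ₑ ^ r)
    (((measurable_gradient_play hloss hb hX hX𝒳).sub
      ((measurable_integral_gradient_play (κ := κ) hloss hb hX hX𝒳).comp
        measurable_fst)).enorm.pow_const r)

omit hξ hlaw in
lemma measurable_lintegral_deviation_round (r : ℕ) :
    Measurable fun ω => ∫⁻ ζ, ‖gradient (loss ζ) (X (p ω))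
        - ∫ ζ, gradient (loss ζ) (X (p ω)) ∂(κ (p ω))‖ₑ ^ r ∂(κ (p ω)) :=
  (Measurable.lintegral_kernel_prod_right' (κ := κ) (f := fun z => ‖gradient (loss z.2) (X z.1)
    - ∫ ζ, gradient (loss ζ) (X z.1) ∂(κ z.1)‖ₑ ^ r)
    (((measurable_gradient_play hloss hb hX hX𝒳).sub
      ((measurable_integral_gradient_play (κ := κ) hloss hb hX hX𝒳).comp
        measurable_fst)).enorm.pow_const r)).comp hp

end Law

/-- Jensen's inequality for the square root. -/
lemma integral_sqrt_le {Ω : Type*} {mΩ : MeasurableSpace Ω} {μ : Measure Ω}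
    [IsProbabilityMeasure μ] {Y : Ω → ℝ} (hY : Integrable Y μ) (h0 : ∀ ω, 0 ≤ Y ω)
    (hs : Integrable (fun ω => Real.sqrt (Y ω)) μ) :
    ∫ ω, Real.sqrt (Y ω) ∂μ ≤ Real.sqrt (∫ ω, Y ω ∂μ) := by
  -- The inequality says that the variance of √Y is nonnegative.
  set a := ∫ ω, Real.sqrt (Y ω) ∂μ with ha
  have h1 : 0 ≤ ∫ ω, (Real.sqrt (Y ω) - a) ^ 2 ∂μ := integral_nonneg fun ω => sq_nonneg _
  have h2 : ∀ ω, (Real.sqrt (Y ω) - a) ^ 2 = Y ω - 2 * a * Real.sqrt (Y ω) + a ^ 2 := by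
    intro ω
    have := Real.sq_sqrt (h0 ω)
    linear_combination this
  simp only [h2] at h1
  have h3 : Integrable (fun ω => Y ω - 2 * a * Real.sqrt (Y ω)) μ := hY.sub (hs.const_mul _)
  rw [integral_add h3 (integrable_const _), integral_sub hY (hs.const_mul _), integral_const_mul, ← ha] at h1
  simp only [integral_const, probReal_univ, one_smul] at h1
  apply Real.le_sqrt_of_sq_le
  linarith

end CLAOONS

end

/-! ### The algorithm as an adapted process in the stochastic model. -/

noncomputable section

namespace CLAOONS

section Run

variable {d : ℕ} {𝒳 : Set (E d)} {B₀ : ℝ}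

/-- The losses act only through the observed gradients, so the deterministic analysis applies to
each outcome. -/
lemma run_eq_trajectory (f : ℕ → E d → ℝ) (t : ℕ) :
    run 𝒳 B₀ f t = trajectory 𝒳 B₀ (fun t => gradient (f t) (decision 𝒳 B₀ f t)) t := by
  induction t with
  | zero => rfl
  | succ t ih => rw [run, trajectory, ← ih]; rfl

lemma valid_run (hB₀ : 0 < B₀) (f : ℕ → E d → ℝ) (t : ℕ) : (run 𝒳 B₀ f t).Valid B₀ := by
  induction t with
  | zero => exact (State.regular_init le_rfl).toValid
  | succ t ih =>
    rw [run]
    by_cases h : (run 𝒳 B₀ f t).D < Real.sqrt ((run 𝒳 B₀ f t).newS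
        (gradient (f t) ((run 𝒳 B₀ f t).play 𝒳)))
    · rw [State.step_of_lt 𝒳 h]; exact ih.restart h
    · rw [State.step_of_not_lt 𝒳 h]; exact ih.cont hB₀ 𝒳 _

lemma decision_mem (hB₀ : 0 < B₀) (hcl : IsClosed 𝒳) (h0 : 0 ∈ 𝒳) (f : ℕ → E d → ℝ) (t : ℕ) :
    decision 𝒳 B₀ f t ∈ 𝒳 :=
  (State.play_spec (zero_le_one.trans (valid_run hB₀ f t).one_le_D) hcl h0).1.1

lemma norm_decision_le {G : ℝ} (hB₀ : 0 < B₀) (hcl : IsClosed 𝒳) (h0 : 0 ∈ 𝒳)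
    (f : ℕ → E d → ℝ) (hg : ∀ t, ‖gradient (f t) (decision 𝒳 B₀ f t)‖ ≤ G) (t : ℕ) :
    ‖decision 𝒳 B₀ f t‖ ≤ max 1 (2 * Real.sqrt t) := by
  have h1 := trajectory_regular hB₀ hcl h0 hg t
  rw [← run_eq_trajectory] at h1
  have h2 := (State.play_spec (zero_le_one.trans h1.one_le_D) hcl h0).1.2
  refine (h2.trans h1.D_le).trans (max_le_max le_rfl ?_)
  linarith [Real.sqrt_le_sqrt h1.S_le]

end Run

lemma MeasurableState.mono {d : ℕ} {Ω : Type*} {m₁ m₂ : MeasurableSpace Ω} (h : m₁ ≤ m₂)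
    {s : Ω → State d} (hs : @MeasurableState d Ω m₁ s) : @MeasurableState d Ω m₂ s := by
  obtain ⟨h1, h2, h3, h4, h5, h6, h7, h8, h9⟩ := hs
  exact @MeasurableState.mk d Ω m₂ s (h1.mono h le_rfl) (h2.mono h le_rfl) (h3.mono h le_rfl)
    (h4.mono h le_rfl) (fun i j => (h5 i j).mono h le_rfl) (h6.mono h le_rfl) (h7.mono h le_rfl)
    (h8.mono h le_rfl) (h9.mono h le_rfl)

namespace SEA

variable {d : ℕ} {Ω Ξ : Type*} [MeasurableSpace Ω] [MeasurableSpace Ξ] {μ : Measure Ω}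
  (M : SEA d Ω Ξ μ)

/-- The sample space with the information available before round `t`. -/
def Past (_ : SEA d Ω Ξ μ) (_ : ℕ) : Type _ := Ω

instance (t : ℕ) : MeasurableSpace (M.Past t) := M.ℱ t

/-- The past of an outcome. -/
def toPast (t : ℕ) : Ω → M.Past t := fun ω => ω

/-- The distribution of round `t`, as a kernel from the past. -/
def law (t : ℕ) : Kernel (M.Past t) Ξ := M.𝒟 t

instance (t : ℕ) : IsMarkovKernel (M.law t) := ⟨M.isProb t⟩

lemma measurable_toPast (t : ℕ) : Measurable (M.toPast t) :=
  fun s hs => M.ℱ.le t s hs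

lemma measurable_ξ' (t : ℕ) : Measurable (M.ξ t) := (M.measurable_ξ t).mono (M.ℱ.le _) le_rfl

/-- Integrating the conditional probabilities in `cond_law` over events of the past gives the
measures of rectangles. -/
lemma map_toPast_ξ [IsProbabilityMeasure μ] (t : ℕ) :
    μ.map (fun ω => (M.toPast t ω, M.ξ t ω)) = (μ.map (M.toPast t)) ⊗ₘ (M.law t) := by
  refine map_prodMk_eq_compProd (M.measurable_toPast t) (M.measurable_ξ' t) fun A s hA hs => ?_
  have hA' : MeasurableSet (M.toPast t ⁻¹' A) := M.measurable_toPast t hA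
  have hs' : MeasurableSet (M.ξ t ⁻¹' s) := M.measurable_ξ' t hs
  have hAm : MeasurableSet[M.ℱ t] (M.toPast t ⁻¹' A) := hA
  have hint : Integrable ((M.ξ t ⁻¹' s).indicator fun _ => (1 : ℝ)) μ :=
    (integrable_const 1).indicator hs'
  have h1 := setIntegral_condExp (M.ℱ.le t) hint hAm
  rw [setIntegral_congr_ae (g := fun ω => (M.𝒟 t ω).real s) hA'
    ((M.cond_law t s hs).mono fun ω h _ => h)] at h1
  have h2 : ∫ ω in M.toPast t ⁻¹' A, (M.ξ t ⁻¹' s).indicator (fun _ => (1 : ℝ)) ω ∂μ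
      = μ.real (M.toPast t ⁻¹' A ∩ M.ξ t ⁻¹' s) := by
    rw [setIntegral_indicator hs', setIntegral_const, smul_eq_mul, mul_one]
  have hmeas : Measurable fun ω => M.law t (M.toPast t ω) s :=
    ((M.law t).measurable_coe hs).comp (M.measurable_toPast t)
  have h3 : ∫ ω in M.toPast t ⁻¹' A, (M.𝒟 t ω).real s ∂μ
      = (∫⁻ ω in M.toPast t ⁻¹' A, M.law t (M.toPast t ω) s ∂μ).toReal := by
    rw [← integral_toReal hmeas.aemeasurable]
    · rfl
    · exact Filter.Eventually.of_forall fun ω => measure_lt_top _ _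
  have hfin : ∫⁻ ω in M.toPast t ⁻¹' A, M.law t (M.toPast t ω) s ∂μ ≠ ⊤ := by
    refine ((setLIntegral_mono measurable_const fun ω _ => prob_le_one (s := s)
      (μ := M.law t (M.toPast t ω))).trans_lt ?_).ne
    rw [lintegral_const]
    simp
  rw [h2, h3] at h1
  exact ((ENNReal.toReal_eq_toReal_iff' hfin (measure_ne_top _ _)).1 h1).symm

/-- The gradient that the learner observes in round `t`. -/
def observed (𝒳 : Set (E d)) (B₀ : ℝ) (ω : Ω) (t : ℕ) : E d :=
  gradient (M.f ω t) (decision 𝒳 B₀ (M.f ω) t)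

variable {𝒳 : Set (E d)} {B₀ G : ℝ} (hB₀ : 0 < B₀) (hcl : IsClosed 𝒳) (hcv : _root_.Convex ℝ 𝒳)
  (h0 : 0 ∈ 𝒳) (hG : M.BoundedGradients 𝒳 G)
include hB₀ hcl hcv h0 hG

/-- The state before round t uses labels of earlier rounds only. This predictability is what allows
the decision to be frozen when the label of round t is averaged. -/
lemma measurableState_run (t : ℕ) :
    @MeasurableState d Ω (M.ℱ t) fun ω => run 𝒳 B₀ (M.f ω) t := by
  induction t with
  | zero =>
    simp only [run]
    exact @MeasurableState.mk d Ω (M.ℱ 0) _ measurable_const measurable_const measurable_const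
      measurable_const (fun _ _ => measurable_const) measurable_const measurable_const
      measurable_const measurable_const
  | succ t ih =>
    have h1 := ih.mono (M.ℱ.mono (Nat.le_succ t))
    have h2 := MeasurableState.play hB₀ hcl hcv h0 h1 fun ω => valid_run hB₀ (M.f ω) t
    exact MeasurableState.step hB₀ hcl hcv h0 h1 (fun ω => valid_run hB₀ (M.f ω) t)
      (measurable_gradient M.measurable_loss (M.measurable_ξ t) h2
        fun ω => (hG _ _ (decision_mem hB₀ hcl h0 (M.f ω) t)).1)

lemma measurable_decision (t : ℕ) :
    Measurable fun ω : M.Past t => decision 𝒳 B₀ (M.f ω) t :=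
  MeasurableState.play hB₀ hcl hcv h0 (M.measurableState_run hB₀ hcl hcv h0 hG t)
    fun ω => valid_run hB₀ (M.f ω) t

lemma measurable_decision' (t : ℕ) : Measurable fun ω => decision 𝒳 B₀ (M.f ω) t :=
  (M.measurable_decision hB₀ hcl hcv h0 hG t).comp (M.measurable_toPast t)

lemma measurable_observed (t : ℕ) : Measurable fun ω => M.observed 𝒳 B₀ ω t :=
  measurable_gradient M.measurable_loss (M.measurable_ξ' t)
    (M.measurable_decision' hB₀ hcl hcv h0 hG t)
    fun ω => (hG _ _ (decision_mem hB₀ hcl h0 (M.f ω) t)).1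

lemma measurable_gradF_decision (t : ℕ) :
    Measurable fun ω => M.gradF ω t (decision 𝒳 B₀ (M.f ω) t) :=
  (measurable_integral_gradient_play (κ := M.law t) M.measurable_loss hG
    (M.measurable_decision hB₀ hcl hcv h0 hG t)
    fun ω => decision_mem hB₀ hcl h0 (M.f ω) t).comp (M.measurable_toPast t)

/-- The decision of round t + 1 depends on the label of round t and is not a function of the past of
round t. The kernel is therefore pulled back to the full σ-algebra; plain measurability is enough
here. -/
lemma measurable_prevGradF_decision (t : ℕ) :
    Measurable fun ω => M.prevGradF ω t (decision 𝒳 B₀ (M.f ω) t) := by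
  rcases t with _ | t
  · exact measurable_const
  · have hX : Measurable fun ω => decision 𝒳 B₀ (M.f ω) (t + 1) :=
      M.measurable_decision' hB₀ hcl hcv h0 hG (t + 1)
    have hκ : Measurable (M.toPast t) := M.measurable_toPast t
    exact measurable_integral_gradient_play (κ := (M.law t).comap (M.toPast t) hκ)
      M.measurable_loss hG hX fun ω => decision_mem hB₀ hcl h0 (M.f ω) (t + 1)

omit hcv in
lemma norm_observed_le (ω : Ω) (t : ℕ) : ‖M.observed 𝒳 B₀ ω t‖ ≤ G :=
  (hG _ _ (decision_mem hB₀ hcl h0 (M.f ω) t)).2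

omit hB₀ hcl hcv h0 in
lemma norm_gradF_le (ω : Ω) (t : ℕ) {x : E d} (hx : x ∈ 𝒳) : ‖M.gradF ω t x‖ ≤ G :=
  norm_integral_gradient_le (ν := M.law t (M.toPast t ω)) hG hx

omit hB₀ hcl hcv h0 in
lemma norm_prevGradF_le (ω : Ω) (t : ℕ) (hG0 : 0 ≤ G) {x : E d} (hx : x ∈ 𝒳) :
    ‖M.prevGradF ω t x‖ ≤ G := by
  rcases t with _ | t
  · simpa [prevGradF] using hG0
  · exact M.norm_gradF_le hG ω t hx

end SEA

end CLAOONS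

end

/-! ### From expected sums along the iterates to the cumulative quantities. -/

noncomputable section

namespace CLAOONS

open Filter

lemma integral_sum_le_toReal {Ω : Type*} {mΩ : MeasurableSpace Ω} {μ : Measure Ω}
    {Y : ℕ → Ω → ℝ} (hY : ∀ t, Measurable (Y t)) (h0 : ∀ t ω, 0 ≤ Y t ω) {T : ℕ} {I : ENNReal}
    (hI : I ≠ ⊤) (h : ∑ t ∈ Finset.range T, ∫⁻ ω, ENNReal.ofReal (Y t ω) ∂μ ≤ I) :
    ∫ ω, ∑ t ∈ Finset.range T, Y t ω ∂μ ≤ I.toReal := by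
  rw [integral_eq_lintegral_of_nonneg_ae
    (Eventually.of_forall fun ω => Finset.sum_nonneg fun t _ => h0 t ω)
    (Finset.measurable_sum _ fun t _ => hY t).aestronglyMeasurable]
  refine ENNReal.toReal_mono hI (le_trans (le_of_eq ?_) h)
  rw [← lintegral_finsetSum _ fun t _ => (hY t).ennreal_ofReal]
  exact lintegral_congr fun ω => ENNReal.ofReal_sum_of_nonneg fun t _ => h0 t ω

/-- Finiteness has to be known because the final bound uses `toReal`, which sends ⊤ to 0. -/
lemma lintegral_sum_iSup_ne_top {d : ℕ} {Ω : Type*} {mΩ : MeasurableSpace Ω} {μ : Measure Ω}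
    [IsFiniteMeasure μ] {𝒳 : Set (E d)} {φ : ℕ → Ω → E d → ENNReal} {c : ENNReal} (hc : c ≠ ⊤)
    (h : ∀ t ω, ∀ x ∈ 𝒳, φ t ω x ≤ c) (T : ℕ) :
    ∫⁻ ω, ∑ t ∈ Finset.range T, ⨆ x ∈ 𝒳, φ t ω x ∂μ ≠ ⊤ := by
  have h1 : ∫⁻ ω, ∑ t ∈ Finset.range T, ⨆ x ∈ 𝒳, φ t ω x ∂μ ≤ ∫⁻ _, T * c ∂μ := by
    refine lintegral_mono fun ω => ?_
    refine (Finset.sum_le_card_nsmul _ _ c fun t _ => iSup₂_le (h t ω)).trans ?_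
    simp
  refine (h1.trans_lt ?_).ne
  rw [lintegral_const]
  exact ENNReal.mul_lt_top (ENNReal.mul_lt_top (by simp) hc.lt_top) (measure_lt_top _ _)

/-- The suprema over 𝒳 are not known to be measurable. Sum and integral are exchanged only for the
values along the iterates, and monotonicity of the lower integral needs no measurability. -/
lemma sum_lintegral_le_lintegral_sum_iSup {d : ℕ} {Ω : Type*} {mΩ : MeasurableSpace Ω}
    {μ : Measure Ω} {𝒳 : Set (E d)} {φ : ℕ → Ω → E d → ENNReal} {x : ℕ → Ω → E d}
    (hx : ∀ t ω, x t ω ∈ 𝒳) (hm : ∀ t, Measurable fun ω => φ t ω (x t ω)) (T : ℕ) :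
    ∑ t ∈ Finset.range T, ∫⁻ ω, φ t ω (x t ω) ∂μ
      ≤ ∫⁻ ω, ∑ t ∈ Finset.range T, ⨆ x ∈ 𝒳, φ t ω x ∂μ := by
  rw [← lintegral_finsetSum _ fun t _ => hm t]
  exact lintegral_mono fun ω => Finset.sum_le_sum fun t _ =>
    le_iSup₂ (f := fun x (_ : x ∈ 𝒳) => φ t ω x) (x t ω) (hx t ω)

lemma enorm_le_ofReal {F : Type*} [SeminormedAddCommGroup F] {x : F} {c : ℝ} (h : ‖x‖ ≤ c) :
    ‖x‖ₑ ≤ ENNReal.ofReal c := by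
  rw [← ofReal_norm]
  exact ENNReal.ofReal_le_ofReal h

lemma integrable_sum_of_bound {Ω : Type*} {mΩ : MeasurableSpace Ω} {μ : Measure Ω}
    [IsFiniteMeasure μ] {Y : ℕ → Ω → ℝ} (hY : ∀ t, Measurable (Y t)) {c : ℝ}
    (h : ∀ t ω, ‖Y t ω‖ ≤ c) (T : ℕ) :
    Integrable (fun ω => ∑ t ∈ Finset.range T, Y t ω) μ ∧
      Integrable (fun ω => Real.sqrt (∑ t ∈ Finset.range T, Y t ω)) μ := by
  have hm : Measurable fun ω => ∑ t ∈ Finset.range T, Y t ω :=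
    Finset.measurable_sum _ fun t _ => hY t
  have hb : ∀ ω, ‖∑ t ∈ Finset.range T, Y t ω‖ ≤ T * c := fun ω =>
    (norm_sum_le_of_le _ fun t _ => h t ω).trans (by simp)
  refine ⟨Integrable.of_bound hm.aestronglyMeasurable _ (Eventually.of_forall hb),
    Integrable.of_bound hm.sqrt.aestronglyMeasurable (Real.sqrt (T * c))
      (Eventually.of_forall fun ω => ?_)⟩
  rw [Real.norm_of_nonneg (Real.sqrt_nonneg _)]
  exact Real.sqrt_le_sqrt ((le_abs_self _).trans (hb ω))

namespace SEA

variable {d : ℕ} {Ω Ξ : Type*} [MeasurableSpace Ω] [MeasurableSpace Ξ] {μ : Measure Ω}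
  (M : SEA d Ω Ξ μ) {𝒳 : Set (E d)} {B₀ G : ℝ}

instance (t : ℕ) (ω : Ω) : IsProbabilityMeasure (M.𝒟 t ω) := M.isProb t ω

section Finite

variable (hG : M.BoundedGradients 𝒳 G) (hG0 : 0 ≤ G)
include hG

lemma enorm_gradient_sub_gradF_le (ω : Ω) (t : ℕ) (ζ : Ξ) {x : E d} (hx : x ∈ 𝒳) :
    ‖gradient (M.loss ζ) x - M.gradF ω t x‖ₑ ≤ ENNReal.ofReal (G + G) :=
  enorm_le_ofReal (norm_sub_le_of_le (hG ζ x hx).2 (M.norm_gradF_le hG ω t hx))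

variable [IsFiniteMeasure μ]

lemma cumVariance_ne_top (T : ℕ) : M.cumVariance 𝒳 T ≠ ⊤ := by
  refine lintegral_sum_iSup_ne_top (c := ENNReal.ofReal (G + G) ^ 2) (by simp) ?_ T
  refine fun t ω x hx => (lintegral_mono fun ζ => pow_le_pow_left'
    (M.enorm_gradient_sub_gradF_le hG ω t ζ hx) 2).trans ?_
  simp

lemma cumDeviation_ne_top (T : ℕ) : M.cumDeviation 𝒳 T ≠ ⊤ := by
  refine lintegral_sum_iSup_ne_top (c := ENNReal.ofReal (G + G)) (by simp) ?_ T
  refine fun t ω x hx => (lintegral_mono fun ζ =>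
    M.enorm_gradient_sub_gradF_le hG ω t ζ hx).trans ?_
  simp

lemma cumMaxGrad_ne_top (T : ℕ) : M.cumMaxGrad 𝒳 T ≠ ⊤ :=
  lintegral_sum_iSup_ne_top (c := ENNReal.ofReal G) (by simp)
    (fun t ω _ hx => enorm_le_ofReal (M.norm_gradF_le hG ω t hx)) T

include hG0 in
lemma cumVariation_ne_top (T : ℕ) : M.cumVariation 𝒳 T ≠ ⊤ :=
  lintegral_sum_iSup_ne_top (c := ENNReal.ofReal (G + G) ^ 2) (by simp)
    (fun t ω _ hx => pow_le_pow_left' (enorm_le_ofReal (norm_sub_le_of_le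
      (M.norm_gradF_le hG ω t hx) (M.norm_prevGradF_le hG ω t hG0 hx))) 2) T

end Finite

section Bounds

variable [IsProbabilityMeasure μ] (hB₀ : 0 < B₀) (hcl : IsClosed 𝒳) (hcv : _root_.Convex ℝ 𝒳)
  (h0 : 0 ∈ 𝒳) (hG : M.BoundedGradients 𝒳 G)
include hB₀ hcl hcv h0 hG

lemma lintegral_deviation_eq (t r : ℕ) :
    ∫⁻ ω, ‖M.observed 𝒳 B₀ ω t - M.gradF ω t (decision 𝒳 B₀ (M.f ω) t)‖ₑ ^ r ∂μ
      = ∫⁻ ω, ∫⁻ ζ, ‖gradient (M.loss ζ) (decision 𝒳 B₀ (M.f ω) t)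
        - M.gradF ω t (decision 𝒳 B₀ (M.f ω) t)‖ₑ ^ r ∂(M.𝒟 t ω) ∂μ :=
  lintegral_deviation_round_eq (M.measurable_toPast t) (M.measurable_ξ' t) (M.map_toPast_ξ t)
    M.measurable_loss hG (M.measurable_decision hB₀ hcl hcv h0 hG t)
    (fun ω => decision_mem hB₀ hcl h0 (M.f ω) t) r

omit [IsProbabilityMeasure μ] in
lemma measurable_lintegral_deviation (t r : ℕ) :
    Measurable fun ω => ∫⁻ ζ, ‖gradient (M.loss ζ) (decision 𝒳 B₀ (M.f ω) t)
        - M.gradF ω t (decision 𝒳 B₀ (M.f ω) t)‖ₑ ^ r ∂(M.𝒟 t ω) :=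
  measurable_lintegral_deviation_round (κ := M.law t) (M.measurable_toPast t)
    M.measurable_loss hG (M.measurable_decision hB₀ hcl hcv h0 hG t)
    (fun ω => decision_mem hB₀ hcl h0 (M.f ω) t) r

omit [IsProbabilityMeasure μ] in
lemma measurable_deviation (t : ℕ) :
    Measurable fun ω => M.observed 𝒳 B₀ ω t - M.gradF ω t (decision 𝒳 B₀ (M.f ω) t) :=
  (M.measurable_observed hB₀ hcl hcv h0 hG t).sub
    (M.measurable_gradF_decision hB₀ hcl hcv h0 hG t)

omit [IsProbabilityMeasure μ] in
lemma measurable_variation (t : ℕ) :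
    Measurable fun ω => M.gradF ω t (decision 𝒳 B₀ (M.f ω) t)
      - M.prevGradF ω t (decision 𝒳 B₀ (M.f ω) t) :=
  (M.measurable_gradF_decision hB₀ hcl hcv h0 hG t).sub
    (M.measurable_prevGradF_decision hB₀ hcl hcv h0 hG t)

lemma integral_sum_deviation_sq_le (T : ℕ) :
    ∫ ω, ∑ t ∈ Finset.range T,
        ‖M.observed 𝒳 B₀ ω t - M.gradF ω t (decision 𝒳 B₀ (M.f ω) t)‖ ^ 2 ∂μ
      ≤ (M.cumVariance 𝒳 T).toReal := by
  refine integral_sum_le_toReal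
    (fun t => (M.measurable_deviation hB₀ hcl hcv h0 hG t).norm.pow_const 2)
    (fun t ω => sq_nonneg _) (M.cumVariance_ne_top hG T) ?_
  simp only [ENNReal.ofReal_pow (norm_nonneg _), ofReal_norm]
  simp only [M.lintegral_deviation_eq hB₀ hcl hcv h0 hG]
  exact sum_lintegral_le_lintegral_sum_iSup
    (fun t ω => decision_mem hB₀ hcl h0 (M.f ω) t)
    (fun t => M.measurable_lintegral_deviation hB₀ hcl hcv h0 hG t 2) T

lemma integral_sum_variation_sq_le (hG0 : 0 ≤ G) (T : ℕ) :
    ∫ ω, ∑ t ∈ Finset.range T, ‖M.gradF ω t (decision 𝒳 B₀ (M.f ω) t)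
        - M.prevGradF ω t (decision 𝒳 B₀ (M.f ω) t)‖ ^ 2 ∂μ
      ≤ (M.cumVariation 𝒳 T).toReal := by
  have hm := M.measurable_variation hB₀ hcl hcv h0 hG
  refine integral_sum_le_toReal (fun t => (hm t).norm.pow_const 2)
    (fun t ω => sq_nonneg _) (M.cumVariation_ne_top hG hG0 T) ?_
  simp only [ENNReal.ofReal_pow (norm_nonneg _), ofReal_norm]
  exact sum_lintegral_le_lintegral_sum_iSup
    (fun t ω => decision_mem hB₀ hcl h0 (M.f ω) t) (fun t => (hm t).enorm.pow_const 2) T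

/-- Split the observed gradient into deviation and conditional mean; the first part is averaged
given the past. -/
lemma integral_sum_observed_le (T : ℕ) :
    ∫ ω, ∑ t ∈ Finset.range T, ‖M.observed 𝒳 B₀ ω t‖ ∂μ
      ≤ (M.cumDeviation 𝒳 T).toReal + (M.cumMaxGrad 𝒳 T).toReal := by
  have hp := M.measurable_gradF_decision hB₀ hcl hcv h0 hG
  rw [← ENNReal.toReal_add (M.cumDeviation_ne_top hG T) (M.cumMaxGrad_ne_top hG T)]
  refine integral_sum_le_toReal (fun t => (M.measurable_observed hB₀ hcl hcv h0 hG t).norm)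
    (fun t ω => norm_nonneg _)
    (ENNReal.add_ne_top.2 ⟨M.cumDeviation_ne_top hG T, M.cumMaxGrad_ne_top hG T⟩) ?_
  simp only [ofReal_norm]
  have h1 : ∀ t, ∫⁻ ω, ‖M.observed 𝒳 B₀ ω t‖ₑ ∂μ
      ≤ ∫⁻ ω, ∫⁻ ζ, ‖gradient (M.loss ζ) (decision 𝒳 B₀ (M.f ω) t)
          - M.gradF ω t (decision 𝒳 B₀ (M.f ω) t)‖ₑ ∂(M.𝒟 t ω) ∂μ
        + ∫⁻ ω, ‖M.gradF ω t (decision 𝒳 B₀ (M.f ω) t)‖ₑ ∂μ := by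
    intro t
    have h2 := M.lintegral_deviation_eq hB₀ hcl hcv h0 hG t 1
    simp only [pow_one] at h2
    rw [← h2, ← lintegral_add_right _ (hp t).enorm]
    refine lintegral_mono fun ω => ?_
    simpa using enorm_add_le (M.observed 𝒳 B₀ ω t - M.gradF ω t (decision 𝒳 B₀ (M.f ω) t))
      (M.gradF ω t (decision 𝒳 B₀ (M.f ω) t))
  refine (Finset.sum_le_sum fun t _ => h1 t).trans ?_
  rw [Finset.sum_add_distrib]
  refine add_le_add (sum_lintegral_le_lintegral_sum_iSup
    (fun t ω => decision_mem hB₀ hcl h0 (M.f ω) t) (fun t => ?_) T)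
    (sum_lintegral_le_lintegral_sum_iSup
    (fun t ω => decision_mem hB₀ hcl h0 (M.f ω) t) (fun t => (hp t).enorm) T)
  simpa only [pow_one] using M.measurable_lintegral_deviation hB₀ hcl hcv h0 hG t 1

omit [IsProbabilityMeasure μ] hcv in
lemma norm_decision_le_horizon (ω : Ω) (t : ℕ) :
    ‖decision 𝒳 B₀ (M.f ω) t‖ ≤ max 1 (2 * Real.sqrt t) :=
  norm_decision_le hB₀ hcl h0 (M.f ω) (M.norm_observed_le hB₀ hcl h0 hG ω) t

variable {u : E d} (hu : u ∈ 𝒳)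
include hu

lemma integrable_round (t : ℕ) :
    Integrable (fun ω => M.f ω t (decision 𝒳 B₀ (M.f ω) t) - M.f ω t u) μ := by
  have hm : Measurable fun ω => M.f ω t (decision 𝒳 B₀ (M.f ω) t) - M.f ω t u :=
    (M.measurable_loss.comp ((M.measurable_ξ' t).prodMk
      (M.measurable_decision' hB₀ hcl hcv h0 hG t))).sub
      (M.measurable_loss.comp ((M.measurable_ξ' t).prodMk measurable_const))
  refine Integrable.of_bound hm.aestronglyMeasurable (G * (max 1 (2 * Real.sqrt t) + ‖u‖))
    (Eventually.of_forall fun ω => ?_)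
  refine (abs_sub_le_of_gradient_le hcv (hG (M.ξ t ω)) hu
    (decision_mem hB₀ hcl h0 (M.f ω) t)).trans ?_
  exact mul_le_mul_of_nonneg_left (norm_sub_le_of_le
    (M.norm_decision_le_horizon hB₀ hcl h0 hG ω t) le_rfl)
    ((norm_nonneg _).trans (M.norm_observed_le hB₀ hcl h0 hG ω t))

omit hu in
lemma integrable_linearized_round (t : ℕ) :
    Integrable (fun ω => (inner ℝ (M.observed 𝒳 B₀ ω t)
      (decision 𝒳 B₀ (M.f ω) t - u) : ℝ)) μ := by
  have hm : Measurable fun ω => (inner ℝ (M.observed 𝒳 B₀ ω t)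
      (decision 𝒳 B₀ (M.f ω) t - u) : ℝ) :=
    (M.measurable_observed hB₀ hcl hcv h0 hG t).inner
      ((M.measurable_decision' hB₀ hcl hcv h0 hG t).sub measurable_const)
  refine Integrable.of_bound hm.aestronglyMeasurable (G * (max 1 (2 * Real.sqrt t) + ‖u‖))
    (Eventually.of_forall fun ω => ?_)
  have hg := M.norm_observed_le hB₀ hcl h0 hG ω t
  exact (norm_inner_le_norm _ _).trans (mul_le_mul hg (norm_sub_le_of_le
    (M.norm_decision_le_horizon hB₀ hcl h0 hG ω t) le_rfl) (norm_nonneg _)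
    ((norm_nonneg _).trans hg))

lemma integrable_regret (T : ℕ) : Integrable (M.regret 𝒳 B₀ T u) μ := by
  have := integrable_finsetSum (Finset.range T) fun t _ =>
    M.integrable_round hB₀ hcl hcv h0 hG hu t
  simp only [Finset.sum_sub_distrib] at this
  exact this

lemma integral_regret_le_linearized {T : ℕ} (hF : M.Convex 𝒳 T) :
    ∫ ω, M.regret 𝒳 B₀ T u ω ∂μ ≤ ∫ ω, ∑ t ∈ Finset.range T,
      inner ℝ (M.observed 𝒳 B₀ ω t) (decision 𝒳 B₀ (M.f ω) t - u) ∂μ := by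
  simp only [regret, ← Finset.sum_sub_distrib]
  rw [integral_finsetSum _ fun t _ => M.integrable_round hB₀ hcl hcv h0 hG hu t,
    integral_finsetSum _ fun t _ => M.integrable_linearized_round (u := u) hB₀ hcl hcv h0 hG t]
  refine Finset.sum_le_sum fun t ht => ?_
  exact integral_regret_round_le (M.measurable_toPast t) (M.measurable_ξ' t) (M.map_toPast_ξ t)
    M.measurable_loss hG (M.measurable_decision hB₀ hcl hcv h0 hG t)
    (fun ω => decision_mem hB₀ hcl h0 (M.f ω) t) hcv hu
    (M.norm_decision_le_horizon hB₀ hcl h0 hG · t) (hF t (Finset.mem_range.1 ht))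

end Bounds

end SEA

end CLAOONS

end

/-! ### The regret bound in expectation. -/

theorem theorem4 (d : ℕ) (L B₀ G₀ : ℝ) (hL : 0 ≤ L) (hB₀ : 0 < B₀) (hG₀ : 0 < G₀) :
    ∃ (C : ℝ) (k : ℕ),
      ∀ (Ω Ξ : Type*) [MeasurableSpace Ω] [MeasurableSpace Ξ]
        (μ : Measure Ω) [IsProbabilityMeasure μ]
        (𝒳 : Set (CLAOONS.E d)) (M : CLAOONS.SEA d Ω Ξ μ) (G : ℝ) (T : ℕ) (u : CLAOONS.E d),
        IsClosed 𝒳 → Convex ℝ 𝒳 → 0 ∈ 𝒳 → u ∈ 𝒳 → G₀ ≤ G →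
        M.BoundedGradients 𝒳 G → M.Smooth 𝒳 L T → M.Convex 𝒳 T →
        Integrable (M.regret 𝒳 B₀ T u) μ ∧
        ∫ ω, M.regret 𝒳 B₀ T u ω ∂μ ≤
          C * (1 + Real.log T) ^ k *
            (‖u‖ ^ 2 * (Real.sqrt (M.cumVariance 𝒳 T).toReal
                + Real.sqrt (M.cumVariation 𝒳 T).toReal)
              + G ^ 2 * ‖u‖ ^ 2 + ‖u‖ ^ 4 + G * ‖u‖ ^ 3
              + G ^ 2 * Real.sqrt ((M.cumDeviation 𝒳 T).toReal
                + (M.cumMaxGrad 𝒳 T).toReal)) := by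
  obtain ⟨C, hC, hpath⟩ := CLAOONS.exists_pathwise_regret_bound d hL hB₀ hG₀
  refine ⟨C, 2, ?_⟩
  intro Ω Ξ _ _ μ _ 𝒳 M G T u hcl hcv h0 hu hG hb hsm hF
  refine ⟨M.integrable_regret hB₀ hcl hcv h0 hb hu T, ?_⟩
  have hG0 : 0 < G := hG₀.trans_le hG
  -- The pathwise bound needs T ≥ 1; for T = 0 the regret is 0 and `Real.log 0 = 0` agrees with the
  -- convention of the theorem.
  rcases T.eq_zero_or_pos with rfl | hT
  · simp only [CLAOONS.SEA.regret, Finset.range_zero, Finset.sum_empty, sub_zero, integral_zero,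
      Nat.cast_zero, Real.log_zero]
    positivity
  set x : Ω → ℕ → CLAOONS.E d := fun ω t => CLAOONS.decision 𝒳 B₀ (M.f ω) t with hx
  have hx𝒳 : ∀ ω t, x ω t ∈ 𝒳 := fun ω t => CLAOONS.decision_mem hB₀ hcl h0 (M.f ω) t
  have hgG := fun ω t => M.norm_observed_le hB₀ hcl h0 hb ω t
  have hae : ∀ᵐ ω ∂μ, ∑ t ∈ Finset.range T, inner ℝ (M.observed 𝒳 B₀ ω t) (x ω t - u)
      ≤ C * (1 + Real.log T) ^ 2 *
          (‖u‖ ^ 2 * (Real.sqrt (∑ t ∈ Finset.range T,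
              ‖M.observed 𝒳 B₀ ω t - M.gradF ω t (x ω t)‖ ^ 2)
            + Real.sqrt (∑ t ∈ Finset.range T,
              ‖M.gradF ω t (x ω t) - M.prevGradF ω t (x ω t)‖ ^ 2))
            + G ^ 2 * ‖u‖ ^ 2 + ‖u‖ ^ 4 + G * ‖u‖ ^ 3
            + G ^ 2 * Real.sqrt (∑ t ∈ Finset.range T, ‖M.observed 𝒳 B₀ ω t‖)) := by
    filter_upwards [(ae_all_iff.2 fun t => ae_all_iff.2 fun h => hsm t h :
      ∀ᵐ ω ∂μ, ∀ t, t < T → ∀ x ∈ 𝒳, ∀ y ∈ 𝒳,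
        ‖M.gradF ω t x - M.gradF ω t y‖ ≤ L * ‖x - y‖)] with ω hω
    have htr : ∀ t, (CLAOONS.trajectory 𝒳 B₀ (M.observed 𝒳 B₀ ω) t).play 𝒳 = x ω t := fun t =>
      (congrArg (CLAOONS.State.play · 𝒳) (CLAOONS.run_eq_trajectory (M.f ω) t)).symm
    have h := hpath 𝒳 G (M.observed 𝒳 B₀ ω) (fun t => M.gradF ω t (x ω t))
      (fun t => M.prevGradF ω t (x ω t)) u T hcl hcv h0 hu hG hT (hgG ω) fun t ht => by
        rw [htr, htr]
        -- `prevGradF` at round t + 1 is the mean gradient of round t, so smoothness of the same F_t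
        -- compares its values at the two successive decisions.
        exact hω t (Nat.lt_of_succ_lt ht) _ (hx𝒳 ω (t + 1)) _ (hx𝒳 ω t)
    simpa only [htr] using h
  obtain ⟨hN, hN'⟩ := CLAOONS.integrable_sum_of_bound (μ := μ)
    (fun t => (M.measurable_deviation hB₀ hcl hcv h0 hb t).norm.pow_const 2)
    (c := (G + G) ^ 2) (fun t ω => by
      rw [Real.norm_of_nonneg (sq_nonneg _)]
      exact pow_le_pow_left₀ (norm_nonneg _)
        (norm_sub_le_of_le (hgG ω t) (M.norm_gradF_le hb ω t (hx𝒳 ω t))) 2) T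
  obtain ⟨hV, hV'⟩ := CLAOONS.integrable_sum_of_bound (μ := μ)
    (fun t => (M.measurable_variation hB₀ hcl hcv h0 hb t).norm.pow_const 2)
    (c := (G + G) ^ 2) (fun t ω => by
      rw [Real.norm_of_nonneg (sq_nonneg _)]
      exact pow_le_pow_left₀ (norm_nonneg _) (norm_sub_le_of_le
        (M.norm_gradF_le hb ω t (hx𝒳 ω t)) (M.norm_prevGradF_le hb ω t hG0.le (hx𝒳 ω t))) 2) T
  obtain ⟨hS, hS'⟩ := CLAOONS.integrable_sum_of_bound (μ := μ)
    (fun t => (M.measurable_observed hB₀ hcl hcv h0 hb t).norm)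
    (c := G) (fun t ω => by
      rw [norm_norm]
      exact hgG ω t) T
  have bN := (CLAOONS.integral_sqrt_le hN
    (fun ω => Finset.sum_nonneg fun t _ => sq_nonneg _) hN').trans
    (Real.sqrt_le_sqrt (M.integral_sum_deviation_sq_le hB₀ hcl hcv h0 hb T))
  have bV := (CLAOONS.integral_sqrt_le hV
    (fun ω => Finset.sum_nonneg fun t _ => sq_nonneg _) hV').trans
    (Real.sqrt_le_sqrt (M.integral_sum_variation_sq_le hB₀ hcl hcv h0 hb hG0.le T))
  have bS := (CLAOONS.integral_sqrt_le hS
    (fun ω => Finset.sum_nonneg fun t _ => norm_nonneg _) hS').trans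
    (Real.sqrt_le_sqrt (M.integral_sum_observed_le hB₀ hcl hcv h0 hb T))
  have hlog : 0 ≤ Real.log T := Real.log_natCast_nonneg T
  have i1 := (hN'.add hV').const_mul (‖u‖ ^ 2)
  have i2 := ((i1.add (integrable_const (G ^ 2 * ‖u‖ ^ 2))).add
    (integrable_const (‖u‖ ^ 4))).add (integrable_const (G * ‖u‖ ^ 3))
  have i3 := hS'.const_mul (G ^ 2)
  refine (M.integral_regret_le_linearized hB₀ hcl hcv h0 hb hu hF).trans
    ((integral_mono_ae (integrable_finsetSum _ fun t _ =>
      M.integrable_linearized_round (u := u) hB₀ hcl hcv h0 hb t)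
      ((i2.add i3).const_mul (C * (1 + Real.log T) ^ 2)) hae).trans ?_)
  rw [integral_const_mul]
  refine mul_le_mul_of_nonneg_left ?_ (by positivity)
  rw [integral_add' i2 i3, integral_add', integral_add', integral_add' i1 (integrable_const _),
    integral_const_mul, integral_const_mul, integral_add' hN' hV', integral_const, integral_const,
    integral_const, probReal_univ, one_smul, one_smul, one_smul]
  · rw [integral_const_mul]
    gcongr
  · exact i1.add (integrable_const _)
  · exact integrable_const _
  · exact (i1.add (integrable_const _)).add (integrable_const _)
  · exact integrable_const _
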